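/- Let $n\ge 1$, $\sigma\in(-1,1)$, and let $\mathbf e$ be the vertical unit vector of $\mathbb R^{n+1}$ (half-space model of $\mathbb H^{n+1}$). Let $\Gamma=\{e^{\phi(\omega)}\omega:\ \omega\in\mathbb S^{n-1}\}\subset\mathbb R^n\times\{0\}$ with $\phi\in C^{1+1}(\mathbb S^{n-1})$ be the boundary of a star-shaped $C^{1+1}$ domain. For $\epsilon>0$ let $\Gamma_\epsilon$ be its lift to $\{x_{n+1}=\epsilon\}$, $D_\epsilon\subset\{x_{n+1}=\epsilon\}$ the open domain enclosed by $\Gamma_\epsilon$, and $\Omega_\epsilon\subset\mathbb S^n_+$ the radial projection of $D_\epsilon$ to the unit sphere, so that $\Gamma_\epsilon$ is a radial graph over $\partial\Omega_\epsilon$. For $0<\epsilon<\epsilon_0$ let $\Sigma_0^\epsilon=\{e^{v_0^\epsilon(\mathbf z)}\mathbf z:\mathbf z\in\overline{\Omega_\epsilon}\}$ with $v_0^\epsilon\in C^{1+1}(\overline{\Omega_\epsilon})$ and $\partial\Sigma_0^\epsilon=\Gamma_\epsilon$. Suppose that the $v_0^\epsilon$ are Lipschitz on $\overline{\Omega_\epsilon}$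 with a constant independent of $\epsilon$, and that the $\Sigma_0^\epsilon$ satisfy the uniform local ball condition: there are $r,\delta>0$ and $\Lambda$, independent of $\epsilon$, such that for all $\epsilon\in(0,\epsilon_0)$ and $P\in\Gamma_\epsilon$ there are closed balls $B_1$, $B_2$ of radii $R_1,R_2\ge r$ with centres $(a',-\sigma R_1)$ and $(b',\sigma R_2)$ and with $P\in\partial B_1\cap\partial B_2$, such that $B_1\cap\{x_{n+1}=\epsilon\}\subset \overline{D_\epsilon}$ and $B_2\cap D_\epsilon=\emptyset$ (internal and external tangency to $\Gamma_\epsilon$ at $P$), $\Sigma_0^\epsilon\cap B_\delta(P)\cap B_i=\{P\}$, and $\partial B_i\cap B_\delta(P)\cap\{x_{n+1}>0\}$ is a radial graph $e^{\varphi}\mathbf z$ with $\varphi$ Lipschitz with constant $\Lambda$ ($i=1,2$). A regular solution for $\epsilon$ is a function $v^\epsilon\in C^\infty(\Omega_\epsilon\times(0,\infty))\cap C^{0+1,0+\frac12}(\overline{\Omega_\epsilon}\times(0,\infty))\cap C^0(\overline{\Omega_\epsilon}\times[0,\infty))$ (the middle class meaning: locally uniformly in $t\in(0,\infty)$) with $$\frac{\partial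 v}{\partial t}=\frac{y^2}{n}a^{ij}v_{ij}-y\,\mathbf e\cdot\nabla v-\sigma y w\quad\text{in }\Omega_\epsilon\times(0,\infty),$$ $v(\cdot,0)=v_0^\epsilon$ on $\Omega_\epsilon$, and $e^{v(\mathbf z,t)}\mathbf z\in\Gamma_\epsilon$ for $(\mathbf z,t)\in\partial\Omega_\epsilon\times[0,\infty)$. Here $y=\mathbf e\cdot\mathbf z$, $\nabla$ is the covariant derivative of the unit sphere with metric $\gamma$, $w=(1+|\nabla v|^2)^{1/2}$ and $a^{ij}=\gamma^{ij}-v^iv^j/w^2$. Then there are a constant $C$ and $\epsilon_1\in(0,\epsilon_0]$ such that for every $\epsilon\in(0,\epsilon_1)$ every regular solution $v^\epsilon$ satisfies $$|\nabla v^\epsilon(\mathbf z,t)|\le C\qquad\text{for all }(\mathbf z,t)\in\overline{\Omega_\epsilon}\times[0,\infty);$$ $C$ does not depend on $\epsilon$. At $\mathbf z\in\Omega_\epsilon$ the gradient exists in the classical sense. At $\mathbf z\in\partial\Omega_\epsilon$ the bound means that $|v^\epsilon(\mathbf x,t)-v^\epsilon(\mathbf z,t)|\le C|\mathbf x-\mathbf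 z|$ for all $\mathbf x\in\overline{\Omega_\epsilon}$ close enough to $\mathbf z$, and that any gradient of $v^\epsilon(\cdot,t)$ at $\mathbf z$ from within $\overline{\Omega_\epsilon}$ has norm at most $C$. -/

import Mathlib

open Set Filter Topology

noncomputable section

namespace HypFlow

/-- The ambient space `ℝⁿ⁺¹`; its last coordinate is the height, and the half-space model of
hyperbolic space is the set of points of positive height. -/
abbrev Amb (n : ℕ) := EuclideanSpace ℝ (Fin (n + 1))

/-- The horizontal space `ℝⁿ`. -/
abbrev Hor (n : ℕ) := EuclideanSpace ℝ (Fin n)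

/-- The point `(x', h)` of `ℝⁿ⁺¹`. -/
def pt {n : ℕ} (x' : Hor n) (h : ℝ) : Amb n :=
  WithLp.toLp 2 (Fin.snoc (α := fun _ => ℝ) (fun i => x' i) h)

/-- The vertical unit vector `e`. -/
def vert (n : ℕ) : Amb n := EuclideanSpace.single (Fin.last n) 1

/-- The height `e · X`; for a point `z` of the unit sphere this is the function `y`. -/
def height {n : ℕ} (X : Amb n) : ℝ := inner ℝ (vert n) X

/-! ### Calculus on the unit sphere

A function on (a subset of) the unit sphere is differentiated through its extension that is
constant along rays. At a point `z` of the sphere the Euclidean gradient of this extension is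
tangent to the sphere and is the covariant gradient; its second derivative, on tangent vectors,
is the covariant Hessian (the radial derivative vanishes, so the second fundamental form does not
contribute). -/

/-- Radial projection to the unit sphere. -/
def proj {E : Type*} [NormedAddCommGroup E] [NormedSpace ℝ E] (x : E) : E := ‖x‖⁻¹ • x

/-- The extension of `f`, given on the unit sphere, that is constant along rays. -/
def radialExt {E : Type*} [NormedAddCommGroup E] [NormedSpace ℝ E] (f : E → ℝ) (x : E) : ℝ :=
  f (proj x)

/-- The covariant gradient `∇f` on the unit sphere, as a vector of `ℝⁿ⁺¹` tangent at `z`. -/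
def sphereGrad {n : ℕ} (f : Amb n → ℝ) (z : Amb n) : Amb n := gradient (radialExt f) z

/-- The covariant Hessian on the unit sphere, evaluated on tangent vectors `a`, `b` at `z`. -/
def sphereHess {n : ℕ} (f : Amb n → ℝ) (z a b : Amb n) : ℝ :=
  fderiv ℝ (fderiv ℝ (radialExt f)) z a b

/-- The Laplace-Beltrami operator `γ^{ij} f_{ij}` of the unit sphere: the trace of the Hessian.
The trace may be taken over an orthonormal basis of all of `ℝⁿ⁺¹`, since the second derivative of
the extension in the radial direction is zero. -/
def sphereLaplacian {n : ℕ} (f : Amb n → ℝ) (z : Amb n) : ℝ :=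
  ∑ i : Fin (n + 1), sphereHess f z (EuclideanSpace.single i 1) (EuclideanSpace.single i 1)

/-- `w = (1 + |∇f|²)^{1/2}`. -/
def slopeFactor {n : ℕ} (f : Amb n → ℝ) (z : Amb n) : ℝ := Real.sqrt (1 + ‖sphereGrad f z‖ ^ 2)

/-- `a^{ij} f_{ij}`, where `a^{ij} = γ^{ij} - f^i f^j / w²`. -/
def aHess {n : ℕ} (f : Amb n → ℝ) (z : Amb n) : ℝ :=
  sphereLaplacian f z - sphereHess f z (sphereGrad f z) (sphereGrad f z) / slopeFactor f z ^ 2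

/-- The right-hand side `y² a^{ij} f_{ij} / n - y e·∇f - σ y w` of the modified mean curvature
flow for radial graphs; it equals `y w (H - σ)`, with `H` the hyperbolic mean curvature of the
radial graph of `e^f`. -/
def flowRHS {n : ℕ} (σ : ℝ) (f : Amb n → ℝ) (z : Amb n) : ℝ :=
  height z ^ 2 * aHess f z / n - height z * inner ℝ (vert n) (sphereGrad f z)
    - σ * height z * slopeFactor f z

/-- `f` is of class `C^{1+1}` on the subset `S` of the unit sphere, up to the boundary:
differentiable, with Lipschitz gradient. -/
def IsC11On {E : Type*} [NormedAddCommGroup E] [NormedSpace ℝ E] (f : E → ℝ) (S : Set E) : Prop :=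
  (∀ z ∈ S, DifferentiableAt ℝ (radialExt f) z) ∧
    ∃ K : NNReal, LipschitzOnWith K (fderiv ℝ (radialExt f)) S

/-! ### The domains -/

/-- `Γ_ε`: the boundary `Γ = {e^{φ(ω)} ω : |ω| = 1}` of the star-shaped domain, lifted to the
height `ε`. -/
def liftedBoundary {n : ℕ} (φ : Hor n → ℝ) (ε : ℝ) : Set (Amb n) :=
  {X | ∃ ω : Hor n, ‖ω‖ = 1 ∧ X = pt (Real.exp (φ ω) • ω) ε}

/-- `D_ε`: the open star-shaped domain enclosed by `Γ_ε` in the plane of height `ε`. -/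
def liftedDomain {n : ℕ} (φ : Hor n → ℝ) (ε : ℝ) : Set (Amb n) :=
  {X | ∃ ω : Hor n, ‖ω‖ = 1 ∧ ∃ s ∈ Ico (0 : ℝ) 1, X = pt ((s * Real.exp (φ ω)) • ω) ε}

/-- `Ω_ε`: the domain of the upper unit hemisphere over whose boundary `Γ_ε` is a radial graph,
that is, the radial projection of `D_ε`. -/
def sphereDomain {n : ℕ} (φ : Hor n → ℝ) (ε : ℝ) : Set (Amb n) := proj '' liftedDomain φ ε

/-- `∂Ω_ε`, the boundary relative to the sphere, in which `Ω_ε` is open. -/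
def sphereBoundary {n : ℕ} (φ : Hor n → ℝ) (ε : ℝ) : Set (Amb n) :=
  closure (sphereDomain φ ε) \ sphereDomain φ ε

/-- The radial graph of `e^f` over `S`. -/
def radialGraph {n : ℕ} (f : Amb n → ℝ) (S : Set (Amb n)) : Set (Amb n) :=
  (fun z => Real.exp (f z) • z) '' S

/-! ### The uniform local ball condition -/

/-- The part of the set `S` at positive height is a Lipschitz radial graph with constant `Λ`. -/
def IsLipschitzRadialGraph {n : ℕ} (Λ : ℝ) (S : Set (Amb n)) : Prop :=
  ∀ X ∈ S, ∀ Y ∈ S, 0 < height X → 0 < height Y →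
    |Real.log ‖X‖ - Real.log ‖Y‖| ≤ Λ * ‖proj X - proj Y‖

/-- The interior ball condition at `P ∈ Γ_ε` for the hypersurface `S`: a ball of radius
`R ≥ r` with centre `(a', -σ R)` whose section at height `ε` is internally tangent to `Γ_ε` at
`P`, which meets `S` near `P` only at `P`, and whose boundary near `P` is a Lipschitz radial
graph. -/
def InteriorBallAt {n : ℕ} (σ : ℝ) (φ : Hor n → ℝ) (ε r δ Λ : ℝ) (S : Set (Amb n))
    (P : Amb n) : Prop :=
  ∃ R : ℝ, r ≤ R ∧ ∃ a' : Hor n,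
    P ∈ Metric.sphere (pt a' (-σ * R)) R ∧
    Metric.closedBall (pt a' (-σ * R)) R ∩ {X | height X = ε}
      ⊆ liftedDomain φ ε ∪ liftedBoundary φ ε ∧
    S ∩ Metric.ball P δ ∩ Metric.closedBall (pt a' (-σ * R)) R = {P} ∧
    IsLipschitzRadialGraph Λ (Metric.sphere (pt a' (-σ * R)) R ∩ Metric.ball P δ)

/-- The exterior ball condition at `P ∈ Γ_ε` for the hypersurface `S`: a ball of radius
`R ≥ r` with centre `(b', σ R)` whose section at height `ε` is externally tangent to `Γ_ε` at
`P`, which meets `S` near `P` only at `P`, and whose boundary near `P` is a Lipschitz radial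
graph. -/
def ExteriorBallAt {n : ℕ} (σ : ℝ) (φ : Hor n → ℝ) (ε r δ Λ : ℝ) (S : Set (Amb n))
    (P : Amb n) : Prop :=
  ∃ R : ℝ, r ≤ R ∧ ∃ b' : Hor n,
    P ∈ Metric.sphere (pt b' (σ * R)) R ∧
    Disjoint (Metric.closedBall (pt b' (σ * R)) R) (liftedDomain φ ε) ∧
    S ∩ Metric.ball P δ ∩ Metric.closedBall (pt b' (σ * R)) R = {P} ∧
    IsLipschitzRadialGraph Λ (Metric.sphere (pt b' (σ * R)) R ∩ Metric.ball P δ)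

/-- The uniform local ball condition for the initial hypersurfaces `Σ_0^ε`, `0 < ε < ε₀`, the
radial graphs of `e^{v₀ ε}`: the lower bound `r` of the radii, the size `δ` of the neighbourhoods
and the Lipschitz constant `Λ` depend neither on `ε` nor on the boundary point. -/
def UniformLocalBall {n : ℕ} (σ : ℝ) (φ : Hor n → ℝ) (ε₀ : ℝ) (v₀ : ℝ → Amb n → ℝ) : Prop :=
  ∃ r δ Λ : ℝ, 0 < r ∧ 0 < δ ∧ ∀ ε ∈ Ioo 0 ε₀, ∀ P ∈ liftedBoundary φ ε,
    InteriorBallAt σ φ ε r δ Λ (radialGraph (v₀ ε) (closure (sphereDomain φ ε))) P ∧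
    ExteriorBallAt σ φ ε r δ Λ (radialGraph (v₀ ε) (closure (sphereDomain φ ε))) P

/-! ### The approximate flow -/

/-- `v` is a regular solution, on `Ω_ε × [0, ∞)`, of the approximate modified mean curvature flow
for radial graphs with initial datum `f₀` and boundary `Γ_ε`. -/
structure IsRegularSolution {n : ℕ} (σ : ℝ) (φ : Hor n → ℝ) (ε : ℝ) (f₀ : Amb n → ℝ)
    (v : Amb n → ℝ → ℝ) : Prop where
  /-- `v ∈ C^∞(Ω_ε × (0, ∞))` -/
  smooth : ∀ z ∈ sphereDomain φ ε, ∀ t : ℝ, 0 < t →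
    ContDiffAt ℝ (⊤ : ℕ∞) (fun p : Amb n × ℝ => v (proj p.1) p.2) (z, t)
  /-- `v ∈ C^{0+1, 0+1/2}(closure Ω_ε × (0, ∞))` -/
  lipschitz : ∀ a b : ℝ, 0 < a → a ≤ b → ∃ K : ℝ,
    ∀ z ∈ closure (sphereDomain φ ε), ∀ z' ∈ closure (sphereDomain φ ε),
      ∀ t ∈ Icc a b, ∀ t' ∈ Icc a b,
        |v z t - v z' t'| ≤ K * (‖z - z'‖ + Real.sqrt |t - t'|)
  /-- `v ∈ C^0(closure Ω_ε × [0, ∞))` -/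
  continuous : ContinuousOn (fun p : Amb n × ℝ => v p.1 p.2)
    (closure (sphereDomain φ ε) ×ˢ Ici 0)
  /-- the evolution equation -/
  equation : ∀ z ∈ sphereDomain φ ε, ∀ t : ℝ, 0 < t →
    deriv (fun s => v z s) t = flowRHS σ (fun x => v x t) z
  /-- the initial condition -/
  initial : ∀ z ∈ sphereDomain φ ε, v z 0 = f₀ z
  /-- the boundary condition: `e^v z` is the point of `Γ_ε` on the ray through `z` -/
  boundary : ∀ z ∈ sphereBoundary φ ε, ∀ t : ℝ, 0 ≤ t →
    Real.exp (v z t) • z ∈ liftedBoundary φ ε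

/-- `g` is the gradient at `z`, from within the subset `S` of the unit sphere, of the function `f`:
`g` is tangent to the sphere at `z` and gives the first order expansion of `f` on `S` at `z`. -/
def HasSphereGradWithin {n : ℕ} (f : Amb n → ℝ) (g : Amb n) (S : Set (Amb n)) (z : Amb n) :
    Prop :=
  inner ℝ g z = 0 ∧ (fun x => f x - f z - inner ℝ g (x - z)) =o[𝓝[S] z] (fun x => x - z)

end HypFlow

end

/-! # A gradient estimate for the approximate modified mean curvature flow

The radial graph of `e^v` is the unit level set of the gauge `G(X, t) = |X| e^{-v(X/|X|, t)}`, which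
is homogeneous of degree one and solves the level set form of the flow (`flowRHS_eq`). Lipschitz
bounds for `v` and for `G` are equivalent as long as `v` is bounded, and `Ω_ε` is described by the
homogeneous function `coneFun`, which is built from the gauge of the given star-shaped domain.
A Euclidean sphere of radius `R` with centre at height `±σR` has constant hyperbolic mean curvature
and is stationary under the flow; all estimates come from comparison with these spheres.

*Barriers.* If `G`, restricted to a piece of a stationary sphere, has an extremum, then `∂G/∂t` has
a sign there (`flowRHS_nonneg_of_touch_sphere`). Hence a bound for `G` on a compact set made of such
pieces is preserved (`IsRegularSolution.barrier`). Spheres centred on the vertical axis bound `v`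
(`IsRegularSolution.abs_le_add_log`).

*The boundary.* The balls of the local ball condition may be shrunk to a common small radius `ρ`
(`IsTangentBall.exists_smaller`). The initial hypersurface is on the correct side of the small balls
(`initial_ball`), and by the barrier principle it stays there. Since the gauge of the star-shaped
domain is Lipschitz, the rays cross these balls at a uniform angle (`IsTangentBall.le_inner`), so
that being on the correct side is a Lipschitz estimate for `G` at the points of `Γ_ε`, uniform in
`ε` (`IsRegularSolution.abs_gauge_sub_one_le`).

*The interior.* Translates of stationary spheres are the spheres of an asymmetric norm: write
`Y - X = τ (b - σ e)` with `|b| = 1`. The estimate `G(Y) - G(X) ≤ C τ` is preserved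
(`IsRegularSolution.twoPoint`): at a first violation the points `X` and `Y` are moved by `h(X) ξ` and
`h(Y) ξ`, where `h` is the height and `ξ ⊥ b`, keeping `|Y - X + τ σ e| = τ`, and then the second
order terms cancel the first order ones exactly (`flowRHS_two_point`). Initially the estimate is the
Lipschitz bound of `v₀`, on the lateral boundary it is the boundary estimate, and for `τ` bounded
below it is the bound for `v`.

A Lipschitz bound for `v` bounds its gradient at interior points. A gradient from within the closed
domain at a boundary point is tested on horizontal directions entering the interior tangent ball
(`HasSphereGradWithin.norm_le`); these, up to sign, are dense and project to all tangent directions.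
-/

namespace HypFlow

/-! ### Horizontal part, height and radial projection -/

/-- The horizontal part of a point of `ℝⁿ⁺¹`. -/
def hor {n : ℕ} (X : Amb n) : Hor n := WithLp.toLp 2 fun i => X i.castSucc

lemma height_eq {n : ℕ} (X : Amb n) : height X = X (Fin.last n) := by
  simp [height, vert, EuclideanSpace.inner_single_left]

@[simp] lemma hor_apply {n : ℕ} (X : Amb n) (i : Fin n) : hor X i = X i.castSucc := rfl

@[simp] lemma height_pt {n : ℕ} (x : Hor n) (h : ℝ) : height (pt x h) = h := by
  simp [height_eq, pt]

@[simp] lemma hor_pt {n : ℕ} (x : Hor n) (h : ℝ) : hor (pt x h) = x := by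
  ext i; simp [pt]

lemma amb_ext {n : ℕ} {X Y : Amb n} (h : hor X = hor Y) (h' : height X = height Y) : X = Y := by
  ext i
  refine Fin.lastCases ?_ (fun j => ?_) i
  · simpa [height_eq] using h'
  · simpa using congrArg (fun Z : Hor n => Z j) h

@[simp] lemma hor_add {n : ℕ} (X Y : Amb n) : hor (X + Y) = hor X + hor Y := by ext i; simp
@[simp] lemma hor_sub {n : ℕ} (X Y : Amb n) : hor (X - Y) = hor X - hor Y := by ext i; simp
@[simp] lemma hor_smul {n : ℕ} (a : ℝ) (X : Amb n) : hor (a • X) = a • hor X := by ext i; simp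
@[simp] lemma hor_zero {n : ℕ} : hor (0 : Amb n) = 0 := by ext i; simp
@[simp] lemma hor_vert {n : ℕ} : hor (vert n) = 0 := by ext i; simp [vert]
@[simp] lemma height_add {n : ℕ} (X Y : Amb n) : height (X + Y) = height X + height Y := by
  simp [height_eq]
@[simp] lemma height_sub {n : ℕ} (X Y : Amb n) : height (X - Y) = height X - height Y := by
  simp [height_eq]
@[simp] lemma height_smul {n : ℕ} (a : ℝ) (X : Amb n) : height (a • X) = a * height X := by
  simp [height_eq]
@[simp] lemma height_zero {n : ℕ} : height (0 : Amb n) = 0 := by simp [height_eq]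
@[simp] lemma height_vert {n : ℕ} : height (vert n) = 1 := by simp [height_eq, vert]

lemma inner_eq_hor {n : ℕ} (X Y : Amb n) :
    inner ℝ X Y = inner ℝ (hor X) (hor Y) + height X * height Y := by
  simp only [PiLp.inner_apply, height_eq, Fin.sum_univ_castSucc, hor_apply]
  simp [mul_comm]

lemma norm_sq_eq_hor {n : ℕ} (X : Amb n) : ‖X‖ ^ 2 = ‖hor X‖ ^ 2 + height X ^ 2 := by
  rw [← real_inner_self_eq_norm_sq, inner_eq_hor, real_inner_self_eq_norm_sq]; ring

lemma norm_hor_le {n : ℕ} (X : Amb n) : ‖hor X‖ ≤ ‖X‖ := by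
  have := norm_sq_eq_hor X
  exact abs_le_of_sq_le_sq' (by nlinarith [sq_nonneg (height X)]) (norm_nonneg _) |>.2

lemma abs_height_le {n : ℕ} (X : Amb n) : |height X| ≤ ‖X‖ := by
  have := norm_sq_eq_hor X
  exact abs_le_of_sq_le_sq (by nlinarith [sq_nonneg ‖hor X‖]) (norm_nonneg _)

lemma norm_vert {n : ℕ} : ‖vert n‖ = 1 := by simp [vert]

lemma continuous_hor {n : ℕ} : Continuous (hor : Amb n → Hor n) := by
  unfold hor; fun_prop

lemma continuous_height {n : ℕ} : Continuous (height : Amb n → ℝ) := by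
  unfold height; fun_prop

section Proj

variable {E : Type*} [NormedAddCommGroup E] [NormedSpace ℝ E]

lemma norm_proj {x : E} (hx : x ≠ 0) : ‖proj x‖ = 1 := by
  simp [proj, norm_smul, hx]

lemma proj_of_norm_one {x : E} (hx : ‖x‖ = 1) : proj x = x := by simp [proj, hx]

@[simp] lemma proj_zero : proj (0 : E) = 0 := by simp [proj]

lemma norm_smul_proj (x : E) : ‖x‖ • proj x = x := by
  rcases eq_or_ne x 0 with rfl | hx
  · simp
  · simp [proj, smul_smul, hx]

lemma proj_smul {a : ℝ} (ha : 0 < a) (x : E) : proj (a • x) = proj x := by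
  simp only [proj, norm_smul, Real.norm_of_nonneg ha.le, smul_smul]
  congr 1
  field_simp

lemma norm_mul_norm_proj_sub_le {x y : E} (hx : x ≠ 0) :
    ‖y‖ * ‖proj x - proj y‖ ≤ 2 * ‖x - y‖ := by
  have h1 : ‖y‖ • (proj x - proj y) = (‖y‖ - ‖x‖) • proj x + (x - y) := by
    rw [smul_sub, sub_smul, norm_smul_proj, norm_smul_proj]; abel
  calc ‖y‖ * ‖proj x - proj y‖ = ‖‖y‖ • (proj x - proj y)‖ := by
        rw [norm_smul, norm_norm]
    _ ≤ |‖y‖ - ‖x‖| * ‖proj x‖ + ‖x - y‖ := by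
        rw [h1]; refine (norm_add_le _ _).trans ?_; rw [norm_smul, Real.norm_eq_abs]
    _ ≤ 2 * ‖x - y‖ := by
        rw [norm_proj hx]
        have := abs_norm_sub_norm_le y x
        rw [norm_sub_rev] at this
        linarith

lemma continuousAt_proj {x : E} (hx : x ≠ 0) : ContinuousAt (proj : E → E) x :=
  (continuousAt_id.norm.inv₀ (by simpa using hx)).smul continuousAt_id

/-- The function, homogeneous of degree one, whose unit level set is the radial graph of `e^f`. -/
noncomputable def radialGauge (f : E → ℝ) (x : E) : ℝ := ‖x‖ * Real.exp (-f (proj x))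

@[simp] lemma radialGauge_zero (f : E → ℝ) : radialGauge f 0 = 0 := by simp [radialGauge]

lemma radialGauge_smul (f : E → ℝ) {a : ℝ} (ha : 0 < a) (x : E) :
    radialGauge f (a • x) = a * radialGauge f x := by
  simp only [radialGauge, proj_smul ha, norm_smul, Real.norm_of_nonneg ha.le]; ring

lemma radialGauge_nonneg (f : E → ℝ) (x : E) : 0 ≤ radialGauge f x := by
  unfold radialGauge; positivity

lemma radialGauge_pos (f : E → ℝ) {x : E} (hx : x ≠ 0) : 0 < radialGauge f x := by
  have := norm_pos_iff.2 hx
  unfold radialGauge; positivity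

lemma radialGauge_of_norm_one (f : E → ℝ) {x : E} (hx : ‖x‖ = 1) :
    radialGauge f x = Real.exp (-f x) := by
  simp [radialGauge, hx, proj_of_norm_one hx]

lemma abs_exp_neg_sub_exp_neg_le {a b M : ℝ} (ha : |a| ≤ M) (hb : |b| ≤ M) :
    |Real.exp (-a) - Real.exp (-b)| ≤ Real.exp M * |a - b| := by
  wlog h : a ≤ b generalizing a b
  · rw [abs_sub_comm, abs_sub_comm a]; exact this hb ha (le_of_not_ge h)
  have h1 : Real.exp (-b) = Real.exp (-a) * Real.exp (a - b) := by rw [← Real.exp_add]; ring_nf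
  have h2 := Real.add_one_le_exp (a - b)
  have h3 : Real.exp (-a) ≤ Real.exp M := Real.exp_le_exp.2 (by linarith [(abs_le.1 ha).1])
  have h4 : Real.exp (a - b) ≤ 1 := Real.exp_le_one_iff.2 (by linarith)
  rw [abs_of_nonneg (by rw [h1]; nlinarith [Real.exp_pos (-a)]), abs_of_nonpos (by linarith), h1]
  nlinarith [Real.exp_pos (-a), Real.exp_pos M]

lemma radialGauge_lipschitz {f : E → ℝ} {S : Set E} {L M : ℝ}
    (hL : ∀ x ∈ S, ∀ y ∈ S, |f x - f y| ≤ L * ‖x - y‖) (hM : ∀ x ∈ S, |f x| ≤ M)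
    (hL0 : 0 ≤ L) {x y : E} (hx0 : x ≠ 0) (hx : proj x ∈ S) (hy : proj y ∈ S) :
    |radialGauge f x - radialGauge f y| ≤ Real.exp M * (1 + 2 * L) * ‖x - y‖ := by
  have h1 : radialGauge f x - radialGauge f y = (‖x‖ - ‖y‖) * Real.exp (-f (proj x)) +
      ‖y‖ * (Real.exp (-f (proj x)) - Real.exp (-f (proj y))) := by
    simp only [radialGauge]; ring
  have h2 : |(‖x‖ - ‖y‖) * Real.exp (-f (proj x))| ≤ ‖x - y‖ * Real.exp M := by
    rw [abs_mul, Real.abs_exp]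
    gcongr
    · exact abs_norm_sub_norm_le x y
    · linarith [(abs_le.1 (hM _ hx)).1]
  have h3 : |‖y‖ * (Real.exp (-f (proj x)) - Real.exp (-f (proj y)))| ≤
      Real.exp M * (L * (2 * ‖x - y‖)) := by
    rw [abs_mul, abs_norm]
    calc ‖y‖ * _ ≤ ‖y‖ * (Real.exp M * (L * ‖proj x - proj y‖)) := by
          gcongr
          exact (abs_exp_neg_sub_exp_neg_le (hM _ hx) (hM _ hy)).trans
            (mul_le_mul_of_nonneg_left (hL _ hx _ hy) (Real.exp_pos _).le)
      _ = Real.exp M * (L * (‖y‖ * ‖proj x - proj y‖)) := by ring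
      _ ≤ _ := by
          have := norm_mul_norm_proj_sub_le (y := y) hx0
          gcongr
  rw [h1]
  refine (abs_add_le _ _).trans ?_
  linarith

end Proj

/-! ### The gauge of a star-shaped `C^{1+1}` domain -/

lemma differentiableAt_radialExt_of_sphere {E : Type*} [NormedAddCommGroup E] [NormedSpace ℝ E]
    {f : E → ℝ} {x : E} (hx : x ≠ 0) (h : DifferentiableAt ℝ (radialExt f) (proj x)) :
    HasFDerivAt (radialExt f) (‖x‖⁻¹ • fderiv ℝ (radialExt f) (proj x)) x := by
  have hpos : 0 < ‖x‖⁻¹ := inv_pos.2 (norm_pos_iff.2 hx)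
  have h1 : radialExt f = fun y => radialExt f (‖x‖⁻¹ • y) := by
    funext y; simp [radialExt, proj_smul hpos]
  have h2 : HasFDerivAt (radialExt f) (fderiv ℝ (radialExt f) (proj x)) (‖x‖⁻¹ • x) :=
    h.hasFDerivAt
  have h3 : HasFDerivAt (fun y : E => ‖x‖⁻¹ • y) (‖x‖⁻¹ • ContinuousLinearMap.id ℝ E) x :=
    (hasFDerivAt_id x).const_smul _
  have h4 : HasFDerivAt (fun y => radialExt f (‖x‖⁻¹ • y)) _ x := h2.comp x h3
  rw [← h1] at h4
  refine h4.congr_fderiv ?_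
  ext v
  simp

/-- A `C^{1+1}` function on the unit sphere is bounded and Lipschitz for the chordal distance. -/
lemma IsC11On.exists_lipschitz {n : ℕ} {φ : Hor n → ℝ} (hφ : IsC11On φ (Metric.sphere 0 1)) :
    ∃ L M : ℝ, 0 ≤ L ∧ (∀ x ∈ Metric.sphere (0 : Hor n) 1, |φ x| ≤ M) ∧
      ∀ x ∈ Metric.sphere (0 : Hor n) 1, ∀ y ∈ Metric.sphere (0 : Hor n) 1,
        |φ x - φ y| ≤ L * ‖x - y‖ := by
  obtain ⟨hd, K, hK⟩ := hφ
  have hcpt : IsCompact (Metric.sphere (0 : Hor n) 1) := isCompact_sphere 0 1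
  have hn1 : ∀ x ∈ Metric.sphere (0 : Hor n) 1, ‖x‖ = 1 := fun x hx => by simpa using hx
  obtain ⟨D, hD⟩ := hcpt.exists_bound_of_continuousOn hK.continuousOn
  have hc : ContinuousOn φ (Metric.sphere (0 : Hor n) 1) := by
    have : ContinuousOn (radialExt φ) (Metric.sphere (0 : Hor n) 1) :=
      fun x hx => (hd x hx).continuousAt.continuousWithinAt
    refine this.congr fun x hx => ?_
    simp [radialExt, proj_of_norm_one (hn1 x hx)]
  obtain ⟨M, hM⟩ := hcpt.exists_bound_of_continuousOn hc
  refine ⟨2 * max D 0 + 2 * max M 0, M, by positivity, fun x hx => by simpa using hM x hx, ?_⟩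
  intro x hx y hy
  have hD0 : 0 ≤ max D 0 := le_max_right _ _
  have hM0 : 0 ≤ max M 0 := le_max_right _ _
  rcases le_or_gt 1 ‖x - y‖ with h | h
  · have h1 := hM x hx
    have h2 := hM y hy
    rw [Real.norm_eq_abs] at h1 h2
    have h3 := abs_sub (φ x) (φ y)
    have := le_max_left M 0
    nlinarith
  · -- the chord stays away from the origin, where the gradient of the extension is bounded
    have hseg : ∀ z ∈ segment ℝ x y, 1 / 2 ≤ ‖z‖ := by
      intro z hz
      have h0 : ‖z - x‖ + ‖z - y‖ ≤ ‖x - y‖ := by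
        have := dist_add_dist_of_mem_segment hz
        rw [dist_eq_norm, dist_eq_norm, dist_eq_norm, norm_sub_rev x z] at this
        exact this.le
      have h1 := norm_sub_norm_le x z
      have h2 := norm_sub_norm_le y z
      rw [norm_sub_rev x z, hn1 x hx] at h1
      rw [norm_sub_rev y z, hn1 y hy] at h2
      linarith
    have hne : ∀ z ∈ segment ℝ x y, z ≠ 0 := fun z hz h0 => by
      have := hseg z hz; rw [h0, norm_zero] at this; norm_num at this
    have hmv := (convex_segment x y).norm_image_sub_le_of_norm_hasFDerivWithin_le
      (f := radialExt φ) (C := 2 * max D 0)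
      (f' := fun z => ‖z‖⁻¹ • fderiv ℝ (radialExt φ) (proj z))
      (fun z hz => (differentiableAt_radialExt_of_sphere (hne z hz)
        (hd _ (by simpa using norm_proj (hne z hz)))).hasFDerivWithinAt)
      (fun z hz => by
        rw [norm_smul, norm_inv, norm_norm]
        have h1 : ‖z‖⁻¹ ≤ 2 := by
          rw [inv_le_comm₀ (norm_pos_iff.2 (hne z hz)) (by norm_num)]
          have := hseg z hz; linarith
        have h2 : ‖fderiv ℝ (radialExt φ) (proj z)‖ ≤ max D 0 :=
          (hD _ (by simpa using norm_proj (hne z hz))).trans (le_max_left _ _)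
        gcongr)
      (right_mem_segment ℝ x y) (left_mem_segment ℝ x y)
    simp only [radialExt, proj_of_norm_one (hn1 x hx), proj_of_norm_one (hn1 y hy),
      Real.norm_eq_abs] at hmv
    nlinarith [norm_nonneg (x - y)]

lemma IsC11On.exists_gauge_lipschitz {n : ℕ} {φ : Hor n → ℝ}
    (hφ : IsC11On φ (Metric.sphere 0 1)) :
    ∃ Lg : ℝ, 1 ≤ Lg ∧ ∀ x y, |radialGauge φ x - radialGauge φ y| ≤ Lg * ‖x - y‖ := by
  obtain ⟨L, M, hL0, hM, hL⟩ := hφ.exists_lipschitz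
  refine ⟨max 1 (Real.exp M * (1 + 2 * L)), le_max_left _ _, ?_⟩
  have key : ∀ x y : Hor n, x ≠ 0 → |radialGauge φ x - radialGauge φ y| ≤
      max 1 (Real.exp M * (1 + 2 * L)) * ‖x - y‖ := by
    intro x y hx
    rcases eq_or_ne y 0 with rfl | hy
    · have h1 : radialGauge φ x ≤ ‖x‖ * Real.exp M := by
        unfold radialGauge
        gcongr
        linarith [(abs_le.1 (hM (proj x) (by simpa using norm_proj hx))).1]
      have h2 : Real.exp M * 1 ≤ max 1 (Real.exp M * (1 + 2 * L)) :=
        le_trans (by gcongr; linarith) (le_max_right _ _)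
      rw [radialGauge_zero, sub_zero, sub_zero, abs_of_nonneg (radialGauge_nonneg _ _)]
      nlinarith [norm_nonneg x]
    · refine (radialGauge_lipschitz hL hM hL0 hx (by simpa using norm_proj hx)
        (by simpa using norm_proj hy)).trans ?_
      gcongr
      exact le_max_right _ _
  intro x y
  rcases eq_or_ne x 0 with rfl | hx
  · rcases eq_or_ne y 0 with rfl | hy
    · simp
    · rw [abs_sub_comm, norm_sub_rev]; exact key y 0 hy
  · exact key x y hx

/-! ### The domains in terms of the gauge -/

/-- The defining function of the cone over `Ω_ε`: the cone is the set where it is positive. -/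
noncomputable def coneFun {n : ℕ} (φ : Hor n → ℝ) (ε : ℝ) (X : Amb n) : ℝ :=
  height X - ε * radialGauge φ (hor X)

lemma coneFun_smul {n : ℕ} (φ : Hor n → ℝ) (ε : ℝ) {a : ℝ} (ha : 0 < a) (X : Amb n) :
    coneFun φ ε (a • X) = a * coneFun φ ε X := by
  simp only [coneFun, height_smul, hor_smul, radialGauge_smul _ ha]; ring

lemma coneFun_proj {n : ℕ} (φ : Hor n → ℝ) (ε : ℝ) {X : Amb n} (hX : X ≠ 0) :
    coneFun φ ε (proj X) = ‖X‖⁻¹ * coneFun φ ε X :=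
  coneFun_smul φ ε (inv_pos.2 (norm_pos_iff.2 hX)) X

lemma exists_norm_one {n : ℕ} (hn : 1 ≤ n) : ∃ ω : Hor n, ‖ω‖ = 1 :=
  ⟨EuclideanSpace.single ⟨0, hn⟩ 1, by simp⟩

lemma pt_eq_iff {n : ℕ} {X : Amb n} {x : Hor n} {h : ℝ} :
    X = pt x h ↔ hor X = x ∧ height X = h :=
  ⟨fun e => by simp [e], fun ⟨h1, h2⟩ => amb_ext (by simpa using h1) (by simpa using h2)⟩

lemma eq_gauge_smul {n : ℕ} (φ : Hor n → ℝ) (x : Hor n) :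
    x = (radialGauge φ x * Real.exp (φ (proj x))) • proj x := by
  have : radialGauge φ x * Real.exp (φ (proj x)) = ‖x‖ := by
    rw [radialGauge, mul_assoc, ← Real.exp_add]; simp
  rw [this, norm_smul_proj]

lemma radialGauge_smul_exp {n : ℕ} (φ : Hor n → ℝ) {ω : Hor n} (hω : ‖ω‖ = 1) {s : ℝ}
    (hs : 0 ≤ s) : radialGauge φ ((s * Real.exp (φ ω)) • ω) = s := by
  rcases hs.eq_or_lt with rfl | hs
  · simp
  · rw [radialGauge_smul _ (by positivity), radialGauge_of_norm_one _ hω, mul_assoc,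
      ← Real.exp_add]; simp

lemma mem_liftedDomain {n : ℕ} (hn : 1 ≤ n) {φ : Hor n → ℝ} {ε : ℝ} {X : Amb n} :
    X ∈ liftedDomain φ ε ↔ height X = ε ∧ radialGauge φ (hor X) < 1 := by
  constructor
  · rintro ⟨ω, hω, s, hs, rfl⟩
    simpa [radialGauge_smul_exp φ hω hs.1] using hs.2
  · rintro ⟨h1, h2⟩
    rcases eq_or_ne (hor X) 0 with h0 | h0
    · obtain ⟨ω, hω⟩ := exists_norm_one hn
      exact ⟨ω, hω, 0, by simp, pt_eq_iff.2 ⟨by simpa using h0, h1⟩⟩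
    · exact ⟨proj (hor X), norm_proj h0, radialGauge φ (hor X), ⟨radialGauge_nonneg _ _, h2⟩,
        pt_eq_iff.2 ⟨eq_gauge_smul φ _, h1⟩⟩

lemma mem_liftedBoundary {n : ℕ} {φ : Hor n → ℝ} {ε : ℝ} {X : Amb n} :
    X ∈ liftedBoundary φ ε ↔ height X = ε ∧ radialGauge φ (hor X) = 1 := by
  constructor
  · rintro ⟨ω, hω, rfl⟩
    simpa using radialGauge_smul_exp φ hω zero_le_one
  · rintro ⟨h1, h2⟩
    have h0 : hor X ≠ 0 := fun h => by simp [h] at h2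
    refine ⟨proj (hor X), norm_proj h0, pt_eq_iff.2 ⟨?_, h1⟩⟩
    have := eq_gauge_smul φ (hor X)
    rwa [h2, one_mul] at this

lemma mem_sphereDomain {n : ℕ} (hn : 1 ≤ n) {φ : Hor n → ℝ} {ε : ℝ} (hε : 0 < ε) {z : Amb n} :
    z ∈ sphereDomain φ ε ↔ ‖z‖ = 1 ∧ 0 < coneFun φ ε z := by
  constructor
  · rintro ⟨X, hX, rfl⟩
    rw [mem_liftedDomain hn] at hX
    have h0 : X ≠ 0 := by rintro rfl; simp at hX; linarith
    refine ⟨norm_proj h0, ?_⟩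
    rw [coneFun_proj φ ε h0]
    have : 0 < coneFun φ ε X := by rw [coneFun, hX.1]; nlinarith
    have := norm_pos_iff.2 h0
    positivity
  · rintro ⟨h1, h2⟩
    have hh : 0 < height z := by
      have := mul_nonneg hε.le (radialGauge_nonneg φ (hor z)); unfold coneFun at h2; linarith
    have ha : 0 < ε / height z := by positivity
    refine ⟨(ε / height z) • z, (mem_liftedDomain hn).2 ⟨?_, ?_⟩, ?_⟩
    · simp [hh.ne']
    · rw [hor_smul, radialGauge_smul _ ha, div_mul_eq_mul_div, div_lt_one hh]
      unfold coneFun at h2; linarith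
    · rw [proj_smul ha, proj_of_norm_one h1]

section Domain

variable {n : ℕ} {φ : Hor n → ℝ} {ε Lg : ℝ}

lemma continuous_gauge
    (hLg : ∀ x y, |radialGauge φ x - radialGauge φ y| ≤ Lg * ‖x - y‖) :
    Continuous (radialGauge φ) := by
  have : LipschitzWith (Real.toNNReal Lg) (radialGauge φ) :=
    LipschitzWith.of_dist_le_mul fun x y => by
      rw [Real.dist_eq, dist_eq_norm]
      refine (hLg x y).trans ?_
      gcongr
      exact Real.le_coe_toNNReal Lg
  exact this.continuous

lemma continuous_coneFun
    (hLg : ∀ x y, |radialGauge φ x - radialGauge φ y| ≤ Lg * ‖x - y‖) :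
    Continuous (coneFun φ ε) :=
  continuous_height.sub (continuous_const.mul ((continuous_gauge hLg).comp continuous_hor))

lemma height_pos_of_coneFun (hε : 0 < ε) {X : Amb n} (hX : X ≠ 0) (h : 0 ≤ coneFun φ ε X) :
    0 < height X := by
  have h1 := radialGauge_nonneg φ (hor X)
  unfold coneFun at h
  have h2 : 0 ≤ height X := by nlinarith
  refine h2.lt_of_ne fun h0 => hX ?_
  have h3 : radialGauge φ (hor X) = 0 := by
    rw [← h0] at h; nlinarith
  have h4 : hor X = 0 := by
    by_contra h5; exact (radialGauge_pos φ h5).ne' h3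
  exact amb_ext (by simpa using h4) (by simpa using h0.symm)

lemma mem_closure_sphereDomain (hn : 1 ≤ n) (hε : 0 < ε)
    (hLg : ∀ x y, |radialGauge φ x - radialGauge φ y| ≤ Lg * ‖x - y‖) {z : Amb n} :
    z ∈ closure (sphereDomain φ ε) ↔ ‖z‖ = 1 ∧ 0 ≤ coneFun φ ε z := by
  constructor
  · intro hz
    have hcl : IsClosed {z : Amb n | ‖z‖ = 1 ∧ 0 ≤ coneFun φ ε z} :=
      (isClosed_eq continuous_norm continuous_const).inter
        (isClosed_le continuous_const (continuous_coneFun hLg))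
    have hsub : sphereDomain φ ε ⊆ {z : Amb n | ‖z‖ = 1 ∧ 0 ≤ coneFun φ ε z} := fun w hw =>
      ⟨((mem_sphereDomain hn hε).1 hw).1, ((mem_sphereDomain hn hε).1 hw).2.le⟩
    exact closure_minimal hsub hcl hz
  · rintro ⟨h1, h2⟩
    have hz0 : z ≠ 0 := fun h => by simp [h] at h1
    -- lifting a boundary point moves it into the cone
    have hcont : ContinuousAt (fun η : ℝ => proj (z + η • vert n)) 0 := by
      refine ContinuousAt.comp (g := proj) (f := fun η : ℝ => z + η • vert n) ?_ (by fun_prop)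
      simpa using continuousAt_proj hz0
    have hlim : Tendsto (fun η : ℝ => proj (z + η • vert n)) (𝓝[>] 0) (𝓝 z) := by
      have := hcont.tendsto.mono_left (nhdsWithin_le_nhds (s := Ioi 0))
      simpa [proj_of_norm_one h1] using this
    refine mem_closure_of_tendsto hlim ?_
    filter_upwards [self_mem_nhdsWithin] with η (hη : 0 < η)
    have h3 : 0 < coneFun φ ε (z + η • vert n) := by
      have : coneFun φ ε (z + η • vert n) = coneFun φ ε z + η := by
        simp [coneFun]; ring
      linarith
    have h4 : z + η • vert n ≠ 0 := fun h => by simp [h, coneFun] at h3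
    refine (mem_sphereDomain hn hε).2 ⟨norm_proj h4, ?_⟩
    rw [coneFun_proj _ _ h4]
    have := norm_pos_iff.2 h4
    positivity

lemma mem_sphereBoundary (hn : 1 ≤ n) (hε : 0 < ε)
    (hLg : ∀ x y, |radialGauge φ x - radialGauge φ y| ≤ Lg * ‖x - y‖) {z : Amb n} :
    z ∈ sphereBoundary φ ε ↔ ‖z‖ = 1 ∧ coneFun φ ε z = 0 := by
  rw [sphereBoundary, Set.mem_sdiff, mem_closure_sphereDomain hn hε hLg, mem_sphereDomain hn hε]
  constructor
  · rintro ⟨⟨h1, h2⟩, h3⟩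
    exact ⟨h1, le_antisymm (not_lt.1 fun h => h3 ⟨h1, h⟩) h2⟩
  · rintro ⟨h1, h2⟩
    exact ⟨⟨h1, h2.ge⟩, fun h => h.2.ne' h2⟩

end Domain

/-! ### Second order expansions along curves -/

/-- The function `g` is differentiable near `0` and twice differentiable at `0`, with
`g'(0) = a` and `g''(0) = b`. -/
def HasTwoDerivs (g : ℝ → ℝ) (a b : ℝ) : Prop :=
  ∃ g' : ℝ → ℝ, (∀ᶠ s in 𝓝 0, HasDerivAt g (g' s) s) ∧ g' 0 = a ∧ HasDerivAt g' b 0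

lemma HasTwoDerivs.const_mul {g : ℝ → ℝ} {a b : ℝ} (h : HasTwoDerivs g a b) (c : ℝ) :
    HasTwoDerivs (fun s => c * g s) (c * a) (c * b) := by
  obtain ⟨g', h1, h2, h3⟩ := h
  exact ⟨fun s => c * g' s, h1.mono fun s hs => hs.const_mul c, by simp only [h2], h3.const_mul c⟩

lemma HasTwoDerivs.sub {g k : ℝ → ℝ} {a b a' b' : ℝ} (h : HasTwoDerivs g a b)
    (h' : HasTwoDerivs k a' b') : HasTwoDerivs (fun s => g s - k s) (a - a') (b - b') := by
  obtain ⟨g', h1, h2, h3⟩ := h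
  obtain ⟨k', h4, h5, h6⟩ := h'
  exact ⟨fun s => g' s - k' s, (h1.and h4).mono fun s hs => hs.1.sub hs.2,
    by simp only [h2, h5],
    h3.sub h6⟩

lemma HasTwoDerivs.of_isLocalMax {g : ℝ → ℝ} {a b : ℝ} (h : HasTwoDerivs g a b)
    (hmax : ∀ᶠ s in 𝓝 0, g s ≤ g 0) : a = 0 ∧ b ≤ 0 := by
  obtain ⟨g', h1, h2, h3⟩ := h
  have hloc : IsLocalMax g 0 := hmax
  have ha : a = 0 := by rw [← h2]; exact hloc.hasDerivAt_eq_zero h1.self_of_nhds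
  refine ⟨ha, not_lt.1 fun hb => ?_⟩
  have hd : deriv g =ᶠ[𝓝 0] g' := h1.mono fun s hs => hs.deriv
  have hdd : deriv (deriv g) 0 = b := by rw [hd.deriv_eq]; exact h3.deriv
  have hmin : IsLocalMin g 0 := isLocalMin_of_deriv_deriv_pos (by rw [hdd]; exact hb)
    (by rw [hd.self_of_nhds, h2, ha]) h1.self_of_nhds.continuousAt
  -- a function that is both locally maximal and minimal is locally constant
  have hconst : g =ᶠ[𝓝 0] fun _ => g 0 := by
    filter_upwards [hmin, hmax] with s hs1 hs2 using le_antisymm hs2 hs1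
  have h4 : deriv (deriv g) 0 = 0 := by
    have := hconst.deriv.deriv_eq
    rw [this]; simp
  linarith

/-! ### The Hessian of the gauge on the unit sphere -/

section Sphere

variable {n : ℕ} {f : Amb n → ℝ} {z : Amb n}

lemma inner_sphereGrad (f : Amb n → ℝ) (z ξ : Amb n) :
    inner ℝ (sphereGrad f z) ξ = fderiv ℝ (radialExt f) z ξ := by
  rw [sphereGrad, inner_gradient_left]

lemma fderiv_radialExt_smul (hz : ‖z‖ = 1) (hf : DifferentiableAt ℝ (radialExt f) z) {a : ℝ}
    (ha : 0 < a) : fderiv ℝ (radialExt f) (a • z) = a⁻¹ • fderiv ℝ (radialExt f) z := by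
  have h0 : a • z ≠ 0 := by
    rw [← norm_ne_zero_iff, norm_smul, hz]; simp [ha.ne']
  have h1 : proj (a • z) = z := by rw [proj_smul ha, proj_of_norm_one hz]
  have := (differentiableAt_radialExt_of_sphere (f := f) h0 (by rwa [h1])).fderiv
  rw [this, h1, norm_smul, hz, mul_one, Real.norm_of_nonneg ha.le]

lemma fderiv_radialExt_self (hf : DifferentiableAt ℝ (radialExt f) z) :
    fderiv ℝ (radialExt f) z z = 0 := by
  have h1 : HasDerivAt (fun s : ℝ => z + s • z) z 0 := by
    simpa using ((hasDerivAt_id (0 : ℝ)).smul_const z).const_add z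
  have h2 : HasDerivAt (fun s : ℝ => radialExt f (z + s • z)) (fderiv ℝ (radialExt f) z z) 0 := by
    have hf' : HasFDerivAt (radialExt f) (fderiv ℝ (radialExt f) z) (z + (0 : ℝ) • z) := by
      simpa using hf.hasFDerivAt
    exact HasFDerivAt.comp_hasDerivAt (f := fun s : ℝ => z + s • z) 0 hf' h1
  have h3 : (fun s : ℝ => radialExt f (z + s • z)) =ᶠ[𝓝 0] fun _ => radialExt f z := by
    filter_upwards [lt_mem_nhds (show (-1 : ℝ) < 0 by norm_num)] with s hs
    have : z + s • z = (1 + s) • z := by rw [add_smul, one_smul]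
    rw [this, radialExt, proj_smul (by linarith), radialExt]
  have h4 := (hasDerivAt_const (0 : ℝ) (radialExt f z)).congr_of_eventuallyEq h3
  exact h2.unique h4

lemma inner_sphereGrad_self (hf : DifferentiableAt ℝ (radialExt f) z) :
    inner ℝ (sphereGrad f z) z = 0 := by
  rw [inner_sphereGrad, fderiv_radialExt_self hf]

lemma sphereHess_self_left (hz : ‖z‖ = 1) (hf : ContDiffAt ℝ 2 (radialExt f) z) (ξ : Amb n) :
    sphereHess f z z ξ = -inner ℝ (sphereGrad f z) ξ := by
  have hd : DifferentiableAt ℝ (radialExt f) z := hf.differentiableAt (by norm_num)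
  have hd2 : DifferentiableAt ℝ (fderiv ℝ (radialExt f)) z :=
    (hf.fderiv_right (m := 1) (by norm_num)).differentiableAt (by norm_num)
  have h1 : HasDerivAt (fun s : ℝ => s • z) z 1 := by
    simpa using (hasDerivAt_id (1 : ℝ)).smul_const z
  have h2 : HasDerivAt (fun s : ℝ => fderiv ℝ (radialExt f) (s • z))
      (fderiv ℝ (fderiv ℝ (radialExt f)) z z) 1 := by
    have hf' : HasFDerivAt (fderiv ℝ (radialExt f)) (fderiv ℝ (fderiv ℝ (radialExt f)) z)
        ((1 : ℝ) • z) := by simpa using hd2.hasFDerivAt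
    exact hf'.comp_hasDerivAt 1 h1
  have h3 : (fun s : ℝ => fderiv ℝ (radialExt f) (s • z)) =ᶠ[𝓝 1]
      fun s => s⁻¹ • fderiv ℝ (radialExt f) z := by
    filter_upwards [lt_mem_nhds (show (0 : ℝ) < 1 by norm_num)] with s hs
    exact fderiv_radialExt_smul hz hd hs
  have h4 : HasDerivAt (fun s : ℝ => s⁻¹ • fderiv ℝ (radialExt f) z)
      ((-1 : ℝ) • fderiv ℝ (radialExt f) z) 1 := by
    simpa using (hasDerivAt_inv (one_ne_zero (α := ℝ))).smul_const (fderiv ℝ (radialExt f) z)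
  have h5 := h2.unique (h4.congr_of_eventuallyEq h3)
  rw [sphereHess, h5, inner_sphereGrad]
  simp

lemma sphereHess_symm (hf : ContDiffAt ℝ 2 (radialExt f) z) (a b : Amb n) :
    sphereHess f z a b = sphereHess f z b a :=
  (hf.isSymmSndFDerivAt (by simp)) a b

/-- The Hessian at `z` of the gauge `|X| e^{-f(X/|X|)}`, up to the factor `e^{-f(z)}`, on vectors
`ξ` tangent to its level set. -/
noncomputable def levelHess (f : Amb n → ℝ) (z ξ : Amb n) : ℝ :=
  ‖ξ‖ ^ 2 - 2 * inner ℝ z ξ ^ 2 - sphereHess f z ξ ξ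

lemma levelHess_smul (a : ℝ) (ξ : Amb n) : levelHess f z (a • ξ) = a ^ 2 * levelHess f z ξ := by
  simp only [levelHess, norm_smul, inner_smul_right, sphereHess, map_smul,
    smul_apply, smul_eq_mul, mul_pow, Real.norm_eq_abs, sq_abs]
  ring

/-- Second order expansion of the gauge along a curve through a point of the unit sphere. -/
lemma hasTwoDerivs_gauge_unit (hz : ‖z‖ = 1) (hf : ContDiffAt ℝ 2 (radialExt f) z)
    {γ γ' : ℝ → Amb n} {ξ η : Amb n} (hγ : ∀ s, HasDerivAt γ (γ' s) s)
    (hγ' : HasDerivAt γ' η 0) (h0 : γ 0 = z) (h1 : γ' 0 = ξ) :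
    HasTwoDerivs (fun s => radialGauge f (γ s))
      (Real.exp (-f z) * inner ℝ (z - sphereGrad f z) ξ)
      (Real.exp (-f z) * (inner ℝ (z - sphereGrad f z) ξ ^ 2 + levelHess f z ξ +
        inner ℝ (z - sphereGrad f z) η)) := by
  have hd2 : DifferentiableAt ℝ (fderiv ℝ (radialExt f)) z :=
    (hf.fderiv_right (m := 1) (by norm_num)).differentiableAt (by norm_num)
  have hev : ∀ᶠ x in 𝓝 z, DifferentiableAt ℝ (radialExt f) x :=
    (hf.eventually (by simp)).mono fun x hx => hx.differentiableAt (by norm_num)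
  have hγc : Tendsto γ (𝓝 0) (𝓝 z) := by rw [← h0]; exact (hγ 0).continuousAt
  have hz0 : z ≠ 0 := fun h => by simp [h] at hz
  have hne : ∀ᶠ s in 𝓝 0, γ s ≠ 0 := hγc.eventually_ne hz0
  have hnorm : ∀ s, γ s ≠ 0 →
      HasDerivAt (fun s => ‖γ s‖) (inner ℝ (γ s) (γ' s) / ‖γ s‖) s := by
    intro s hs
    have h2 := ((hγ s).norm_sq).sqrt (by simpa using hs)
    simp only [Real.sqrt_sq (norm_nonneg _)] at h2
    convert h2 using 1
    ring
  have hu : ∀ s, DifferentiableAt ℝ (radialExt f) (γ s) →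
      HasDerivAt (fun s => radialExt f (γ s)) (fderiv ℝ (radialExt f) (γ s) (γ' s)) s :=
    fun s hs => hs.hasFDerivAt.comp_hasDerivAt s (hγ s)
  refine ⟨fun s => Real.exp (-radialExt f (γ s)) * (inner ℝ (γ s) (γ' s) / ‖γ s‖ -
    ‖γ s‖ * fderiv ℝ (radialExt f) (γ s) (γ' s)), ?_, ?_, ?_⟩
  · filter_upwards [hne, hγc.eventually hev] with s hs1 hs2
    have h2 := (hnorm s hs1).fun_mul (hu s hs2).fun_neg.exp
    refine h2.congr_deriv ?_
    ring
  · simp only [h0, h1, hz]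
    rw [inner_sub_left, inner_sphereGrad, radialExt, proj_of_norm_one hz]
    ring
  · have hev0 : DifferentiableAt ℝ (radialExt f) (γ 0) := by rw [h0]; exact hev.self_of_nhds
    have hne0 : γ 0 ≠ 0 := by rwa [h0]
    have hA := (hu 0 hev0).fun_neg.exp
    have hB := (hnorm 0 hne0)
    have hC : HasDerivAt (fun s => inner ℝ (γ s) (γ' s)) _ 0 := (hγ 0).inner ℝ hγ'
    have hD : HasDerivAt (fun s => fderiv ℝ (radialExt f) (γ s)) _ 0 :=
      HasFDerivAt.comp_hasDerivAt (0 : ℝ) (by rw [h0]; exact hd2.hasFDerivAt) (hγ 0)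
    have hE := hD.clm_apply hγ'
    have hF := hA.fun_mul ((hC.fun_div hB (norm_ne_zero_iff.2 hne0)).fun_sub (hB.fun_mul hE))
    refine hF.congr_deriv ?_
    simp only [h0, h1, hz, inner_sub_left, inner_sphereGrad, radialExt, proj_of_norm_one hz,
      levelHess, sphereHess, real_inner_self_eq_norm_sq, real_inner_comm ξ z]
    ring

/-- Second order expansion of the gauge along a curve. -/
lemma hasTwoDerivs_gauge {X₀ : Amb n} (hX₀ : X₀ ≠ 0)
    (hf : ContDiffAt ℝ 2 (radialExt f) (proj X₀))
    {γ γ' : ℝ → Amb n} {ξ η : Amb n} (hγ : ∀ s, HasDerivAt γ (γ' s) s)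
    (hγ' : HasDerivAt γ' η 0) (h0 : γ 0 = X₀) (h1 : γ' 0 = ξ) :
    HasTwoDerivs (fun s => radialGauge f (γ s))
      (Real.exp (-f (proj X₀)) * inner ℝ (proj X₀ - sphereGrad f (proj X₀)) ξ)
      (Real.exp (-f (proj X₀)) * ((inner ℝ (proj X₀ - sphereGrad f (proj X₀)) ξ ^ 2 +
        levelHess f (proj X₀) ξ) / ‖X₀‖ + inner ℝ (proj X₀ - sphereGrad f (proj X₀)) η)) := by
  have hpos : 0 < ‖X₀‖ := norm_pos_iff.2 hX₀
  have h := (hasTwoDerivs_gauge_unit (norm_proj hX₀) hf (γ := fun s => ‖X₀‖⁻¹ • γ s)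
    (γ' := fun s => ‖X₀‖⁻¹ • γ' s) (ξ := ‖X₀‖⁻¹ • ξ) (η := ‖X₀‖⁻¹ • η)
    (fun s => (hγ s).fun_const_smul _) (hγ'.fun_const_smul _) (by rw [h0]; rfl)
    (by rw [h1])).const_mul ‖X₀‖
  convert h using 1
  · funext s
    rw [radialGauge_smul _ (inv_pos.2 hpos)]
    field_simp
  · rw [inner_smul_right]; field_simp
  · rw [inner_smul_right, inner_smul_right, levelHess_smul]; field_simp

/-- The orthogonal projections of the coordinate vectors to the complement of `b`. -/
noncomputable def tangentProj (b : Amb n) (i : Fin (n + 1)) : Amb n :=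
  EuclideanSpace.single i 1 - b i • b

lemma sum_coord_smul_single (b : Amb n) : ∑ i, b i • EuclideanSpace.single i (1 : ℝ) = b := by
  have := (EuclideanSpace.basisFun (Fin (n + 1)) ℝ).sum_repr b
  simpa using this

lemma sum_coord_sq (b : Amb n) : ∑ i, b i ^ 2 = ‖b‖ ^ 2 := by
  rw [EuclideanSpace.norm_sq_eq]; simp

lemma inner_tangentProj {b : Amb n} (hb : ‖b‖ = 1) (i : Fin (n + 1)) :
    inner ℝ b (tangentProj b i) = 0 := by
  simp [tangentProj, inner_sub_right, inner_smul_right, hb, EuclideanSpace.inner_single_right]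

/-- The trace of a bilinear form over the orthogonal complement of a unit vector. -/
lemma sum_bilin_tangentProj (B : Amb n →L[ℝ] Amb n →L[ℝ] ℝ) {b : Amb n} (hb : ‖b‖ = 1) :
    ∑ i, B (tangentProj b i) (tangentProj b i) =
      ∑ i, B (EuclideanSpace.single i 1) (EuclideanSpace.single i 1) - B b b := by
  have h1 : ∑ i, b i * B (EuclideanSpace.single i 1) b = B b b := by
    have h := congrArg (fun v => B v b) (sum_coord_smul_single b)
    simpa [map_sum, _root_.sum_apply] using h
  have h2 : ∑ i, b i * B b (EuclideanSpace.single i 1) = B b b := by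
    have h := congrArg (B b) (sum_coord_smul_single b)
    simpa [map_sum] using h
  have h3 : ∑ i, b i ^ 2 = 1 := by rw [sum_coord_sq, hb]; norm_num
  have h4 : ∀ i, B (tangentProj b i) (tangentProj b i) =
      B (EuclideanSpace.single i 1) (EuclideanSpace.single i 1) -
        b i * B (EuclideanSpace.single i 1) b - b i * B b (EuclideanSpace.single i 1) +
        b i ^ 2 * B b b := by
    intro i
    simp only [tangentProj, map_sub, map_smul, sub_apply,
      smul_apply, smul_eq_mul]
    ring
  simp only [h4, Finset.sum_add_distrib, Finset.sum_sub_distrib, ← Finset.sum_mul, h1, h2, h3]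
  ring

lemma sum_norm_sq_tangentProj {b : Amb n} (hb : ‖b‖ = 1) :
    ∑ i, ‖tangentProj b i‖ ^ 2 = n := by
  have h : ∑ i, inner ℝ (tangentProj b i) (tangentProj b i) =
      ∑ i : Fin (n + 1), inner ℝ (EuclideanSpace.single i (1 : ℝ)) (EuclideanSpace.single i 1) -
        inner ℝ b b := sum_bilin_tangentProj (innerSL ℝ) hb
  simp only [real_inner_self_eq_norm_sq, hb] at h
  rw [h]
  simp

lemma sum_inner_sq_tangentProj {b : Amb n} (hb : ‖b‖ = 1) (z : Amb n) :
    ∑ i, inner ℝ z (tangentProj b i) ^ 2 = ‖z‖ ^ 2 - inner ℝ z b ^ 2 := by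
  have h := sum_bilin_tangentProj ((innerSL ℝ z).smulRight (innerSL ℝ z)) hb
  simp only [ContinuousLinearMap.smulRight_apply, smul_apply,
    innerSL_apply_apply, smul_eq_mul, ← sq] at h
  rw [h, ← sum_coord_sq z]
  simp [EuclideanSpace.inner_single_right]

lemma norm_sub_sphereGrad_sq (hz : ‖z‖ = 1) (hf : DifferentiableAt ℝ (radialExt f) z) :
    ‖z - sphereGrad f z‖ ^ 2 = 1 + ‖sphereGrad f z‖ ^ 2 := by
  rw [norm_sub_sq_real, real_inner_comm, inner_sphereGrad_self hf, hz]; ring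

/-- The trace of the Hessian of the gauge over the tangent space of its level set. -/
lemma sum_levelHess (hz : ‖z‖ = 1) (hf : ContDiffAt ℝ 2 (radialExt f) z) {b : Amb n} {q : ℝ}
    (hb : ‖b‖ = 1) (hp : z - sphereGrad f z = q • b) :
    ∑ i, levelHess f z (tangentProj b i) = n - aHess f z := by
  have hd : DifferentiableAt ℝ (radialExt f) z := hf.differentiableAt (by norm_num)
  set g := sphereGrad f z with hg
  have hq : q ^ 2 = 1 + ‖g‖ ^ 2 := by
    rw [← norm_sub_sphereGrad_sq hz hd, ← hg, hp, norm_smul, hb]; simp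
  have hgz : inner ℝ g z = 0 := inner_sphereGrad_self hd
  have hq0 : q ≠ 0 := fun h => by rw [h] at hq; nlinarith [sq_nonneg ‖g‖]
  have hzb : q * inner ℝ z b = 1 := by
    rw [← inner_smul_right, ← hp, inner_sub_right, real_inner_self_eq_norm_sq, hz,
      real_inner_comm, hgz]; norm_num
  have hH : q ^ 2 * sphereHess f z b b = 2 * ‖g‖ ^ 2 + sphereHess f z g g := by
    have h1 : q ^ 2 * sphereHess f z b b = sphereHess f z (q • b) (q • b) := by
      simp [sphereHess]; ring
    have h2 : sphereHess f z (z - g) (z - g) = sphereHess f z z z - sphereHess f z z g -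
        sphereHess f z g z + sphereHess f z g g := by
      simp [sphereHess]; ring
    rw [h1, ← hp, h2, sphereHess_symm hf g z, sphereHess_self_left hz hf,
      sphereHess_self_left hz hf, ← hg, hgz, real_inner_self_eq_norm_sq]
    ring
  have hS : ∑ i, sphereHess f z (tangentProj b i) (tangentProj b i) =
      sphereLaplacian f z - sphereHess f z b b :=
    sum_bilin_tangentProj (fderiv ℝ (fderiv ℝ (radialExt f)) z) hb
  simp only [levelHess, Finset.sum_sub_distrib, ← Finset.mul_sum, sum_norm_sq_tangentProj hb,
    sum_inner_sq_tangentProj hb, hS, hz]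
  have hzb' : inner ℝ z b = 1 / q := by field_simp; linarith
  have hH' : sphereHess f z b b = (2 * ‖g‖ ^ 2 + sphereHess f z g g) / q ^ 2 := by
    rw [← hH]; field_simp
  have hw : slopeFactor f z ^ 2 = q ^ 2 := by
    rw [slopeFactor, Real.sq_sqrt (by positivity), hq]
  have hgg : ‖g‖ ^ 2 = q ^ 2 - 1 := by linarith
  rw [hzb', hH', aHess, hw, ← hg, hgg]
  field_simp
  ring

/-- The evolution equation in terms of the gauge: the level set form of the flow. -/
lemma flowRHS_eq (hn : 1 ≤ n) (σ : ℝ) (hz : ‖z‖ = 1) (hf : ContDiffAt ℝ 2 (radialExt f) z)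
    {b : Amb n} {q : ℝ} (hb : ‖b‖ = 1) (hp : z - sphereGrad f z = q • b) :
    -flowRHS σ f z = height z ^ 2 / n * ∑ i, levelHess f z (tangentProj b i) -
      height z * q * height b + σ * height z * |q| := by
  have hd : DifferentiableAt ℝ (radialExt f) z := hf.differentiableAt (by norm_num)
  have hn0 : (n : ℝ) ≠ 0 := by positivity
  have hw : slopeFactor f z = |q| := by
    rw [slopeFactor, ← norm_sub_sphereGrad_sq hz hd, hp, norm_smul, hb, mul_one,
      Real.norm_eq_abs, sq_abs, Real.sqrt_sq_eq_abs]
  have he : inner ℝ (vert n) (sphereGrad f z) = height z - q * height b := by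
    have : sphereGrad f z = z - q • b := by rw [← hp]; abel
    rw [this]; exact by
      change height (z - q • b) = _
      simp
  rw [sum_levelHess hz hf hb hp, flowRHS, hw, he]
  field_simp
  ring

end Sphere

/-! ### Touching from one side -/

lemma eq_smul_of_orthogonal {n : ℕ} {b p : Amb n} (hb : ‖b‖ = 1)
    (h : ∀ ξ, ‖ξ‖ = 1 → inner ℝ b ξ = 0 → inner ℝ p ξ = 0) : p = inner ℝ p b • b := by
  by_contra hne
  set r := p - inner ℝ p b • b with hr
  have hr0 : r ≠ 0 := sub_ne_zero.2 hne
  have hbr : inner ℝ b r = 0 := by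
    rw [hr, inner_sub_right, inner_smul_right, real_inner_self_eq_norm_sq, hb, real_inner_comm]
    ring
  have h1 := h (proj r) (norm_proj hr0) (by rw [proj, inner_smul_right, hbr, mul_zero])
  rw [proj, inner_smul_right] at h1
  have h2 : inner ℝ p r = 0 := by
    rcases mul_eq_zero.1 h1 with h3 | h3
    · exact absurd h3 (inv_ne_zero (norm_ne_zero_iff.2 hr0))
    · exact h3
  have h3 : inner ℝ r r = 0 := by
    conv_lhs => rw [hr]
    rw [inner_sub_left, inner_smul_left, hbr, h2]; simp
  exact hr0 (inner_self_eq_zero.1 h3)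

/-- A bound on unit vectors for a combination of the Hessians gives a bound on all vectors. -/
lemma levelHess_comb_le {n : ℕ} {f : Amb n → ℝ} {z z' b : Amb n} {α β K : ℝ}
    (h : ∀ ξ, ‖ξ‖ = 1 → inner ℝ b ξ = 0 → α * levelHess f z ξ + β * levelHess f z' ξ ≤ K)
    (hb : ‖b‖ = 1) :
    α * ∑ i, levelHess f z (tangentProj b i) + β * ∑ i, levelHess f z' (tangentProj b i) ≤
      K * n := by
  have key : ∀ ξ, inner ℝ b ξ = 0 →
      α * levelHess f z ξ + β * levelHess f z' ξ ≤ K * ‖ξ‖ ^ 2 := by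
    intro ξ hξ
    rcases eq_or_ne ξ 0 with rfl | h0
    · simp [levelHess, sphereHess]
    · have h1 := h (proj ξ) (norm_proj h0) (by rw [proj, inner_smul_right, hξ, mul_zero])
      rw [← norm_smul_proj ξ, levelHess_smul, levelHess_smul, norm_smul_proj]
      nlinarith [sq_nonneg ‖ξ‖]
  rw [← sum_norm_sq_tangentProj hb, Finset.mul_sum, Finset.mul_sum, Finset.mul_sum,
    ← Finset.sum_add_distrib]
  exact Finset.sum_le_sum fun i _ => key _ (inner_tangentProj hb i)

lemma hasDerivAt_circle {n : ℕ} (c b ξ ζ : Amb n) (R θ : ℝ) (s : ℝ) :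
    HasDerivAt (fun s : ℝ => c + s • ζ + R • (Real.cos (θ * s) • b + Real.sin (θ * s) • ξ))
      (ζ + R • ((-(θ * Real.sin (θ * s))) • b + (θ * Real.cos (θ * s)) • ξ)) s := by
  have h0 : HasDerivAt (fun s : ℝ => θ * s) θ s := by
    simpa using (hasDerivAt_id s).const_mul θ
  have h1 : HasDerivAt (fun s : ℝ => Real.cos (θ * s)) (-(θ * Real.sin (θ * s))) s := by
    refine h0.cos.congr_deriv ?_; ring
  have h2 : HasDerivAt (fun s : ℝ => Real.sin (θ * s)) (θ * Real.cos (θ * s)) s := by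
    refine h0.sin.congr_deriv ?_; ring
  have h3 : HasDerivAt (fun s : ℝ => c + s • ζ) ζ s := by
    simpa using ((hasDerivAt_id s).smul_const ζ).const_add c
  exact h3.add (((h1.smul_const b).add (h2.smul_const ξ)).const_smul R)

lemma hasDerivAt_circle' {n : ℕ} (b ξ ζ : Amb n) (R θ : ℝ) :
    HasDerivAt (fun s : ℝ => ζ + R • ((-(θ * Real.sin (θ * s))) • b +
      (θ * Real.cos (θ * s)) • ξ)) (-(R * θ ^ 2) • b) 0 := by
  have h0 : HasDerivAt (fun s : ℝ => θ * s) θ 0 := by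
    simpa using (hasDerivAt_id (0 : ℝ)).const_mul θ
  have h1 : HasDerivAt (fun s : ℝ => -(θ * Real.sin (θ * s))) (-θ ^ 2) 0 := by
    refine (h0.sin.const_mul θ).neg.congr_deriv ?_; simp; ring
  have h2 : HasDerivAt (fun s : ℝ => θ * Real.cos (θ * s)) 0 0 := by
    refine (h0.cos.const_mul θ).congr_deriv ?_; simp
  have h3 := (((h1.smul_const b).add (h2.smul_const ξ)).const_smul R).const_add ζ
  refine h3.congr_deriv ?_
  rw [zero_smul, add_zero, smul_smul]; congr 1; ring

lemma norm_cos_add_sin {n : ℕ} {b ξ : Amb n} (hb : ‖b‖ = 1) (hξ : ‖ξ‖ = 1)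
    (h : inner ℝ b ξ = 0) (s : ℝ) : ‖Real.cos s • b + Real.sin s • ξ‖ = 1 := by
  have : ‖Real.cos s • b + Real.sin s • ξ‖ ^ 2 = 1 := by
    rw [norm_add_sq_real, norm_smul, norm_smul, inner_smul_left, inner_smul_right, h, hb, hξ]
    simp
  exact (sq_eq_sq₀ (norm_nonneg _) zero_le_one).1 (by rw [this]; norm_num)

/-- A sphere of radius `R` centred at height `-sσR` has hyperbolic mean curvature `±σ`, hence is
stationary: if the gauge of a radial graph, restricted to such a sphere, is extremal at a point,
then the normal speed of the graph has a sign there. -/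
lemma flowRHS_nonneg_of_touch_sphere {n : ℕ} (hn : 1 ≤ n) {σ : ℝ} {f : Amb n → ℝ} {X₀ c : Amb n}
    {R s m : ℝ} (hf : ContDiffAt ℝ 2 (radialExt f) (proj X₀)) (hh : 0 < height X₀) (hR : 0 < R)
    (hc : ‖X₀ - c‖ = R) (hcσ : height c = -s * σ * R) (hs : s = 1 ∨ s = -1)
    (hsb : 0 ≤ s * inner ℝ (X₀ - c) X₀) (hm : m ≠ 0)
    (hmax : ∀ᶠ X in 𝓝[Metric.sphere c R] X₀, m * radialGauge f X ≤ m * radialGauge f X₀) :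
    0 ≤ m * flowRHS σ f (proj X₀) := by
  have hX₀ : X₀ ≠ 0 := by rintro rfl; simp at hh
  have hz : ‖proj X₀‖ = 1 := norm_proj hX₀
  have hd : DifferentiableAt ℝ (radialExt f) (proj X₀) := hf.differentiableAt (by norm_num)
  set z := proj X₀ with hzdef
  set p := z - sphereGrad f z with hp
  set lam := ‖X₀‖ with hlam
  have hlpos : 0 < lam := norm_pos_iff.2 hX₀
  have hzX : lam • z = X₀ := norm_smul_proj X₀
  set E := Real.exp (-f z) with hE
  have hEpos : 0 < E := Real.exp_pos _
  set b := R⁻¹ • (X₀ - c) with hb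
  have hb1 : ‖b‖ = 1 := by
    rw [hb, norm_smul, hc, norm_inv, Real.norm_of_nonneg hR.le]; field_simp
  have hXb : X₀ = c + R • b := by rw [hb, smul_smul]; field_simp; simp
  -- expansion along the great circles of the sphere through the point
  have key : ∀ ξ, ‖ξ‖ = 1 → inner ℝ b ξ = 0 → inner ℝ p ξ = 0 ∧
      m * (R ^ 2 * levelHess f z ξ / lam - R * inner ℝ p b) ≤ 0 := by
    intro ξ hξ hbξ
    have h2 := (hasTwoDerivs_gauge hX₀ hf (fun s => hasDerivAt_circle c b ξ 0 R 1 s)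
      (hasDerivAt_circle' b ξ 0 R 1) (by simp [← hXb]) (ξ := R • ξ) (by simp)).const_mul m
    have h3 : ∀ᶠ s : ℝ in 𝓝 0, m * radialGauge f (c + s • (0 : Amb n) + R •
        (Real.cos (1 * s) • b + Real.sin (1 * s) • ξ)) ≤ m * radialGauge f
        (c + (0 : ℝ) • (0 : Amb n) + R • (Real.cos (1 * 0) • b + Real.sin (1 * 0) • ξ)) := by
      have hcont : Tendsto (fun s : ℝ => c + s • (0 : Amb n) + R •
          (Real.cos (1 * s) • b + Real.sin (1 * s) • ξ)) (𝓝 0) (𝓝[Metric.sphere c R] X₀) := by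
        refine tendsto_nhdsWithin_iff.2 ⟨?_, Eventually.of_forall fun s => ?_⟩
        · have := (hasDerivAt_circle c b ξ 0 R 1 0).continuousAt.tendsto
          simpa [← hXb] using this
        · simp only [smul_zero, add_zero, mem_sphere_iff_norm, add_sub_cancel_left, norm_smul,
            norm_cos_add_sin hb1 hξ hbξ, Real.norm_of_nonneg hR.le, mul_one]
      filter_upwards [hcont.eventually hmax] with s hs
      simpa [← hXb] using hs
    obtain ⟨h4, h5⟩ := h2.of_isLocalMax h3
    have h6 : inner ℝ p ξ = 0 := by
      rw [inner_smul_right] at h4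
      simpa [hm, hEpos.ne', hR.ne'] using h4
    refine ⟨h6, ?_⟩
    rw [inner_smul_right, ← hp, h6, levelHess_smul, inner_smul_right] at h5
    have h7 : m * (E * ((R ^ 2 * levelHess f z ξ) / lam - R * inner ℝ p b)) ≤ 0 := by
      convert h5 using 3; ring
    nlinarith
  set q := inner ℝ p b with hq
  have hpq : z - sphereGrad f z = q • b :=
    eq_smul_of_orthogonal hb1 fun ξ h1 h2 => (key ξ h1 h2).1
  have hqz : q * inner ℝ b z = 1 := by
    have : q * inner ℝ b z = inner ℝ (q • b) z := (real_inner_smul_left b z q).symm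
    rw [this, ← hpq, inner_sub_left, real_inner_self_eq_norm_sq, hz,
      inner_sphereGrad_self hd]; norm_num
  have hsbz : 0 ≤ s * inner ℝ b z := by
    have : s * inner ℝ (X₀ - c) X₀ = R * lam * (s * inner ℝ b z) := by
      rw [hb, inner_smul_left]; nth_rw 2 [← hzX]
      rw [inner_smul_right]; simp; field_simp
    rw [this] at hsb
    exact nonneg_of_mul_nonneg_right hsb (by positivity)
  have habs : |q| = s * q := by
    rcases hs with rfl | rfl
    · have : 0 < q := by by_contra h; nlinarith
      rw [abs_of_pos this]; ring
    · have : q < 0 := by by_contra h; nlinarith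
      rw [abs_of_neg this]; ring
  have hsum := levelHess_comb_le (f := f) (z := z) (z' := z) (b := b) (α := m) (β := 0)
    (K := m * lam * q / R) (fun ξ h1 h2 => by
      have := (key ξ h1 h2).2
      have h3 : m * levelHess f z ξ - m * lam * q / R =
        lam / R ^ 2 * (m * (R ^ 2 * levelHess f z ξ / lam - R * q)) := by field_simp
      have h4 : lam / R ^ 2 * (m * (R ^ 2 * levelHess f z ξ / lam - R * q)) ≤ 0 :=
        mul_nonpos_of_nonneg_of_nonpos (by positivity) this
      linarith) hb1
  rw [zero_mul, add_zero] at hsum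
  have hflow := flowRHS_eq hn σ hz hf hb1 hpq
  have hn0 : (0 : ℝ) < n := by positivity
  have hy : lam * height z = R * (height b - s * σ) := by
    rw [← height_smul, hzX, hXb, height_add, height_smul, hcσ]; ring
  have h8 : m * -flowRHS σ f z ≤ height z ^ 2 / n * (m * lam * q / R * n) +
      m * (- height z * q * height b + σ * height z * (s * q)) := by
    rw [hflow, habs]
    have := mul_le_mul_of_nonneg_left hsum (show 0 ≤ height z ^ 2 / n by positivity)
    linarith
  have h9 : height z ^ 2 / n * (m * lam * q / R * n) +
      m * (- height z * q * height b + σ * height z * (s * q)) =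
      m * height z * q / R * (lam * height z - R * (height b - s * σ)) := by
    field_simp; ring
  rw [h9, hy, sub_self, mul_zero] at h8
  linarith

/-- The two-point inequality. At a maximum of the two-point function, move the first point by
`h(X) ξ` and the second by `h(Y) ξ` while rotating the difference on the sphere of radius `τ`;
with this choice all terms of second and first order cancel. -/
lemma flowRHS_two_point {n : ℕ} (hn : 1 ≤ n) {σ : ℝ} (hσ : σ ∈ Ioo (-1 : ℝ) 1) {f : Amb n → ℝ}
    {X₀ Y₀ b : Amb n} {τ C k : ℝ} (hfX : ContDiffAt ℝ 2 (radialExt f) (proj X₀))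
    (hfY : ContDiffAt ℝ 2 (radialExt f) (proj Y₀)) (hX₀ : X₀ ≠ 0) (hY₀ : Y₀ ≠ 0)
    (hb : ‖b‖ = 1) (hτ : 0 < τ) (hY : Y₀ = X₀ + τ • (b - σ • vert n)) (hC : 0 < C) (hk : 0 < k)
    (heq : radialGauge f Y₀ - C * τ = k * radialGauge f X₀)
    (hmax : ∀ᶠ p : Amb n × Amb n in 𝓝 (X₀, Y₀), ‖p.2 - p.1 + (τ * σ) • vert n‖ = τ →
      radialGauge f p.2 - C * τ ≤ k * radialGauge f p.1) :
    0 ≤ radialGauge f Y₀ * flowRHS σ f (proj Y₀) -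
      k * radialGauge f X₀ * flowRHS σ f (proj X₀) := by
  have hzX : ‖proj X₀‖ = 1 := norm_proj hX₀
  have hzY : ‖proj Y₀‖ = 1 := norm_proj hY₀
  have hdX : DifferentiableAt ℝ (radialExt f) (proj X₀) := hfX.differentiableAt (by norm_num)
  have hdY : DifferentiableAt ℝ (radialExt f) (proj Y₀) := hfY.differentiableAt (by norm_num)
  have hGX : radialGauge f X₀ = ‖X₀‖ * Real.exp (-f (proj X₀)) := rfl
  have hGY : radialGauge f Y₀ = ‖Y₀‖ * Real.exp (-f (proj Y₀)) := rfl
  have hXz : ‖X₀‖ • proj X₀ = X₀ := norm_smul_proj X₀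
  have hYz : ‖Y₀‖ • proj Y₀ = Y₀ := norm_smul_proj Y₀
  set zX := proj X₀
  set zY := proj Y₀
  set pX := zX - sphereGrad f zX with hpX
  set pY := zY - sphereGrad f zY with hpY
  set EX := Real.exp (-f zX)
  set EY := Real.exp (-f zY)
  have hEX : 0 < EX := Real.exp_pos _
  have hEY : 0 < EY := Real.exp_pos _
  set lX := ‖X₀‖
  set lY := ‖Y₀‖
  have hlX : 0 < lX := norm_pos_iff.2 hX₀
  have hlY : 0 < lY := norm_pos_iff.2 hY₀
  have hYX : Y₀ - (τ * σ) • (0 : Amb n) = (X₀ - (τ * σ) • vert n) + τ • b := by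
    rw [hY, smul_sub, smul_smul]; simp; abel
  rw [smul_zero, sub_zero] at hYX
  have key : ∀ ξ ζ : Amb n, ∀ θ : ℝ, ‖ξ‖ = 1 → inner ℝ b ξ = 0 →
      EY * inner ℝ pY (ζ + (τ * θ) • ξ) - k * (EX * inner ℝ pX ζ) = 0 ∧
      EY * ((inner ℝ pY (ζ + (τ * θ) • ξ) ^ 2 + levelHess f zY (ζ + (τ * θ) • ξ)) / lY -
        τ * θ ^ 2 * inner ℝ pY b) -
        k * (EX * ((inner ℝ pX ζ ^ 2 + levelHess f zX ζ) / lX)) ≤ 0 := by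
    intro ξ ζ θ hξ hbξ
    have h1 := hasTwoDerivs_gauge hX₀ hfX (γ := fun s => X₀ + s • ζ) (γ' := fun _ => ζ) (ξ := ζ)
      (fun s => by simpa using ((hasDerivAt_id s).smul_const ζ).const_add X₀)
      (hasDerivAt_const _ _) (by simp) rfl
    have h2 := hasTwoDerivs_gauge hY₀ hfY
      (fun s => hasDerivAt_circle (X₀ - (τ * σ) • vert n) b ξ ζ τ θ s)
      (hasDerivAt_circle' b ξ ζ τ θ) (by simp [← hYX]) (ξ := ζ + (τ * θ) • ξ)
      (by simp [smul_smul])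
    have h3 := (h2.sub (h1.const_mul k)).of_isLocalMax (by
      have hc1 : Tendsto (fun s : ℝ => X₀ - (τ * σ) • vert n + s • ζ + τ •
          (Real.cos (θ * s) • b + Real.sin (θ * s) • ξ)) (𝓝 0) (𝓝 Y₀) := by
        have := (hasDerivAt_circle (X₀ - (τ * σ) • vert n) b ξ ζ τ θ 0).continuousAt.tendsto
        simpa [← hYX] using this
      have hc2 : Tendsto (fun s : ℝ => X₀ + s • ζ) (𝓝 0) (𝓝 X₀) := by
        have : ContinuousAt (fun s : ℝ => X₀ + s • ζ) 0 := by fun_prop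
        simpa using this.tendsto
      filter_upwards [(hc2.prodMk_nhds hc1).eventually hmax] with s hs
      have h4 := hs (by
        have : X₀ - (τ * σ) • vert n + s • ζ + τ •
          (Real.cos (θ * s) • b + Real.sin (θ * s) • ξ) - (X₀ + s • ζ) + (τ * σ) • vert n =
          τ • (Real.cos (θ * s) • b + Real.sin (θ * s) • ξ) := by abel
        simp only [this, norm_smul, norm_cos_add_sin hb hξ hbξ, Real.norm_of_nonneg hτ.le,
          mul_one])
      have h5 : radialGauge f (X₀ - (τ * σ) • vert n + (0 : ℝ) • ζ + τ •
          (Real.cos (θ * 0) • b + Real.sin (θ * 0) • ξ)) = radialGauge f Y₀ := by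
        congr 1; rw [hYX]; simp
      have h6 : radialGauge f (X₀ + (0 : ℝ) • ζ) = radialGauge f X₀ := by simp
      simp only [h5, h6] at h4 ⊢
      linarith)
    refine ⟨h3.1, ?_⟩
    refine le_of_eq_of_le ?_ h3.2
    rw [inner_smul_right, inner_zero_right]
    ring
  obtain ⟨ξ₀, hξ₀, hbξ₀⟩ : ∃ ξ : Amb n, ‖ξ‖ = 1 ∧ inner ℝ b ξ = 0 := by
    by_contra hcon
    push Not at hcon
    have h0 : ∀ i, tangentProj b i = 0 := by
      intro i
      by_contra h
      exact hcon _ (norm_proj h) (by rw [proj, inner_smul_right, inner_tangentProj hb, mul_zero])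
    have h1 := sum_norm_sq_tangentProj hb
    simp only [h0, norm_zero] at h1
    have h2 : (0 : ℝ) < n := by positivity
    rw [← h1] at h2
    simp at h2
  have hP : EY • pY = (k * EX) • pX := by
    refine ext_inner_right ℝ fun ζ => ?_
    have := (key ξ₀ ζ 0 hξ₀ hbξ₀).1
    simp only [mul_zero, zero_smul, add_zero] at this
    simp only [inner_smul_left, RCLike.conj_to_real]
    linarith
  have hpξ : ∀ ξ, ‖ξ‖ = 1 → inner ℝ b ξ = 0 → inner ℝ pY ξ = 0 := by
    intro ξ h1 h2
    have := (key ξ 0 1 h1 h2).1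
    simpa [inner_smul_right, hEY.ne', hτ.ne'] using this
  have hpY' : pY = inner ℝ pY b • b := eq_smul_of_orthogonal hb hpξ
  set q := EY * inner ℝ pY b with hq
  have hqY : zY - sphereGrad f zY = (q / EY) • b := by
    rw [← hpY, hq, mul_div_cancel_left₀ _ hEY.ne']; exact hpY'
  have hqX : zX - sphereGrad f zX = (q / (k * EX)) • b := by
    rw [← hpX]
    have h1 : pX = (k * EX)⁻¹ • EY • pY := by rw [hP, smul_smul]; field_simp; simp
    rw [h1, hpY', smul_smul, smul_smul]
    congr 1
    rw [hq]; field_simp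
  have hbe : |height b| ≤ 1 := (abs_height_le b).trans hb.le
  have hσb : 0 < 1 - σ * height b := by
    have h1 : |σ * height b| < 1 := by
      rw [abs_mul]
      have := abs_lt.2 hσ
      nlinarith [abs_nonneg σ, abs_nonneg (height b)]
    linarith [(abs_lt.1 h1).2]
  -- Euler's identity for the gauge at both points
  have hpYz : inner ℝ pY zY = 1 := by
    rw [hpY, inner_sub_left, real_inner_self_eq_norm_sq, hzY, inner_sphereGrad_self hdY]
    norm_num
  have hpXz : inner ℝ pX zX = 1 := by
    rw [hpX, inner_sub_left, real_inner_self_eq_norm_sq, hzX, inner_sphereGrad_self hdX]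
    norm_num
  have hqpos : 0 < q := by
    have h1 : q * inner ℝ b Y₀ = radialGauge f Y₀ := by
      have : EY * inner ℝ pY Y₀ = lY * EY := by
        rw [← hYz, inner_smul_right, hpYz]; ring
      rw [hGY, ← this, hpY, hqY, inner_smul_left]; simp; field_simp
    have h2 : q * inner ℝ b X₀ = k * radialGauge f X₀ := by
      have : EX * inner ℝ pX X₀ = lX * EX := by
        rw [← hXz, inner_smul_right, hpXz]; ring
      rw [hGX, ← this, hpX, hqX, inner_smul_left]; simp; field_simp
    have h3 : inner ℝ b Y₀ - inner ℝ b X₀ = τ * (1 - σ * height b) := by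
      have : inner ℝ b (vert n) = height b := by rw [real_inner_comm]; rfl
      rw [hY, inner_add_right, inner_smul_right, inner_sub_right, inner_smul_right,
        real_inner_self_eq_norm_sq, hb, this]
      ring
    have h4 : q * (τ * (1 - σ * height b)) = C * τ := by rw [← h3]; linarith
    by_contra h
    have : q * (τ * (1 - σ * height b)) ≤ 0 :=
      mul_nonpos_of_nonpos_of_nonneg (not_lt.1 h) (by positivity)
    have : 0 < C * τ := by positivity
    linarith
  set θ := height b - σ with hθ
  have hhY : height Y₀ = height X₀ + τ * θ := by
    rw [hY, height_add, height_smul, height_sub, height_smul, height_vert, hθ]; ring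
  have hyX : lX * height zX = height X₀ := by rw [← height_smul, hXz]
  have hyY : lY * height zY = height Y₀ := by rw [← height_smul, hYz]
  have hsum := levelHess_comb_le (f := f) (z := zY) (z' := zX) (b := b)
    (α := EY * height Y₀ ^ 2 / lY) (β := -(k * EX * height X₀ ^ 2 / lX)) (K := τ * θ ^ 2 * q)
    (fun ξ h1 h2 => by
      have h3 := (key ξ (height X₀ • ξ) θ h1 h2).2
      have h4 : inner ℝ pX ξ = 0 := by
        rw [hpX, hqX, inner_smul_left, h2, mul_zero]
      rw [← add_smul, ← hhY, inner_smul_right, inner_smul_right, hpξ ξ h1 h2, h4,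
        levelHess_smul, levelHess_smul] at h3
      have h5 : EY * height Y₀ ^ 2 / lY * levelHess f zY ξ +
          -(k * EX * height X₀ ^ 2 / lX) * levelHess f zX ξ - τ * θ ^ 2 * q =
          EY * (((height Y₀ * 0) ^ 2 + height Y₀ ^ 2 * levelHess f zY ξ) / lY -
            τ * θ ^ 2 * inner ℝ pY b) -
          k * (EX * (((height X₀ * 0) ^ 2 + height X₀ ^ 2 * levelHess f zX ξ) / lX)) := by
        rw [hq]; ring
      linarith) hb
  have hflowY := flowRHS_eq hn σ hzY hfY hb hqY
  have hflowX := flowRHS_eq hn σ hzX hfX hb hqX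
  rw [abs_of_pos (by positivity)] at hflowY hflowX
  have hn0 : (0 : ℝ) < n := by positivity
  have hY1 : radialGauge f Y₀ * -flowRHS σ f zY = (EY * height Y₀ ^ 2 / lY) *
      (∑ i, levelHess f zY (tangentProj b i)) / n - height Y₀ * q * θ := by
    rw [hflowY, hGY, ← hyY, hθ]; field_simp; ring
  have hX1 : k * radialGauge f X₀ * -flowRHS σ f zX = (k * EX * height X₀ ^ 2 / lX) *
      (∑ i, levelHess f zX (tangentProj b i)) / n - height X₀ * q * θ := by
    rw [hflowX, hGX, ← hyX, hθ]; field_simp; ring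
  have h6 : (EY * height Y₀ ^ 2 / lY) * (∑ i, levelHess f zY (tangentProj b i)) / n -
      (k * EX * height X₀ ^ 2 / lX) * (∑ i, levelHess f zX (tangentProj b i)) / n ≤
      τ * θ ^ 2 * q := by
    rw [← sub_div, div_le_iff₀ hn0]; linarith
  have h7 : height Y₀ * q * θ - height X₀ * q * θ = τ * θ ^ 2 * q := by rw [hhY]; ring
  linarith

/-! ### Comparison principles for the flow -/

section Comparison

variable {n : ℕ} {σ ε Lg : ℝ} {φ : Hor n → ℝ} {f₀ : Amb n → ℝ} {v : Amb n → ℝ → ℝ}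

lemma IsRegularSolution.contDiffAt (hv : IsRegularSolution σ φ ε f₀ v) {z : Amb n}
    (hz : z ∈ sphereDomain φ ε) {t : ℝ} (ht : 0 < t) :
    ContDiffAt ℝ 2 (radialExt fun x => v x t) z := by
  have h1 : ContDiffAt ℝ 2 (fun p : Amb n × ℝ => v (proj p.1) p.2) (z, t) :=
    (hv.smooth z hz t ht).of_le (WithTop.coe_le_coe.2 (le_top (a := (2 : ℕ∞))))
  exact h1.comp (f := fun x : Amb n => (x, t)) z (contDiffAt_id.prodMk contDiffAt_const)

lemma IsRegularSolution.hasDerivAt (hv : IsRegularSolution σ φ ε f₀ v) {z : Amb n}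
    (hz : z ∈ sphereDomain φ ε) (hz1 : ‖z‖ = 1) {t : ℝ} (ht : 0 < t) :
    HasDerivAt (fun s => v z s) (flowRHS σ (fun x => v x t) z) t := by
  have h1 : ContDiffAt ℝ 1 (fun p : Amb n × ℝ => v (proj p.1) p.2) (z, t) :=
    (hv.smooth z hz t ht).of_le (by exact_mod_cast (le_top : (1 : ℕ∞) ≤ ⊤))
  have h2 : ContDiffAt ℝ 1 (fun s : ℝ => v (proj z) s) t :=
    h1.comp (f := fun s : ℝ => (z, s)) t (contDiffAt_const.prodMk contDiffAt_id)
  rw [proj_of_norm_one hz1] at h2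
  rw [← hv.equation z hz t ht]
  exact (h2.differentiableAt (by norm_num)).hasDerivAt

/-- The time derivative of the gauge of the evolving radial graph. -/
lemma IsRegularSolution.hasDerivAt_gauge (hn : 1 ≤ n) (hε : 0 < ε)
    (hv : IsRegularSolution σ φ ε f₀ v) {X : Amb n} (hX : X ≠ 0) (hc : 0 < coneFun φ ε X)
    {t : ℝ} (ht : 0 < t) :
    HasDerivAt (fun s => radialGauge (fun x => v x s) X)
      (-(radialGauge (fun x => v x t) X * flowRHS σ (fun x => v x t) (proj X))) t := by
  have hX' := norm_pos_iff.2 hX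
  have hmem : proj X ∈ sphereDomain φ ε :=
    (mem_sphereDomain hn hε).2 ⟨norm_proj hX, by rw [coneFun_proj _ _ hX]; positivity⟩
  have h1 := ((hv.hasDerivAt hmem (norm_proj hX) ht).fun_neg.exp).const_mul ‖X‖
  refine h1.congr_deriv ?_
  rw [radialGauge]; ring

lemma IsRegularSolution.continuousOn_gauge (hn : 1 ≤ n) (hε : 0 < ε)
    (hLg : ∀ x y, |radialGauge φ x - radialGauge φ y| ≤ Lg * ‖x - y‖)
    (hv : IsRegularSolution σ φ ε f₀ v) :
    ContinuousOn (fun p : Amb n × ℝ => radialGauge (fun x => v x p.2) p.1)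
      ({X | X ≠ 0 ∧ 0 ≤ coneFun φ ε X} ×ˢ Ici 0) := by
  have h1 : ContinuousOn (fun p : Amb n × ℝ => (proj p.1, p.2))
      ({X | X ≠ 0 ∧ 0 ≤ coneFun φ ε X} ×ˢ Ici 0) := by
    rintro ⟨X, t⟩ ⟨hX, -⟩
    refine ContinuousAt.continuousWithinAt (ContinuousAt.prodMk ?_ continuousAt_snd)
    exact (continuousAt_proj hX.1).comp (f := Prod.fst) continuousAt_fst
  have h2 := hv.continuous.comp h1 (by
    rintro ⟨X, t⟩ ⟨hX, ht⟩
    refine ⟨(mem_closure_sphereDomain hn hε hLg).2 ⟨norm_proj hX.1, ?_⟩, ht⟩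
    rw [coneFun_proj _ _ hX.1]
    exact mul_nonneg (inv_nonneg.2 (norm_nonneg _)) hX.2)
  exact (continuous_fst.norm.continuousOn).mul h2.neg.rexp

/-- Over `∂Ω_ε` the gauge of a radial graph with boundary `Γ_ε` is determined by the height. -/
lemma radialGauge_of_boundary (hn : 1 ≤ n) (hε : 0 < ε)
    (hLg : ∀ x y, |radialGauge φ x - radialGauge φ y| ≤ Lg * ‖x - y‖) {f : Amb n → ℝ}
    (hf : ∀ z ∈ sphereBoundary φ ε, Real.exp (f z) • z ∈ liftedBoundary φ ε) {X : Amb n}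
    (hX : X ≠ 0) (hc : coneFun φ ε X = 0) : radialGauge f X = height X / ε := by
  have hmem : proj X ∈ sphereBoundary φ ε :=
    (mem_sphereBoundary hn hε hLg).2 ⟨norm_proj hX, by rw [coneFun_proj _ _ hX, hc, mul_zero]⟩
  have h1 := (mem_liftedBoundary.1 (hf _ hmem)).1
  rw [height_smul] at h1
  have h2 : ‖X‖ * height (proj X) = height X := by rw [← height_smul, norm_smul_proj]
  rw [eq_div_iff hε.ne', radialGauge, ← h1, ← h2, mul_assoc, ← mul_assoc (Real.exp _),
    ← Real.exp_add]
  simp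

lemma IsRegularSolution.gauge_boundary (hn : 1 ≤ n) (hε : 0 < ε)
    (hLg : ∀ x y, |radialGauge φ x - radialGauge φ y| ≤ Lg * ‖x - y‖)
    (hv : IsRegularSolution σ φ ε f₀ v) {X : Amb n} (hX : X ≠ 0) (hc : coneFun φ ε X = 0)
    {t : ℝ} (ht : 0 ≤ t) : radialGauge (fun x => v x t) X = height X / ε :=
  radialGauge_of_boundary hn hε hLg (fun z hz => hv.boundary z hz t ht) hX hc

lemma HasDerivAt.nonneg_of_isMax_right {h : ℝ → ℝ} {D t : ℝ} (hd : HasDerivAt h D t) (ht : 0 < t)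
    (hmax : ∀ s ∈ Icc 0 t, h s ≤ h t) : 0 ≤ D := by
  have h1 := (hasDerivAt_iff_tendsto_slope.1 hd).mono_left
    (nhdsWithin_mono t (show Iio t ⊆ {t}ᶜ from fun s hs => ne_of_lt hs))
  refine ge_of_tendsto h1 ?_
  filter_upwards [Ioo_mem_nhdsLT ht] with s hs
  rw [slope_def_field]
  exact div_nonneg_of_nonpos (by linarith [hmax s ⟨hs.1.le, hs.2.le⟩]) (by linarith [hs.2])

/-- Comparison with stationary spheres. The gauge stays bounded on a compact set `T` if it is so
initially and at the points of `T` on the lateral boundary, provided that at every other point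
either `T` allows to increase the gauge along the ray or `T` contains a neighbourhood of the point
in a stationary sphere. For `m > 0` the bound is an upper bound, for `m < 0` a lower bound. -/
theorem IsRegularSolution.barrier (hn : 1 ≤ n) (hε : 0 < ε)
    (hLg : ∀ x y, |radialGauge φ x - radialGauge φ y| ≤ Lg * ‖x - y‖)
    (hv : IsRegularSolution σ φ ε f₀ v) {T : Set (Amb n)} (hT : IsCompact T)
    (hsub : ∀ X ∈ T, X ≠ 0 ∧ 0 ≤ coneFun φ ε X) {m g : ℝ} (hm : m ≠ 0)
    (h0 : ∀ X ∈ T, m * radialGauge (fun x => v x 0) X ≤ g)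
    (hT' : ∀ X ∈ T, (∀ t, 0 ≤ t → m * radialGauge (fun x => v x t) X ≤ g) ∨
      (∃ a : ℝ, 0 < a ∧ a • X ∈ T ∧ m < m * a) ∨
      (0 < coneFun φ ε X ∧ ∃ (c : Amb n) (R s : ℝ), 0 < R ∧ ‖X - c‖ = R ∧
        height c = -s * σ * R ∧ (s = 1 ∨ s = -1) ∧ 0 ≤ s * inner ℝ (X - c) X ∧
        T ∈ 𝓝[Metric.sphere c R] X)) :
    ∀ t, 0 ≤ t → ∀ X ∈ T, m * radialGauge (fun x => v x t) X ≤ g := by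
  intro t₁ ht₁ X₁ hX₁
  by_contra hcon
  push Not at hcon
  set G : Amb n → ℝ → ℝ := fun X t => radialGauge (fun x => v x t) X with hG
  obtain ⟨δ, hδ, hδ1⟩ : ∃ δ : ℝ, 0 < δ ∧ g < m * G X₁ t₁ - δ * t₁ := by
    refine ⟨(m * G X₁ t₁ - g) / (2 * (t₁ + 1)), div_pos (by linarith) (by positivity), ?_⟩
    have : (m * G X₁ t₁ - g) / (2 * (t₁ + 1)) * t₁ ≤ (m * G X₁ t₁ - g) / 2 := by
      rw [div_mul_eq_mul_div, div_le_div_iff₀ (by positivity) (by norm_num)]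
      nlinarith
    linarith
  have hcont : ContinuousOn (fun p : Amb n × ℝ => m * G p.1 p.2 - δ * p.2) (T ×ˢ Icc 0 t₁) := by
    refine (continuousOn_const.mul ?_).sub (by fun_prop)
    exact (hv.continuousOn_gauge hn hε hLg).mono
      (prod_mono (fun X hX => hsub X hX) Icc_subset_Ici_self)
  obtain ⟨⟨X₀, t₀⟩, ⟨hX₀, ht₀⟩, hmax⟩ := (hT.prod isCompact_Icc).exists_isMaxOn
    ⟨(X₁, t₁), hX₁, right_mem_Icc.2 ht₁⟩ hcont
  simp only at hX₀ ht₀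
  have hmax' : ∀ X ∈ T, ∀ t ∈ Icc 0 t₁, m * G X t - δ * t ≤ m * G X₀ t₀ - δ * t₀ :=
    fun X hX t ht => isMaxOn_iff.1 hmax (X, t) ⟨hX, ht⟩
  have hbig := hmax' X₁ hX₁ t₁ (right_mem_Icc.2 ht₁)
  have ht₀pos : 0 < t₀ := by
    refine ht₀.1.lt_of_ne fun h => ?_
    have := h0 X₀ hX₀
    rw [← h, mul_zero, sub_zero] at hbig
    have : m * G X₀ 0 ≤ g := this
    linarith
  have hval : g < m * G X₀ t₀ := by nlinarith
  obtain ⟨hX₀0, hc₀⟩ := hsub X₀ hX₀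
  have hGpos : 0 < G X₀ t₀ := radialGauge_pos _ hX₀0
  rcases hT' X₀ hX₀ with h | ⟨a, ha, haT, ham⟩ | ⟨hc, c, R, s, hR, hcR, hcσ, hs, hsb, hTn⟩
  · exact absurd (h t₀ ht₀.1) (not_le.2 hval)
  · have h1 := hmax' _ haT t₀ ht₀
    have h2 : G (a • X₀) t₀ = a * G X₀ t₀ := radialGauge_smul _ ha _
    rw [h2] at h1
    nlinarith
  · have hmem : proj X₀ ∈ sphereDomain φ ε := (mem_sphereDomain hn hε).2
      ⟨norm_proj hX₀0, by
        rw [coneFun_proj _ _ hX₀0]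
        have := norm_pos_iff.2 hX₀0
        positivity⟩
    have h1 := flowRHS_nonneg_of_touch_sphere hn (σ := σ) (hv.contDiffAt hmem ht₀pos)
      (height_pos_of_coneFun hε hX₀0 hc₀) hR hcR hcσ hs hsb hm (by
        filter_upwards [hTn] with X hX
        have := hmax' X hX t₀ ht₀
        simp only [hG] at this
        linarith)
    have h2 : HasDerivAt (fun t => m * G X₀ t - δ * t) _ t₀ :=
      ((hv.hasDerivAt_gauge hn hε hX₀0 hc ht₀pos).const_mul m).sub
        ((hasDerivAt_id t₀).const_mul δ)
    have h3 := HasDerivAt.nonneg_of_isMax_right h2 ht₀pos fun t ht =>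
      hmax' X₀ hX₀ t ⟨ht.1, ht.2.trans ht₀.2⟩
    have h4 : 0 ≤ G X₀ t₀ * (m * flowRHS σ (fun x => v x t₀) (proj X₀)) :=
      mul_nonneg hGpos.le h1
    simp only [hG] at h3 h4
    nlinarith

/-- The pairs of points entering the two-point comparison: a unit vector `z` over `closure Ω_ε`
and a point `z + τ (b - σ e)` of the cone, where `b` is a unit vector and `0 ≤ τ ≤ τ₁`. -/
def twoPointSet (σ : ℝ) (φ : Hor n → ℝ) (ε τ₁ : ℝ) : Set (Amb n × Amb n × ℝ) :=
  {p | ‖p.1‖ = 1 ∧ ‖p.2.1‖ = 1 ∧ p.2.2 ∈ Icc 0 τ₁ ∧ 0 ≤ coneFun φ ε p.1 ∧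
    0 ≤ coneFun φ ε (p.1 + p.2.2 • (p.2.1 - σ • vert n))}

lemma isCompact_twoPointSet
    (hLg : ∀ x y, |radialGauge φ x - radialGauge φ y| ≤ Lg * ‖x - y‖) (τ₁ : ℝ) :
    IsCompact (twoPointSet σ φ ε τ₁) := by
  have h1 : IsCompact (Metric.sphere (0 : Amb n) 1 ×ˢ Metric.sphere (0 : Amb n) 1 ×ˢ Icc 0 τ₁) :=
    (isCompact_sphere _ _).prod ((isCompact_sphere _ _).prod isCompact_Icc)
  have hc := continuous_coneFun (ε := ε) hLg
  have h2 : IsClosed {p : Amb n × Amb n × ℝ | 0 ≤ coneFun φ ε p.1 ∧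
      0 ≤ coneFun φ ε (p.1 + p.2.2 • (p.2.1 - σ • vert n))} :=
    (isClosed_le continuous_const (hc.comp continuous_fst)).inter
      (isClosed_le continuous_const (hc.comp (by fun_prop)))
  convert h1.inter_right h2 using 1
  ext p
  simp only [twoPointSet, mem_ofPred_eq, mem_inter_iff, mem_prod, mem_sphere_zero_iff_norm]
  tauto

lemma norm_sub_smul_vert_bounds (hσ : σ ∈ Ioo (-1 : ℝ) 1) {b : Amb n} (hb : ‖b‖ = 1) :
    1 - |σ| ≤ ‖b - σ • vert n‖ ∧ ‖b - σ • vert n‖ ≤ 2 := by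
  have h1 : ‖σ • vert n‖ = |σ| := by rw [norm_smul, norm_vert, mul_one, Real.norm_eq_abs]
  have h2 := norm_sub_norm_le b (σ • vert n)
  have h3 := norm_sub_le b (σ • vert n)
  have := abs_lt.2 hσ
  constructor <;> linarith

lemma twoPoint_ne_zero (hσ : σ ∈ Ioo (-1 : ℝ) 1) {z b : Amb n} {τ τ₁ : ℝ} (hz : ‖z‖ = 1)
    (hb : ‖b‖ = 1) (hτ : τ ∈ Icc 0 τ₁) (hτ₁ : τ₁ < 1 / 2) : z + τ • (b - σ • vert n) ≠ 0 := by
  intro h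
  have h1 : ‖z‖ = ‖τ • (b - σ • vert n)‖ := by rw [eq_neg_of_add_eq_zero_left h, norm_neg]
  rw [hz, norm_smul, Real.norm_of_nonneg hτ.1] at h1
  have := (norm_sub_smul_vert_bounds hσ hb).2
  nlinarith [hτ.1, hτ.2]

/-- Preservation of a Lipschitz bound for the gauge with respect to the asymmetric norm with
stationary spheres: the bound `G(Y) - G(X) ≤ C τ`, for `Y = X + τ (b - σ e)` with a unit vector `b`,
persists if it holds initially, at the lateral boundary and for `τ = τ₁`. -/
theorem IsRegularSolution.twoPoint (hn : 1 ≤ n) (hε : 0 < ε) (hσ : σ ∈ Ioo (-1 : ℝ) 1)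
    (hLg : ∀ x y, |radialGauge φ x - radialGauge φ y| ≤ Lg * ‖x - y‖)
    (hv : IsRegularSolution σ φ ε f₀ v) {τ₁ C : ℝ} (hτ₁ : τ₁ < 1 / 2) (hC : 0 < C)
    (h0 : ∀ p ∈ twoPointSet σ φ ε τ₁,
      radialGauge (fun x => v x 0) (p.1 + p.2.2 • (p.2.1 - σ • vert n)) -
        radialGauge (fun x => v x 0) p.1 ≤ C * p.2.2)
    (hbd : ∀ t, 0 ≤ t → ∀ p ∈ twoPointSet σ φ ε τ₁, (coneFun φ ε p.1 = 0 ∨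
      coneFun φ ε (p.1 + p.2.2 • (p.2.1 - σ • vert n)) = 0 ∨ p.2.2 = τ₁) →
      radialGauge (fun x => v x t) (p.1 + p.2.2 • (p.2.1 - σ • vert n)) -
        radialGauge (fun x => v x t) p.1 ≤ C * p.2.2) :
    ∀ t, 0 ≤ t → ∀ p ∈ twoPointSet σ φ ε τ₁,
      radialGauge (fun x => v x t) (p.1 + p.2.2 • (p.2.1 - σ • vert n)) -
        radialGauge (fun x => v x t) p.1 ≤ C * p.2.2 := by
  intro t₁ ht₁ p₁ hp₁
  by_contra hcon
  push Not at hcon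
  set G : Amb n → ℝ → ℝ := fun X t => radialGauge (fun x => v x t) X with hG
  set Yf : Amb n × Amb n × ℝ → Amb n := fun p => p.1 + p.2.2 • (p.2.1 - σ • vert n) with hYf
  have hYc : Continuous Yf := by rw [hYf]; fun_prop
  have hne1 : ∀ p ∈ twoPointSet σ φ ε τ₁, p.1 ≠ 0 := fun p hp h => by
    have := hp.1; rw [h, norm_zero] at this; norm_num at this
  have hneY : ∀ p ∈ twoPointSet σ φ ε τ₁, Yf p ≠ 0 := fun p hp =>
    twoPoint_ne_zero hσ hp.1 hp.2.1 hp.2.2.1 hτ₁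
  set Φ : Amb n × Amb n × ℝ → ℝ → ℝ := fun p t => (G (Yf p) t - C * p.2.2) / G p.1 t with hΦ
  have hΦ1 : ∀ p ∈ twoPointSet σ φ ε τ₁, ∀ t, G (Yf p) t - G p.1 t ≤ C * p.2.2 → Φ p t ≤ 1 := by
    intro p hp t h
    have : 0 < G p.1 t := radialGauge_pos _ (hne1 p hp)
    rw [hΦ]; simp only
    rw [div_le_one this]; linarith
  have h1 : 1 < Φ p₁ t₁ := by
    have : 0 < G p₁.1 t₁ := radialGauge_pos _ (hne1 p₁ hp₁)
    rw [hΦ]; simp only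
    rw [one_lt_div this]
    simp only [hG, hYf]; linarith
  obtain ⟨δ, hδ, hδ1⟩ : ∃ δ : ℝ, 0 < δ ∧ 1 < Φ p₁ t₁ - δ * t₁ := by
    refine ⟨(Φ p₁ t₁ - 1) / (2 * (t₁ + 1)), div_pos (by linarith) (by positivity), ?_⟩
    have : (Φ p₁ t₁ - 1) / (2 * (t₁ + 1)) * t₁ ≤ (Φ p₁ t₁ - 1) / 2 := by
      rw [div_mul_eq_mul_div, div_le_div_iff₀ (by positivity) (by norm_num)]
      nlinarith
    linarith
  have hGc := hv.continuousOn_gauge hn hε hLg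
  have hcont : ContinuousOn (fun p : (Amb n × Amb n × ℝ) × ℝ => Φ p.1 p.2 - δ * p.2)
      (twoPointSet σ φ ε τ₁ ×ˢ Icc 0 t₁) := by
    have hA : ContinuousOn (fun p : (Amb n × Amb n × ℝ) × ℝ => G (Yf p.1) p.2)
        (twoPointSet σ φ ε τ₁ ×ˢ Icc 0 t₁) :=
      hGc.comp (f := fun p : (Amb n × Amb n × ℝ) × ℝ => (Yf p.1, p.2))
        (Continuous.continuousOn (by fun_prop))
        fun p hp => ⟨⟨hneY _ hp.1, hp.1.2.2.2.2⟩, hp.2.1⟩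
    have hB : ContinuousOn (fun p : (Amb n × Amb n × ℝ) × ℝ => G p.1.1 p.2)
        (twoPointSet σ φ ε τ₁ ×ˢ Icc 0 t₁) :=
      hGc.comp (f := fun p : (Amb n × Amb n × ℝ) × ℝ => (p.1.1, p.2))
        (Continuous.continuousOn (by fun_prop))
        fun p hp => ⟨⟨hne1 _ hp.1, hp.1.2.2.2.1⟩, hp.2.1⟩
    refine ContinuousOn.sub (ContinuousOn.div (hA.sub (by fun_prop)) hB ?_) (by fun_prop)
    exact fun p hp => (radialGauge_pos _ (hne1 _ hp.1)).ne'
  obtain ⟨⟨p₀, t₀⟩, ⟨hp₀, ht₀⟩, hmax⟩ :=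
    ((isCompact_twoPointSet hLg τ₁).prod isCompact_Icc).exists_isMaxOn
      ⟨(p₁, t₁), hp₁, right_mem_Icc.2 ht₁⟩ hcont
  simp only at hp₀ ht₀
  have hmax' : ∀ p ∈ twoPointSet σ φ ε τ₁, ∀ t ∈ Icc 0 t₁,
      Φ p t - δ * t ≤ Φ p₀ t₀ - δ * t₀ := fun p hp t ht =>
    isMaxOn_iff.1 hmax (p, t) ⟨hp, ht⟩
  have hbig := hmax' p₁ hp₁ t₁ (right_mem_Icc.2 ht₁)
  have ht₀pos : 0 < t₀ := by
    refine ht₀.1.lt_of_ne fun h => ?_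
    have h2 := hΦ1 p₀ hp₀ 0 (h0 p₀ hp₀)
    rw [← h] at hbig
    linarith
  have hval : 1 < Φ p₀ t₀ := by nlinarith
  have hnb : ¬ (coneFun φ ε p₀.1 = 0 ∨ coneFun φ ε (Yf p₀) = 0 ∨ p₀.2.2 = τ₁) := fun h =>
    absurd (hΦ1 p₀ hp₀ t₀ (hbd t₀ ht₀.1 p₀ hp₀ h)) (not_le.2 hval)
  push Not at hnb
  have hX₀ := hne1 p₀ hp₀
  have hY₀ := hneY p₀ hp₀
  obtain ⟨z₀, b₀, τ₀⟩ := p₀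
  obtain ⟨hz, hb, hτ, hcz, hcY⟩ := id hp₀
  simp only at hz hb hτ hcz hcY hnb hX₀
  set Y₀ := Yf (z₀, b₀, τ₀) with hY₀def
  have hcz' : 0 < coneFun φ ε z₀ := hcz.lt_of_ne (Ne.symm hnb.1)
  have hcY' : 0 < coneFun φ ε Y₀ := lt_of_le_of_ne hcY (Ne.symm hnb.2.1)
  have hτ' : τ₀ < τ₁ := hτ.2.lt_of_ne hnb.2.2
  have hGX : 0 < G z₀ t₀ := radialGauge_pos _ hX₀
  set k := Φ (z₀, b₀, τ₀) t₀ with hk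
  have hkeq : G Y₀ t₀ - C * τ₀ = k * G z₀ t₀ := by
    rw [hk, hΦ]; simp only; rw [div_mul_cancel₀ _ hGX.ne']
  have hτpos : 0 < τ₀ := by
    refine hτ.1.lt_of_ne fun h => ?_
    have h2 : Y₀ = z₀ := by rw [hY₀def, hYf]; simp [← h]
    rw [h2, ← h] at hkeq
    nlinarith
  have hmemD : ∀ X : Amb n, X ≠ 0 → 0 < coneFun φ ε X → proj X ∈ sphereDomain φ ε := by
    intro X hX hc
    refine (mem_sphereDomain hn hε).2 ⟨norm_proj hX, ?_⟩
    rw [coneFun_proj _ _ hX]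
    have := norm_pos_iff.2 hX
    positivity
  have hcone := continuous_coneFun (ε := ε) hLg
  have key := flowRHS_two_point hn hσ (hv.contDiffAt (hmemD z₀ hX₀ hcz') ht₀pos)
    (hv.contDiffAt (hmemD Y₀ hY₀ hcY') ht₀pos) hX₀ hY₀ hb hτpos rfl hC
    (show 0 < k by linarith) hkeq (by
      have e1 : ∀ᶠ p : Amb n × Amb n in 𝓝 (z₀, Y₀), 0 < coneFun φ ε p.1 :=
        (hcone.comp continuous_fst).continuousAt.eventually (lt_mem_nhds hcz')
      have e2 : ∀ᶠ p : Amb n × Amb n in 𝓝 (z₀, Y₀), 0 < coneFun φ ε p.2 :=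
        (hcone.comp continuous_snd).continuousAt.eventually (lt_mem_nhds hcY')
      have e3 : ∀ᶠ p : Amb n × Amb n in 𝓝 (z₀, Y₀), τ₀ < τ₁ * ‖p.1‖ :=
        (show Continuous fun p : Amb n × Amb n => τ₁ * ‖p.1‖ by fun_prop).continuousAt.eventually
          (lt_mem_nhds (by simp only [hz]; linarith))
      filter_upwards [e1, e2, e3] with p h1 h2 h3 h4
      have hp0 : p.1 ≠ 0 := fun h => by rw [h, norm_zero] at h3; linarith
      have hl : 0 < ‖p.1‖ := norm_pos_iff.2 hp0
      -- by homogeneity the first point may be taken on the unit sphere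
      set b' := τ₀⁻¹ • (p.2 - p.1 + (τ₀ * σ) • vert n) with hb'
      have hp2 : ‖p.1‖⁻¹ • p.2 = Yf (‖p.1‖⁻¹ • p.1, b', τ₀ / ‖p.1‖) := by
        have : p.2 = p.1 + τ₀ • (b' - σ • vert n) := by
          rw [hb', smul_sub, smul_smul, smul_smul, mul_inv_cancel₀ hτpos.ne', one_smul]; abel
        rw [hYf]; simp only
        nth_rw 1 [this]
        rw [smul_add, smul_smul, div_eq_inv_mul]
      have hmem : (‖p.1‖⁻¹ • p.1, b', τ₀ / ‖p.1‖) ∈ twoPointSet σ φ ε τ₁ := by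
        refine ⟨norm_proj hp0, ?_, ⟨by positivity, ?_⟩, ?_, ?_⟩
        · simp only [hb', norm_smul, h4, norm_inv, Real.norm_of_nonneg hτpos.le]
          field_simp
        · simp only; rw [div_le_iff₀ hl]; exact h3.le
        · simp only; rw [coneFun_smul _ _ (inv_pos.2 hl)]; positivity
        · change 0 ≤ coneFun φ ε (Yf (‖p.1‖⁻¹ • p.1, b', τ₀ / ‖p.1‖))
          rw [← hp2, coneFun_smul _ _ (inv_pos.2 hl)]; positivity
      have h5 := hmax' _ hmem t₀ ht₀
      have h6 : Φ (‖p.1‖⁻¹ • p.1, b', τ₀ / ‖p.1‖) t₀ ≤ k := by linarith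
      have hGp : 0 < G p.1 t₀ := radialGauge_pos _ hp0
      rw [hΦ] at h6
      simp only [← hp2] at h6
      simp only [hG, radialGauge_smul _ (inv_pos.2 hl)] at h6 hGp ⊢
      rw [div_le_iff₀ (by positivity)] at h6
      have h7 := mul_le_mul_of_nonneg_left h6 hl.le
      field_simp at h7
      linarith)
  have h2 : HasDerivAt (fun t => Φ (z₀, b₀, τ₀) t - δ * t) _ t₀ :=
    (((hv.hasDerivAt_gauge hn hε hY₀ hcY' ht₀pos).sub_const (C * τ₀)).div
      (hv.hasDerivAt_gauge hn hε hX₀ hcz' ht₀pos) hGX.ne').sub ((hasDerivAt_id t₀).const_mul δ)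
  have h3 := HasDerivAt.nonneg_of_isMax_right h2 ht₀pos fun t ht =>
    hmax' _ hp₀ t ⟨ht.1, ht.2.trans ht₀.2⟩
  have h4 : (-(radialGauge (fun x => v x t₀) Y₀ * flowRHS σ (fun x => v x t₀) (proj Y₀)) *
      radialGauge (fun x => v x t₀) z₀ - (radialGauge (fun x => v x t₀) Y₀ - C * τ₀) *
      -(radialGauge (fun x => v x t₀) z₀ * flowRHS σ (fun x => v x t₀) (proj z₀))) /
      radialGauge (fun x => v x t₀) z₀ ^ 2 ≤ 0 := by
    refine div_nonpos_of_nonpos_of_nonneg ?_ (sq_nonneg _)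
    simp only [hG] at hkeq hGX
    rw [hkeq]
    nlinarith
  linarith

end Comparison

/-! ### Stationary balls tangent to the boundary -/

/-- The ball of radius `R` centred at `(a, -κσR)` passes through `P ∈ Γ_ε`, and its section at
height `ε` is contained in `closure D_ε` if `κ = 1`, and is disjoint from `D_ε` if `κ = -1`. -/
structure IsTangentBall {n : ℕ} (σ : ℝ) (φ : Hor n → ℝ) (ε κ R : ℝ) (a : Hor n)
    (P : Amb n) : Prop where
  mem : P ∈ liftedBoundary φ ε
  norm_eq : ‖P - pt a (-κ * σ * R)‖ = R
  section_le : ∀ X : Amb n, ‖X - pt a (-κ * σ * R)‖ ≤ R → height X = ε →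
    0 ≤ κ * (1 - radialGauge φ (hor X))

/-- A lower bound for the ratio of the radius of the section of a stationary ball to the radius of
the ball, valid for sections at small height. -/
noncomputable def sectionRatio (σ : ℝ) : ℝ := Real.sqrt (1 - ((1 + |σ|) / 2) ^ 2)

lemma sectionRatio_pos {σ : ℝ} (hσ : σ ∈ Ioo (-1 : ℝ) 1) : 0 < sectionRatio σ := by
  have := abs_lt.2 hσ
  refine Real.sqrt_pos.2 ?_
  nlinarith [abs_nonneg σ]

lemma sectionRatio_le_one (σ : ℝ) : sectionRatio σ ≤ 1 :=
  Real.sqrt_le_one.2 (by nlinarith [sq_nonneg ((1 + |σ|) / 2)])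

lemma abs_kappa {κ : ℝ} (hκ : κ = 1 ∨ κ = -1) : |κ| = 1 := by rcases hκ with rfl | rfl <;> simp

lemma exists_eventually_of_inner_neg {E : Type*} [NormedAddCommGroup E] [InnerProductSpace ℝ E]
    {u ζ : E} (h : inner ℝ ζ u < 0) : ∀ᶠ s : ℝ in 𝓝[>] 0, ‖u + s • ζ‖ < ‖u‖ := by
  have h1 : ∀ᶠ s : ℝ in 𝓝 0, 2 * inner ℝ ζ u + s * ‖ζ‖ ^ 2 < 0 :=
    (show Continuous fun s : ℝ => 2 * inner ℝ ζ u + s * ‖ζ‖ ^ 2 by fun_prop).continuousAt.eventually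
      (gt_mem_nhds (by simp only [zero_mul, add_zero]; linarith))
  filter_upwards [self_mem_nhdsWithin, nhdsWithin_le_nhds h1] with s (hs : 0 < s) hs1
  refine lt_of_pow_lt_pow_left₀ 2 (norm_nonneg _) ?_
  rw [norm_add_sq_real, inner_smul_right, norm_smul, real_inner_comm, Real.norm_of_nonneg hs.le]
  nlinarith

section TangentBall

variable {n : ℕ} {σ ε κ R Lg : ℝ} {φ : Hor n → ℝ} {a : Hor n} {P : Amb n}

lemma norm_sq_sub_pt (X : Amb n) (a : Hor n) (h : ℝ) :
    ‖X - pt a h‖ ^ 2 = ‖hor X - a‖ ^ 2 + (height X - h) ^ 2 := by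
  rw [norm_sq_eq_hor]; simp

lemma IsTangentBall.sq_eq (h : IsTangentBall σ φ ε κ R a P) :
    ‖hor P - a‖ ^ 2 = R ^ 2 - (ε + κ * σ * R) ^ 2 := by
  have h1 := norm_sq_sub_pt P a (-κ * σ * R)
  rw [h.norm_eq, (mem_liftedBoundary.1 h.mem).1] at h1
  linarith

lemma IsTangentBall.sectionRatio_le (h : IsTangentBall σ φ ε κ R a P) (hσ : σ ∈ Ioo (-1 : ℝ) 1)
    (hκ : κ = 1 ∨ κ = -1) (hε : 0 < ε) (hR : 0 < R) (hεR : ε ≤ R * ((1 - |σ|) / 2)) :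
    sectionRatio σ * R ≤ ‖hor P - a‖ := by
  have h1 : |ε + κ * σ * R| ≤ R * ((1 + |σ|) / 2) := by
    refine (abs_add_le _ _).trans ?_
    rw [abs_mul, abs_mul, abs_kappa hκ, abs_of_pos hε, abs_of_pos hR]
    linarith
  have h2 := sq_le_sq' (by linarith [(abs_le.1 h1).1, abs_nonneg (ε + κ * σ * R)])
    (abs_le.1 h1).2
  have h3 : 0 ≤ 1 - ((1 + |σ|) / 2) ^ 2 := by
    have := abs_lt.2 hσ
    nlinarith [abs_nonneg σ]
  refine abs_le_of_sq_le_sq' ?_ (norm_nonneg _) |>.2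
  rw [h.sq_eq, mul_pow, sectionRatio, Real.sq_sqrt h3]
  linarith

/-- Since the gauge of a star-shaped domain is homogeneous and Lipschitz, the boundary of the domain
is uniformly transversal to the radial direction. -/
lemma IsTangentBall.norm_le (h : IsTangentBall σ φ ε κ R a P) (hκ : κ = 1 ∨ κ = -1)
    (hLg1 : 1 ≤ Lg) (hLg : ∀ x y, |radialGauge φ x - radialGauge φ y| ≤ Lg * ‖x - y‖) :
    ‖hor P - a‖ ≤ 2 * Lg * (κ * inner ℝ (hor P) (hor P - a)) := by
  obtain ⟨hPε, hP1⟩ := mem_liftedBoundary.1 h.mem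
  set p := hor P
  set w := p - a with hw
  rcases eq_or_ne w 0 with h0 | h0
  · simp [h0]
  have hw0 : 0 < ‖w‖ := norm_pos_iff.2 h0
  -- otherwise this direction enters the section of the ball
  by_contra hcon
  push Not at hcon
  set ζ := (κ * (2 * Lg * ‖w‖)) • p - w with hζ
  have hin : inner ℝ ζ w < 0 := by
    rw [hζ, inner_sub_left, inner_smul_left, real_inner_self_eq_norm_sq]
    simp only [RCLike.conj_to_real]
    nlinarith
  have hsmall : ∀ᶠ s : ℝ in 𝓝 0, s * (2 * Lg * ‖w‖) < 1 :=
    (show Continuous fun s : ℝ => s * (2 * Lg * ‖w‖) by fun_prop).continuousAt.eventually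
      (gt_mem_nhds (by simp))
  obtain ⟨s, hs1, hs2, hs3 : 0 < s⟩ := ((exists_eventually_of_inner_neg hin).and
    ((hsmall.filter_mono nhdsWithin_le_nhds).and
      (self_mem_nhdsWithin (s := Ioi (0 : ℝ))))).exists
  have hball : ‖pt (p + s • ζ) ε - pt a (-κ * σ * R)‖ ≤ R := by
    refine abs_le_of_sq_le_sq' ?_ (h.norm_eq ▸ norm_nonneg _) |>.2
    have e1 : p + s • ζ - a = w + s • ζ := by rw [hw]; abel
    have e2 := sq_lt_sq' (by linarith [norm_nonneg (w + s • ζ)]) hs1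
    have e3 := h.sq_eq
    change ‖w‖ ^ 2 = _ at e3
    rw [norm_sq_sub_pt, hor_pt, height_pt, e1]
    nlinarith
  have h2 := h.section_le _ hball (height_pt _ _)
  rw [hor_pt] at h2
  have hpos : 0 < s * (2 * Lg * ‖w‖) := by positivity
  have h3 : p + s • ζ = (1 + κ * (s * (2 * Lg * ‖w‖))) • p - s • w := by
    rw [hζ, add_smul, one_smul, smul_sub, smul_smul]
    rw [show s * (κ * (2 * Lg * ‖w‖)) = κ * (s * (2 * Lg * ‖w‖)) by ring]; abel
  have h4 : 0 < 1 + κ * (s * (2 * Lg * ‖w‖)) := by rcases hκ with rfl | rfl <;> linarith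
  have h5 := hLg (p + s • ζ) ((1 + κ * (s * (2 * Lg * ‖w‖))) • p)
  rw [radialGauge_smul _ h4, hP1, mul_one, h3, sub_sub_cancel_left, norm_neg, norm_smul,
    Real.norm_of_nonneg hs3.le, ← h3] at h5
  have h6 := abs_le.1 h5
  have h7 : 0 < Lg * (s * ‖w‖) := by positivity
  rcases hκ with rfl | rfl <;> nlinarith

/-- The rays meet tangent stationary balls at a uniform angle. -/
lemma IsTangentBall.le_inner (h : IsTangentBall σ φ ε κ R a P) (hσ : σ ∈ Ioo (-1 : ℝ) 1)
    (hκ : κ = 1 ∨ κ = -1) (hε : 0 < ε) (hR : 0 < R) (hεR : ε ≤ R * ((1 - |σ|) / 2))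
    (hLg1 : 1 ≤ Lg) (hLg : ∀ x y, |radialGauge φ x - radialGauge φ y| ≤ Lg * ‖x - y‖)
    (hεs : ε ≤ sectionRatio σ / (4 * Lg)) :
    R * (sectionRatio σ / (4 * Lg)) ≤ κ * inner ℝ P (P - pt a (-κ * σ * R)) := by
  have h1 := h.norm_le hκ hLg1 hLg
  have h2 := h.sectionRatio_le hσ hκ hε hR hεR
  have hPε := (mem_liftedBoundary.1 h.mem).1
  have h3 : |ε + κ * σ * R| ≤ R := by
    refine (abs_add_le _ _).trans ?_
    have := abs_lt.2 hσ
    rw [abs_mul, abs_mul, abs_kappa hκ, abs_of_pos hε, abs_of_pos hR]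
    nlinarith
  have h4 : |κ * (ε * (ε + κ * σ * R))| ≤ ε * R := by
    rw [abs_mul, abs_mul, abs_kappa hκ, abs_of_pos hε]
    nlinarith
  have h5 : sectionRatio σ * R / (2 * Lg) ≤ κ * inner ℝ (hor P) (hor P - a) := by
    rw [div_le_iff₀ (by positivity)]; linarith
  have h6 : R * (sectionRatio σ / (4 * Lg)) = sectionRatio σ * R / (2 * Lg) -
      sectionRatio σ / (4 * Lg) * R := by field_simp; ring
  rw [inner_eq_hor, hor_sub, hor_pt, height_sub, height_pt, hPε, h6]
  have h7 := (abs_le.1 h4).1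
  have h8 := mul_le_mul_of_nonneg_right hεs hR.le
  have h9 : κ * (inner ℝ (hor P) (hor P - a) + ε * (ε - -κ * σ * R)) =
      κ * inner ℝ (hor P) (hor P - a) + κ * (ε * (ε + κ * σ * R)) := by ring
  rw [h9]; linarith

/-- For two stationary spheres through the same point of height `ε`, whose sections at that height
have radii `q'` and `q`, the smaller sphere leans more towards the interior. -/
lemma section_slope_le {β ε ρ R q q' : ℝ} (hε : 0 ≤ ε) (hρ : 0 < ρ) (hρR : ρ ≤ R) (hq : 0 < q)
    (hq' : 0 < q') (hq2 : q ^ 2 = R ^ 2 - (ε + β * R) ^ 2)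
    (hq'2 : q' ^ 2 = ρ ^ 2 - (ε + β * ρ) ^ 2) :
    q' * (ε + β * R) ≤ q * (ε + β * ρ) := by
  have hR : 0 < R := hρ.trans_le hρR
  have hRT : ρ * (ε + β * R) ≤ R * (ε + β * ρ) := by nlinarith
  have hsq : (q * (ε + β * ρ)) ^ 2 - (q' * (ε + β * R)) ^ 2 =
      (R * (ε + β * ρ)) ^ 2 - (ρ * (ε + β * R)) ^ 2 := by
    rw [mul_pow, mul_pow, hq2, hq'2]; ring
  rcases le_or_gt 0 (ε + β * ρ) with h0 | h0
  · rcases le_or_gt (ε + β * R) 0 with h1 | h1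
    · have h2 := mul_nonneg hq.le h0
      have h3 := mul_nonpos_of_nonneg_of_nonpos hq'.le h1
      linarith
    · refine abs_le_of_sq_le_sq' ?_ (by positivity) |>.2
      have := pow_le_pow_left₀ (by positivity) hRT 2
      linarith
  · have h1 : ε + β * R < 0 := by
      by_contra h2
      have h4 := mul_nonneg hρ.le (not_lt.1 h2)
      have h3 := mul_neg_of_pos_of_neg hR h0
      linarith
    have h2 : q * -(ε + β * ρ) ≤ q' * -(ε + β * R) := by
      refine abs_le_of_sq_le_sq' ?_ (mul_nonneg hq'.le (by linarith)) |>.2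
      have := pow_le_pow_left₀ (mul_nonneg hR.le (by linarith))
        (show R * -(ε + β * ρ) ≤ ρ * -(ε + β * R) by linarith) 2
      simp only [mul_neg, even_two.neg_pow] at this ⊢
      linarith
    linarith

lemma section_radius_le {β ε ρ R q q' : ℝ} (hβ : |β| < 1) (hρ : 0 < ρ) (hρR : ρ ≤ R)
    (hε : 0 ≤ ε) (hερ : ε ≤ ρ * ((1 - |β|) / 2)) (hq : 0 < q)
    (hq2 : q ^ 2 = R ^ 2 - (ε + β * R) ^ 2) (hq'2 : q' ^ 2 = ρ ^ 2 - (ε + β * ρ) ^ 2) :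
    q' ≤ q := by
  refine abs_le_of_sq_le_sq' ?_ hq.le |>.2
  have hβ2 : β ^ 2 = |β| ^ 2 := (sq_abs β).symm
  have h1 : (R - ρ) * ((R + ρ) * (1 - |β| ^ 2) - 2 * β * ε) = q ^ 2 - q' ^ 2 := by
    rw [hq2, hq'2, ← hβ2]; ring
  have h2 : 0 ≤ (R + ρ) * (1 - |β| ^ 2) - 2 * β * ε := by
    have h3 : β * ε ≤ 1 * (ρ * ((1 - |β|) / 2)) :=
      mul_le_mul ((le_abs_self β).trans hβ.le) hερ hε zero_le_one
    have h4 : (1 - |β|) * 1 ≤ (1 - |β|) * (1 + |β|) :=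
      mul_le_mul_of_nonneg_left (by linarith [abs_nonneg β]) (by linarith)
    have h5 : ρ * (1 - |β|) ≤ (R + ρ) * (1 - |β| ^ 2) := by
      have e : (1 : ℝ) - |β| ^ 2 = (1 - |β|) * (1 + |β|) := by ring
      rw [e]
      exact mul_le_mul (by linarith) (by linarith) (by linarith) (by linarith)
    linarith
  have := mul_nonneg (sub_nonneg.2 hρR) h2
  linarith

/-- A tangent stationary ball contains, above the height `ε`, a smaller stationary ball that is
tangent at the same point. -/
lemma IsTangentBall.exists_smaller (h : IsTangentBall σ φ ε κ R a P) (hσ : σ ∈ Ioo (-1 : ℝ) 1)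
    (hκ : κ = 1 ∨ κ = -1) (hε : 0 < ε) {ρ : ℝ} (hρ : 0 < ρ) (hρR : ρ ≤ R)
    (hερ : ε ≤ ρ * ((1 - |σ|) / 2)) :
    ∃ a' : Hor n, IsTangentBall σ φ ε κ ρ a' P ∧
      ∀ X : Amb n, ‖X - pt a' (-κ * σ * ρ)‖ ≤ ρ → ε ≤ height X →
        ‖X - pt a (-κ * σ * R)‖ ≤ R := by
  have hσ1 := abs_lt.2 hσ
  have hR : 0 < R := hρ.trans_le hρR
  have hεR : ε ≤ R * ((1 - |σ|) / 2) := hερ.trans (by gcongr)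
  have hPε := (mem_liftedBoundary.1 h.mem).1
  have hβ : |κ * σ| = |σ| := by rw [abs_mul, abs_kappa hκ, one_mul]
  set β := κ * σ with hβdef
  set w := hor P - a with hw
  have hq2 : ‖w‖ ^ 2 = R ^ 2 - (ε + β * R) ^ 2 := h.sq_eq
  have hqpos : 0 < ‖w‖ :=
    (mul_pos (sectionRatio_pos hσ) hR).trans_le (h.sectionRatio_le hσ hκ hε hR hεR)
  set q := ‖w‖ with hq
  have hT'1 : |ε + β * ρ| < ρ := by
    refine (abs_add_le _ _).trans_lt ?_
    rw [abs_mul, hβ, abs_of_pos hε, abs_of_pos hρ]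
    nlinarith
  have hq'pos : 0 < ρ ^ 2 - (ε + β * ρ) ^ 2 := by
    have := sq_lt_sq' (by linarith [(abs_lt.1 hT'1).1]) (abs_lt.1 hT'1).2
    linarith
  set q' := Real.sqrt (ρ ^ 2 - (ε + β * ρ) ^ 2) with hq'
  have hq'0 : 0 < q' := Real.sqrt_pos.2 hq'pos
  have hq'2 : q' ^ 2 = ρ ^ 2 - (ε + β * ρ) ^ 2 := Real.sq_sqrt hq'pos.le
  have hqq : q' ≤ q := section_radius_le (by rw [hβ]; exact hσ1) hρ hρR hε.le
    (by rw [hβ]; exact hερ) hqpos hq2 hq'2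
  have hslope : q' * (ε + β * R) ≤ q * (ε + β * ρ) :=
    section_slope_le hε.le hρ hρR hqpos hq'0 hq2 hq'2
  have hcont : ∀ X : Amb n, ‖X - pt (hor P - (q' / q) • w) (-κ * σ * ρ)‖ ≤ ρ → ε ≤ height X →
      ‖X - pt a (-κ * σ * R)‖ ≤ R := by
    intro X hX hXε
    have e1 := pow_le_pow_left₀ (norm_nonneg _) hX 2
    refine abs_le_of_sq_le_sq' ?_ hR.le |>.2
    have e2 : hor X - (hor P - (q' / q) • w) = (hor X - hor P) + (q' / q) • w := by abel
    have e3 : hor X - a = (hor X - hor P) + w := by rw [hw]; abel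
    rw [norm_sq_sub_pt, e2, norm_add_sq_real, inner_smul_right, norm_smul,
      Real.norm_of_nonneg (by positivity), ← hq, mul_pow, div_pow,
      div_mul_cancel₀ _ (by positivity), hq'2] at e1
    rw [norm_sq_sub_pt, e3, norm_add_sq_real, ← hq, hq2]
    set W : ℝ := inner ℝ (hor X - hor P) w
    set η := height X - ε with hη
    have hη0 : 0 ≤ η := by linarith
    have hh : height X = ε + η := by linarith
    rw [hh] at e1 ⊢
    set N := ‖hor X - hor P‖ ^ 2 with hN
    have hN0 : 0 ≤ N := sq_nonneg _
    have e4 : N + η ^ 2 + 2 * η * (ε + β * ρ) + 2 * (q' / q) * W ≤ 0 := by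
      have : -κ * σ * ρ = -(β * ρ) := by rw [hβdef]; ring
      rw [this] at e1
      nlinarith
    have e5 : q * (N + η ^ 2 + 2 * η * (ε + β * ρ)) + 2 * q' * W ≤ 0 := by
      have := mul_nonpos_of_nonneg_of_nonpos hqpos.le e4
      have e6 : q * (N + η ^ 2 + 2 * η * (ε + β * ρ) + 2 * (q' / q) * W) =
        q * (N + η ^ 2 + 2 * η * (ε + β * ρ)) + 2 * q' * W := by field_simp
      linarith
    have e7 : q' * (N + η ^ 2 + 2 * η * (ε + β * R) + 2 * W) ≤ 0 := by
      have f1 := mul_nonneg (sub_nonneg.2 hqq) (show 0 ≤ N + η ^ 2 by positivity)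
      have f2 := mul_nonneg hη0 (sub_nonneg.2 hslope)
      linarith
    have e8 : N + η ^ 2 + 2 * η * (ε + β * R) + 2 * W ≤ 0 := by
      by_contra hc
      have := mul_pos hq'0 (not_le.1 hc)
      linarith
    have : -κ * σ * R = -(β * R) := by rw [hβdef]; ring
    rw [this]
    nlinarith
  refine ⟨hor P - (q' / q) • w, ⟨h.mem, ?_, fun X hX hXε => h.section_le X (hcont X hX hXε.ge) hXε⟩,
    hcont⟩
  refine (sq_eq_sq₀ (norm_nonneg _) hρ.le).1 ?_
  rw [norm_sq_sub_pt, sub_sub_cancel, norm_smul, Real.norm_of_nonneg (by positivity), ← hq,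
    div_mul_cancel₀ _ hqpos.ne', hq'2, hPε, hβdef]
  ring

/-- An interior tangent stationary ball lies, above the height `ε`, in the cone over `Ω_ε`. -/
lemma IsTangentBall.coneFun_pos (h : IsTangentBall σ φ ε 1 R a P) (hσ : σ ∈ Ioo (-1 : ℝ) 1)
    (hε : 0 < ε) (hR : 0 < R) (hεR : ε ≤ R * ((1 - |σ|) / 2))
    (hLg1 : 1 ≤ Lg) (hLg : ∀ x y, |radialGauge φ x - radialGauge φ y| ≤ Lg * ‖x - y‖)
    (hεs : ε ≤ sectionRatio σ / (4 * Lg)) {X : Amb n} (hX : ‖X - pt a (-1 * σ * R)‖ ≤ R)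
    (hXε : ε < height X) : 0 < coneFun φ ε X := by
  have hs := sectionRatio_pos hσ
  have hσ1 := abs_lt.2 hσ
  set q := ‖hor P - a‖ with hq
  have hqs : sectionRatio σ * R ≤ q := h.sectionRatio_le hσ (Or.inl rfl) hε hR hεR
  have hq0 : 0 < q := (mul_pos hs hR).trans_le hqs
  have hq2 : q ^ 2 = R ^ 2 - (ε + 1 * σ * R) ^ 2 := h.sq_eq
  set d := ‖hor X - a‖ with hd
  have hX2 := pow_le_pow_left₀ (norm_nonneg _) hX 2
  rw [norm_sq_sub_pt, ← hd] at hX2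
  have hsec : ∀ x : Hor n, ‖x - a‖ ≤ q → radialGauge φ x ≤ 1 := by
    intro x hx
    have := h.section_le (pt x ε) (by
      refine abs_le_of_sq_le_sq' ?_ hR.le |>.2
      rw [norm_sq_sub_pt, hor_pt, height_pt]
      have := pow_le_pow_left₀ (norm_nonneg _) hx 2
      nlinarith) (height_pt _ _)
    rw [hor_pt] at this
    linarith
  have hgauge : radialGauge φ (hor X) ≤ 1 + Lg * (2 / sectionRatio σ * (height X - ε)) := by
    rcases le_or_gt d q with hdq | hdq
    · have h1 := hsec (hor X) hdq
      have h2 : 0 ≤ Lg * (2 / sectionRatio σ * (height X - ε)) :=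
        mul_nonneg (by linarith) (mul_nonneg (by positivity) (by linarith))
      linarith
    · -- compare with the closest point of the section
      have hd0 : 0 < d := hq0.trans hdq
      have h1 := hsec (a + (q / d) • (hor X - a)) (by
        rw [add_sub_cancel_left, norm_smul, Real.norm_of_nonneg (by positivity), ← hd,
          div_mul_cancel₀ _ hd0.ne'])
      have h2 := (abs_le.1 (hLg (hor X) (a + (q / d) • (hor X - a)))).2
      have h3 : ‖hor X - (a + (q / d) • (hor X - a))‖ = d - q := by
        have : hor X - (a + (q / d) • (hor X - a)) = (1 - q / d) • (hor X - a) := by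
          rw [sub_smul, one_smul]; abel
        rw [this, norm_smul, Real.norm_of_nonneg (by
          rw [sub_nonneg, div_le_one hd0]; exact hdq.le), ← hd]
        field_simp
      have h4 : (d - q) * q ≤ 2 * R * (height X - ε) := by
        have h5 : d ^ 2 - q ^ 2 ≤ (height X - ε) * -(ε + height X + 2 * σ * R) := by
          rw [hq2]; nlinarith
        have h6 : -(ε + height X + 2 * σ * R) ≤ 2 * R := by
          nlinarith [(abs_lt.1 hσ1).1]
        nlinarith
      have h5 : d - q ≤ 2 / sectionRatio σ * (height X - ε) := by
        rw [div_mul_eq_mul_div, le_div_iff₀ hs]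
        have h6 : (d - q) * (sectionRatio σ * R) ≤ (d - q) * q :=
          mul_le_mul_of_nonneg_left hqs (by linarith)
        nlinarith
      rw [h3] at h2
      have h7 := mul_le_mul_of_nonneg_left h5 (show 0 ≤ Lg by linarith)
      linarith
  have h8 : ε * (Lg * (2 / sectionRatio σ * (height X - ε))) ≤ (height X - ε) / 2 := by
    have h9 : ε * (Lg * (2 / sectionRatio σ * (height X - ε))) =
        ε * (4 * Lg) / sectionRatio σ * ((height X - ε) / 2) := by ring
    have h10 : ε * (4 * Lg) / sectionRatio σ ≤ 1 := by
      rw [div_le_one hs]; rwa [le_div_iff₀ (by positivity)] at hεs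
    rw [h9]
    nlinarith
  have h11 := mul_le_mul_of_nonneg_left hgauge hε.le
  unfold coneFun
  nlinarith

end TangentBall

/-! ### The initial hypersurface near its boundary -/

section Initial

variable {n : ℕ} {σ ε κ R Lg δ : ℝ} {φ : Hor n → ℝ} {f : Amb n → ℝ} {P c : Amb n}

lemma continuousOn_radialGauge (hn : 1 ≤ n) (hε : 0 < ε)
    (hLg : ∀ x y, |radialGauge φ x - radialGauge φ y| ≤ Lg * ‖x - y‖)
    (hf : ContinuousOn f (closure (sphereDomain φ ε))) :
    ContinuousOn (radialGauge f) {X | X ≠ 0 ∧ 0 ≤ coneFun φ ε X} := by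
  have h1 : ContinuousOn (proj : Amb n → Amb n) {X | X ≠ 0 ∧ 0 ≤ coneFun φ ε X} :=
    fun X hX => (continuousAt_proj hX.1).continuousWithinAt
  have h2 := hf.comp h1 fun X hX => (mem_closure_sphereDomain hn hε hLg).2 ⟨norm_proj hX.1, by
    rw [coneFun_proj _ _ hX.1]; exact mul_nonneg (inv_nonneg.2 (norm_nonneg _)) hX.2⟩
  exact continuous_norm.continuousOn.mul h2.neg.rexp

lemma mem_radialGraph_of_gauge (hn : 1 ≤ n) (hε : 0 < ε)
    (hLg : ∀ x y, |radialGauge φ x - radialGauge φ y| ≤ Lg * ‖x - y‖) {X : Amb n} (hX : X ≠ 0)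
    (hc : 0 ≤ coneFun φ ε X) (hG : radialGauge f X = 1) :
    X ∈ radialGraph f (closure (sphereDomain φ ε)) := by
  refine ⟨proj X, (mem_closure_sphereDomain hn hε hLg).2 ⟨norm_proj hX, ?_⟩, ?_⟩
  · rw [coneFun_proj _ _ hX]; exact mul_nonneg (inv_nonneg.2 (norm_nonneg _)) hc
  · have h1 : Real.exp (f (proj X)) = ‖X‖ := by
      rw [radialGauge, Real.exp_neg, mul_inv_eq_one₀ (Real.exp_pos _).ne'] at hG
      exact hG.symm
    simp only [h1, norm_smul_proj]

lemma coneFun_of_mem_liftedBoundary (hP : P ∈ liftedBoundary φ ε) : coneFun φ ε P = 0 := by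
  obtain ⟨h1, h2⟩ := mem_liftedBoundary.1 hP
  rw [coneFun, h1, h2]; ring

lemma ne_zero_of_mem_liftedBoundary (hε : 0 < ε) (hP : P ∈ liftedBoundary φ ε) : P ≠ 0 := by
  rintro rfl
  have := (mem_liftedBoundary.1 hP).1
  simp at this
  linarith

/-- Near `P` the graph lies on one side of a ball meeting it only at `P`. The rays cross the sphere
transversally, so that a point of the ball on the wrong side of the graph would have the point of
the graph on the same ray in the ball. -/
lemma eventually_gauge_near (hn : 1 ≤ n) (hε : 0 < ε)
    (hLg : ∀ x y, |radialGauge φ x - radialGauge φ y| ≤ Lg * ‖x - y‖)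
    (hf : ContinuousOn f (closure (sphereDomain φ ε)))
    (hfb : ∀ z ∈ sphereBoundary φ ε, Real.exp (f z) • z ∈ liftedBoundary φ ε)
    (hκ : κ = 1 ∨ κ = -1) (hP : P ∈ liftedBoundary φ ε) (hc : ‖P - c‖ = R)
    (hin : 0 < κ * inner ℝ P (P - c)) (hδ : 0 < δ)
    (hS : radialGraph f (closure (sphereDomain φ ε)) ∩ Metric.ball P δ ∩
      Metric.closedBall c R ⊆ {P}) :
    ∀ᶠ Z in 𝓝 P, 0 ≤ coneFun φ ε Z → ‖Z - c‖ ≤ R → Z ≠ P → κ * (radialGauge f Z - 1) < 0 := by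
  have hP0 := ne_zero_of_mem_liftedBoundary hε hP
  have hcP := coneFun_of_mem_liftedBoundary hP
  have hGP : radialGauge f P = 1 := by
    rw [radialGauge_of_boundary hn hε hLg hfb hP0 hcP, (mem_liftedBoundary.1 hP).1,
      div_self hε.ne']
  have hG := continuousOn_radialGauge hn hε hLg hf P ⟨hP0, hcP.ge⟩
  have hG1 : Tendsto (radialGauge f) (𝓝[{X | X ≠ 0 ∧ 0 ≤ coneFun φ ε X}] P) (𝓝 1) := by
    have := hG.tendsto; rwa [hGP] at this
  have hinv : Tendsto (fun Z => (radialGauge f Z)⁻¹)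
      (𝓝[{X | X ≠ 0 ∧ 0 ≤ coneFun φ ε X}] P) (𝓝 1) := by simpa using hG1.inv₀ one_ne_zero
  have hid : Tendsto (fun Z : Amb n => Z) (𝓝[{X | X ≠ 0 ∧ 0 ≤ coneFun φ ε X}] P) (𝓝 P) :=
    tendsto_id.mono_left nhdsWithin_le_nhds
  have e1 : ∀ᶠ Z in 𝓝[{X | X ≠ 0 ∧ 0 ≤ coneFun φ ε X}] P,
      (radialGauge f Z)⁻¹ • Z ∈ Metric.ball P δ := by
    have := hinv.smul hid
    rw [one_smul] at this
    exact this.eventually (Metric.ball_mem_nhds P hδ)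
  have e2 : ∀ᶠ Z in 𝓝[{X | X ≠ 0 ∧ 0 ≤ coneFun φ ε X}] P,
      0 < κ * (2 * inner ℝ Z (Z - c) + ((radialGauge f Z)⁻¹ - 1) * ‖Z‖ ^ 2) := by
    have h1 := (((hid.inner (hid.sub_const c)).const_mul 2).add
      ((hinv.sub_const 1).mul (hid.norm.pow 2))).const_mul κ
    refine h1.eventually (lt_mem_nhds ?_)
    linarith
  filter_upwards [eventually_nhdsWithin_iff.1 e1, eventually_nhdsWithin_iff.1 e2,
    isOpen_ne.mem_nhds hP0] with Z h1 h2 hZ0 hcZ hZR hZP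
  have h1 := h1 ⟨hZ0, hcZ⟩
  have h2 := h2 ⟨hZ0, hcZ⟩
  by_contra hcon
  push Not at hcon
  set g := radialGauge f Z with hg
  have hgpos : 0 < g := radialGauge_pos f hZ0
  have hgi : 0 < g⁻¹ := inv_pos.2 hgpos
  have hfac : (g⁻¹ - 1) * (2 * inner ℝ Z (Z - c) + (g⁻¹ - 1) * ‖Z‖ ^ 2) ≤ 0 := by
    have h3 : κ * (g⁻¹ - 1) ≤ 0 := by
      have : κ * (g⁻¹ - 1) = -(g⁻¹ * (κ * (g - 1))) := by field_simp; ring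
      rw [this]; exact neg_nonpos.2 (mul_nonneg hgi.le hcon)
    rcases hκ with rfl | rfl <;> nlinarith
  have hball : ‖g⁻¹ • Z - c‖ ≤ R := by
    have hR : 0 ≤ R := hc ▸ norm_nonneg _
    refine abs_le_of_sq_le_sq' ?_ hR |>.2
    have e : g⁻¹ • Z - c = (Z - c) + (g⁻¹ - 1) • Z := by rw [sub_smul, one_smul]; abel
    have h3 := pow_le_pow_left₀ (norm_nonneg _) hZR 2
    rw [e, norm_add_sq_real, inner_smul_right, norm_smul, mul_pow, Real.norm_eq_abs, sq_abs,
      real_inner_comm]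
    nlinarith
  have hmem : g⁻¹ • Z ∈ radialGraph f (closure (sphereDomain φ ε)) :=
    mem_radialGraph_of_gauge hn hε hLg (smul_ne_zero hgi.ne' hZ0)
      (by rw [coneFun_smul _ _ hgi]; positivity)
      (by rw [radialGauge_smul _ hgi, ← hg, inv_mul_cancel₀ hgpos.ne'])
  have hP' : g⁻¹ • Z = P := hS ⟨⟨hmem, h1⟩, by simpa [dist_eq_norm] using hball⟩
  have hZ : Z = g • P := by rw [← hP', smul_smul, mul_inv_cancel₀ hgpos.ne', one_smul]
  have h3 := pow_le_pow_left₀ (norm_nonneg _) hZR 2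
  have e : Z - c = (P - c) + (g - 1) • P := by rw [hZ, sub_smul, one_smul]; abel
  rw [e, norm_add_sq_real, inner_smul_right, norm_smul, mul_pow, Real.norm_eq_abs, sq_abs,
    real_inner_comm, hc] at h3
  have hg1 : g - 1 = 0 := by
    have hPn : 0 < ‖P‖ ^ 2 := by have := norm_pos_iff.2 hP0; positivity
    by_contra hne
    have hκ1 : κ * κ = 1 := by rcases hκ with rfl | rfl <;> norm_num
    have h4 : 0 < (g - 1) ^ 2 * ‖P‖ ^ 2 := by positivity
    have h5 : 0 ≤ (κ * (g - 1)) * (κ * inner ℝ P (P - c)) := mul_nonneg hcon hin.le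
    have h6 : (κ * (g - 1)) * (κ * inner ℝ P (P - c)) = (g - 1) * inner ℝ P (P - c) := by
      linear_combination (g - 1) * inner ℝ P (P - c) * hκ1
    linarith
  exact hZP (by rw [hZ, show g = 1 by linarith, one_smul])

/-- A point of the ball that can be joined to `P` by a segment inside the cone over `closure Ω_ε`,
or leaving it on the correct side, lies on the correct side of the graph. -/
lemma gauge_of_segment (hn : 1 ≤ n) (hε : 0 < ε)
    (hLg : ∀ x y, |radialGauge φ x - radialGauge φ y| ≤ Lg * ‖x - y‖)
    (hf : ContinuousOn f (closure (sphereDomain φ ε)))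
    (hfb : ∀ z ∈ sphereBoundary φ ε, Real.exp (f z) • z ∈ liftedBoundary φ ε)
    (hκ : κ = 1 ∨ κ = -1) (hP : P ∈ liftedBoundary φ ε) (hc : ‖P - c‖ = R)
    (hin : 0 < κ * inner ℝ P (P - c)) (hδ : 0 < δ)
    (hS : radialGraph f (closure (sphereDomain φ ε)) ∩ Metric.ball P δ ∩
      Metric.closedBall c R ⊆ {P})
    {X : Amb n} (hX0 : X ≠ 0) (hcX : 0 ≤ coneFun φ ε X) (hXR : ‖X - c‖ ≤ R) (hXδ : ‖X - P‖ < δ)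
    (hseg : ∀ s ∈ Icc (0 : ℝ) 1, coneFun φ ε (X + s • (P - X)) = 0 →
      κ * (height (X + s • (P - X)) - ε) ≤ 0) :
    κ * (radialGauge f X - 1) ≤ 0 := by
  by_contra hcon
  push Not at hcon
  have hP0 := ne_zero_of_mem_liftedBoundary hε hP
  have hcP := coneFun_of_mem_liftedBoundary hP
  have hPε := (mem_liftedBoundary.1 hP).1
  have hGP : radialGauge f P = 1 := by
    rw [radialGauge_of_boundary hn hε hLg hfb hP0 hcP, hPε, div_self hε.ne']
  have hXP : X ≠ P := by rintro rfl; rw [hGP] at hcon; simp at hcon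
  have hXh := height_pos_of_coneFun hε hX0 hcX
  set Z : ℝ → Amb n := fun s => X + s • (P - X) with hZ
  have hZc : Continuous Z := by rw [hZ]; fun_prop
  have hZ0 : ∀ s ∈ Icc (0 : ℝ) 1, Z s ≠ 0 := by
    intro s hs h
    have h1 : height (Z s) = (1 - s) * height X + s * ε := by
      rw [hZ]; simp only [height_add, height_smul, height_sub, hPε]; ring
    rw [h, height_zero] at h1
    rcases hs.2.eq_or_lt with rfl | h2
    · linarith
    · have := mul_pos (sub_pos.2 h2) hXh
      have := mul_nonneg hs.1 hε.le
      linarith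
  have hZ1 : Z 1 = P := by rw [hZ]; simp
  have hZball : ∀ s ∈ Icc (0 : ℝ) 1, ‖Z s - c‖ ≤ R ∧ ‖Z s - P‖ < δ := by
    intro s hs
    constructor
    · have e : Z s - c = (1 - s) • (X - c) + s • (P - c) := by
        rw [hZ]; simp only [smul_sub, sub_smul, one_smul]; abel
      rw [e]
      refine (norm_add_le _ _).trans ?_
      rw [norm_smul, norm_smul, Real.norm_of_nonneg (by linarith [hs.2]),
        Real.norm_of_nonneg hs.1, hc]
      nlinarith [mul_le_mul_of_nonneg_left hXR (sub_nonneg.2 hs.2)]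
    · have e : Z s - P = (1 - s) • (X - P) := by
        rw [hZ]; simp only [smul_sub, sub_smul, one_smul]; abel
      rw [e, norm_smul, Real.norm_of_nonneg (by linarith [hs.2])]
      nlinarith [norm_nonneg (X - P), hs.1]
  have hZP : ∀ s ∈ Icc (0 : ℝ) 1, Z s = P → s = 1 := by
    intro s hs h
    have e : (1 - s) • (X - P) = 0 := by
      have : Z s - P = (1 - s) • (X - P) := by
        rw [hZ]; simp only [smul_sub, sub_smul, one_smul]; abel
      rw [← this, h, sub_self]
    rcases smul_eq_zero.1 e with h1 | h1
    · linarith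
    · exact absurd (sub_eq_zero.1 h1) hXP
  -- near `P` the sign is the correct one
  have hnear := (eventually_gauge_near hn hε hLg hf hfb hκ hP hc hin hδ hS)
  have hnear' : ∀ᶠ s in 𝓝 (1 : ℝ), 0 ≤ coneFun φ ε (Z s) → ‖Z s - c‖ ≤ R → Z s ≠ P →
      κ * (radialGauge f (Z s) - 1) < 0 := by
    have := hZc.tendsto 1
    rw [hZ1] at this
    exact this.eventually hnear
  obtain ⟨η, hη, hη1⟩ := Metric.eventually_nhds_iff.1 hnear'
  set s₂ := max 0 (1 - η / 2) with hs₂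
  have hs₂0 : 0 ≤ s₂ := le_max_left _ _
  have hs₂1 : s₂ < 1 := max_lt one_pos (by linarith)
  -- the last parameter with the wrong sign
  have hcone := continuous_coneFun (ε := ε) hLg
  have hK : IsClosed {s : ℝ | s ∈ Icc 0 s₂ ∧ 0 ≤ coneFun φ ε (Z s)} :=
    isClosed_Icc.inter (isClosed_le continuous_const (hcone.comp hZc))
  have hGZ : ContinuousOn (fun s => κ * (radialGauge f (Z s) - 1))
      {s : ℝ | s ∈ Icc 0 s₂ ∧ 0 ≤ coneFun φ ε (Z s)} := by
    refine continuousOn_const.mul (ContinuousOn.sub ?_ continuousOn_const)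
    exact (continuousOn_radialGauge hn hε hLg hf).comp hZc.continuousOn
      fun s hs => ⟨hZ0 s ⟨hs.1.1, hs.1.2.trans hs₂1.le⟩, hs.2⟩
  have hA := hGZ.preimage_isClosed_of_isClosed hK (isClosed_Ici (a := (0 : ℝ)))
  have hAc : IsCompact ({s : ℝ | s ∈ Icc 0 s₂ ∧ 0 ≤ coneFun φ ε (Z s)} ∩
      (fun s => κ * (radialGauge f (Z s) - 1)) ⁻¹' Ici 0) :=
    isCompact_Icc.of_isClosed_subset hA fun s hs => hs.1.1
  have hZ00 : Z 0 = X := by rw [hZ]; simp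
  obtain ⟨s₀, ⟨⟨hs₀, hcs⟩, hGs : 0 ≤ κ * (radialGauge f (Z s₀) - 1)⟩, hmax⟩ :=
    hAc.exists_isGreatest ⟨0, ⟨⟨left_mem_Icc.2 hs₂0, by rwa [hZ00]⟩, by
      simp only [mem_preimage, hZ00, mem_Ici]; exact hcon.le⟩⟩
  have hs₀1 : s₀ ∈ Icc (0 : ℝ) 1 := ⟨hs₀.1, hs₀.2.trans hs₂1.le⟩
  have hs₀ne : s₀ ≠ 1 := (hs₀.2.trans_lt hs₂1).ne
  obtain ⟨hb1, hb2⟩ := hZball s₀ hs₀1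
  have hs₀2 : s₀ < s₂ := by
    refine hs₀.2.lt_of_ne fun h => ?_
    rcases le_or_gt (1 - η / 2) 0 with h1 | h1
    · have h2 : s₀ = 0 := by rw [h, hs₂, max_eq_left h1]
      have := hη1 (show dist (0 : ℝ) 1 < η by rw [dist_comm]; simp; linarith)
      rw [h2] at hcs hb1 hGs hs₀ne
      have := this hcs hb1 (fun h => hs₀ne (hZP 0 (by simp) h))
      linarith
    · have h2 : s₀ = 1 - η / 2 := by rw [h, hs₂, max_eq_right h1.le]
      have := hη1 (y := s₀) (by rw [h2, Real.dist_eq, abs_lt]; constructor <;> linarith)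
        hcs hb1 (fun h => hs₀ne (hZP s₀ hs₀1 h))
      linarith
  have hstrict : 0 < κ * (radialGauge f (Z s₀) - 1) := by
    refine hGs.lt_of_ne fun h => hs₀ne (hZP s₀ hs₀1 ?_)
    have hκ0 : κ ≠ 0 := by rcases hκ with rfl | rfl <;> norm_num
    have hG1 : radialGauge f (Z s₀) = 1 := by
      have := (mul_eq_zero.1 h.symm).resolve_left hκ0; linarith
    exact hS ⟨⟨mem_radialGraph_of_gauge hn hε hLg (hZ0 s₀ hs₀1) hcs hG1, by
      simpa [dist_eq_norm] using hb2⟩, by simpa [dist_eq_norm] using hb1⟩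
  rcases hcs.eq_or_lt with h0 | h0
  · have h1 := hseg s₀ hs₀1 h0.symm
    change κ * (height (Z s₀) - ε) ≤ 0 at h1
    rw [radialGauge_of_boundary hn hε hLg hfb (hZ0 s₀ hs₀1) h0.symm] at hstrict
    have h2 : κ * (height (Z s₀) / ε - 1) = κ * (height (Z s₀) - ε) / ε := by field_simp
    rw [h2] at hstrict
    have := div_nonpos_of_nonpos_of_nonneg h1 hε.le
    linarith
  · -- the sign would persist for a little longer
    have e1 : ∀ᶠ s in 𝓝 s₀, 0 < coneFun φ ε (Z s) :=
      (hcone.comp hZc).continuousAt.eventually (lt_mem_nhds h0)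
    have e2 : ∀ᶠ s in 𝓝 s₀, s < s₂ := gt_mem_nhds hs₀2
    have e3 : ∀ᶠ s in 𝓝[{s : ℝ | s ∈ Icc 0 s₂ ∧ 0 ≤ coneFun φ ε (Z s)}] s₀,
        0 < κ * (radialGauge f (Z s) - 1) :=
      (hGZ s₀ ⟨hs₀, hcs⟩).eventually (lt_mem_nhds hstrict)
    have e4 : ∀ᶠ s in 𝓝[>] s₀, s ∈ Ioi s₀ := self_mem_nhdsWithin
    obtain ⟨s, ⟨⟨h1, h2⟩, h3⟩, h4 : s₀ < s⟩ := (((e1.and e2).and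
      (eventually_nhdsWithin_iff.1 e3)).filter_mono nhdsWithin_le_nhds |>.and e4).exists
    have hsm : s ∈ Icc 0 s₂ ∧ 0 ≤ coneFun φ ε (Z s) := ⟨⟨by linarith [hs₀.1], h2.le⟩, h1.le⟩
    have := hmax ⟨hsm, (h3 hsm).le⟩
    linarith

end Initial

/-! ### The boundary Lipschitz estimate -/

/-- Two balls through a point which are separated by a level of a function have opposite normals. -/
lemma smul_eq_neg_smul_of_separated {E : Type*} [NormedAddCommGroup E] [InnerProductSpace ℝ E]
    {g : E → ℝ} {x p q : E} (hp : ∀ y, ‖y - p‖ < ‖x - p‖ → g y < 1)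
    (hq : ∀ y, ‖y - q‖ < ‖x - q‖ → 1 ≤ g y) :
    ‖x - q‖ • (x - p) = -(‖x - p‖ • (x - q)) := by
  set u := x - p with hu
  set w := x - q with hw
  have key : ∀ ζ, inner ℝ ζ u < 0 → ¬ inner ℝ ζ w < 0 := by
    intro ζ h1 h2
    obtain ⟨s, hs1, hs2⟩ :=
      ((exists_eventually_of_inner_neg h1).and (exists_eventually_of_inner_neg h2)).exists
    have e1 := hp (x + s • ζ) (by rwa [show x + s • ζ - p = u + s • ζ by rw [hu]; abel])
    have e2 := hq (x + s • ζ) (by rwa [show x + s • ζ - q = w + s • ζ by rw [hw]; abel])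
    linarith
  rcases eq_or_ne u 0 with h0 | h0
  · simp [h0]
  rcases eq_or_ne w 0 with h1 | h1
  · simp [h1]
  have hu0 := norm_pos_iff.2 h0
  have hw0 := norm_pos_iff.2 h1
  have hle : ‖u‖ * ‖w‖ + inner ℝ u w ≤ 0 := by
    by_contra hc
    push Not at hc
    refine key (-(‖w‖ • u + ‖u‖ • w)) ?_ ?_
    · have : inner ℝ (-(‖w‖ • u + ‖u‖ • w)) u = -(‖u‖ * (‖u‖ * ‖w‖ + inner ℝ u w)) := by
        rw [inner_neg_left, inner_add_left, real_inner_smul_left, real_inner_smul_left,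
          real_inner_self_eq_norm_sq, real_inner_comm]; ring
      rw [this]; exact neg_neg_of_pos (by positivity)
    · have : inner ℝ (-(‖w‖ • u + ‖u‖ • w)) w = -(‖w‖ * (‖u‖ * ‖w‖ + inner ℝ u w)) := by
        rw [inner_neg_left, inner_add_left, real_inner_smul_left, real_inner_smul_left,
          real_inner_self_eq_norm_sq]; ring
      rw [this]; exact neg_neg_of_pos (by positivity)
  have hsq : ‖‖w‖ • u + ‖u‖ • w‖ ^ 2 ≤ 0 := by
    rw [norm_add_sq_real, norm_smul, norm_smul, real_inner_smul_left, inner_smul_right, norm_norm,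
      norm_norm]
    have : 2 * (‖u‖ * ‖w‖) * (‖u‖ * ‖w‖ + inner ℝ u w) ≤ 0 :=
      mul_nonpos_of_nonneg_of_nonpos (by positivity) hle
    nlinarith
  have h2 : ‖w‖ • u + ‖u‖ • w = 0 := by
    rw [← norm_eq_zero]
    exact pow_eq_zero_iff (two_ne_zero) |>.1 (le_antisymm hsq (sq_nonneg _))
  exact eq_neg_of_add_eq_zero_left h2

/-- At every point of `Γ_ε` there is a tangent stationary ball of radius at least `r`, meeting the
set `S` near the point only there. -/
def HasTangentBalls {n : ℕ} (σ : ℝ) (φ : Hor n → ℝ) (ε r δ κ : ℝ) (S : Set (Amb n)) : Prop :=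
  ∀ Q ∈ liftedBoundary φ ε, ∃ R : ℝ, r ≤ R ∧ ∃ a : Hor n, IsTangentBall σ φ ε κ R a Q ∧
    S ∩ Metric.ball Q δ ∩ Metric.closedBall (pt a (-κ * σ * R)) R ⊆ {Q}

section Boundary

variable {n : ℕ} {σ ε κ R Lg r δ ρ pm : ℝ} {φ : Hor n → ℝ} {f f₀ : Amb n → ℝ} {P : Amb n}
  {v : Amb n → ℝ → ℝ}

lemma IsTangentBall.gauge_lt_one {a : Hor n} (h : IsTangentBall σ φ ε 1 R a P)
    {x : Hor n} (hx : ‖x - a‖ < ‖hor P - a‖) : radialGauge φ x < 1 := by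
  have hR : 0 ≤ R := h.norm_eq ▸ norm_nonneg _
  have key : ∀ y : Hor n, ‖y - a‖ < ‖hor P - a‖ → radialGauge φ y ≤ 1 := by
    intro y hy
    have := h.section_le (pt y ε) (by
      refine abs_le_of_sq_le_sq' ?_ hR |>.2
      have e2 := sq_lt_sq' (by linarith [norm_nonneg (y - a), norm_nonneg (hor P - a)]) hy
      have e3 := h.sq_eq
      rw [norm_sq_sub_pt, hor_pt, height_pt]
      nlinarith) (height_pt _ _)
    rw [hor_pt] at this
    linarith
  have hc : ∀ᶠ s : ℝ in 𝓝 1, ‖s • x - a‖ < ‖hor P - a‖ :=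
    (show Continuous fun s : ℝ => ‖s • x - a‖ by fun_prop).continuousAt.eventually
      (gt_mem_nhds (by simpa using hx))
  obtain ⟨s, hs, hs1 : 1 < s⟩ :=
    ((hc.filter_mono nhdsWithin_le_nhds).and (self_mem_nhdsWithin (s := Ioi (1 : ℝ)))).exists
  have h1 := key _ hs
  rw [radialGauge_smul _ (by linarith)] at h1
  nlinarith [radialGauge_nonneg φ x]

lemma IsTangentBall.one_le_gauge {a : Hor n} (h : IsTangentBall σ φ ε (-1) R a P)
    {x : Hor n} (hx : ‖x - a‖ < ‖hor P - a‖) : 1 ≤ radialGauge φ x := by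
  have hR : 0 ≤ R := h.norm_eq ▸ norm_nonneg _
  have := h.section_le (pt x ε) (by
    refine abs_le_of_sq_le_sq' ?_ hR |>.2
    have e2 := sq_lt_sq' (by linarith [norm_nonneg (x - a), norm_nonneg (hor P - a)]) hx
    have e3 := h.sq_eq
    rw [norm_sq_sub_pt, hor_pt, height_pt]
    nlinarith) (height_pt _ _)
  rw [hor_pt] at this
  linarith

/-- Near `Γ_ε` the initial hypersurface lies above `D_ε`: a point of `D_ε` close to `Γ_ε` lies in
the interior tangent ball at the closest point of `Γ_ε`. -/
lemma gauge_le_one_of_height_eq (hn : 1 ≤ n) (hε : 0 < ε) (hσ : σ ∈ Ioo (-1 : ℝ) 1)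
    (hLg1 : 1 ≤ Lg) (hLg : ∀ x y, |radialGauge φ x - radialGauge φ y| ≤ Lg * ‖x - y‖)
    (hf : ContinuousOn f (closure (sphereDomain φ ε)))
    (hfb : ∀ z ∈ sphereBoundary φ ε, Real.exp (f z) • z ∈ liftedBoundary φ ε)
    (hδ : 0 < δ) (hr : 0 < r) (hεr : ε ≤ r * ((1 - |σ|) / 2))
    (hεs : ε ≤ sectionRatio σ / (4 * Lg))
    (hI : HasTangentBalls σ φ ε r δ 1 (radialGraph f (closure (sphereDomain φ ε))))
    (hE : HasTangentBalls σ φ ε r δ (-1) (radialGraph f (closure (sphereDomain φ ε))))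
    (hP : P ∈ liftedBoundary φ ε) {W : Amb n} (hWε : height W = ε) (hcW : 0 ≤ coneFun φ ε W)
    (hWδ : ‖W - P‖ < δ) (hWr : ‖W - P‖ ≤ 2 * (sectionRatio σ * r)) : radialGauge f W ≤ 1 := by
  have hW0 : W ≠ 0 := by rintro rfl; simp at hWε; linarith
  rcases hcW.eq_or_lt with h0 | hcW'
  · rw [radialGauge_of_boundary hn hε hLg hfb hW0 h0.symm, hWε, div_self hε.ne']
  have hgW : radialGauge φ (hor W) < 1 := by
    rw [coneFun, hWε] at hcW'; nlinarith
  have hcl : IsClosed (liftedBoundary φ ε) := by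
    have : liftedBoundary φ ε = {X | height X = ε ∧ radialGauge φ (hor X) = 1} := by
      ext X; exact mem_liftedBoundary
    rw [this]
    exact (isClosed_eq continuous_height continuous_const).inter
      (isClosed_eq ((continuous_gauge hLg).comp continuous_hor) continuous_const)
  obtain ⟨Q, hQ, hQd⟩ := hcl.exists_infDist_eq_dist ⟨P, hP⟩ W
  have hmin : ∀ Y ∈ liftedBoundary φ ε, ‖W - Q‖ ≤ ‖W - Y‖ := by
    intro Y hY
    rw [← dist_eq_norm, ← dist_eq_norm, ← hQd]
    exact Metric.infDist_le_dist_of_mem hY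
  obtain ⟨hQε, hQ1⟩ := mem_liftedBoundary.1 hQ
  have hWQP := hmin P hP
  have hflat : ∀ Y : Amb n, height Y = ε → ‖W - Y‖ = ‖hor Y - hor W‖ := by
    intro Y hY
    refine (sq_eq_sq₀ (norm_nonneg _) (norm_nonneg _)).1 ?_
    rw [norm_sq_eq_hor, height_sub, hWε, hY, hor_sub, norm_sub_rev]; ring
  -- the ball about `W` with `Q` on its boundary lies in the domain
  have hball : ∀ y : Hor n, ‖y - hor W‖ < ‖hor Q - hor W‖ → radialGauge φ y < 1 := by
    intro y hy
    by_contra hge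
    push Not at hge
    have hcont : ContinuousOn (fun s : ℝ => radialGauge φ (hor W + s • (y - hor W)))
        (Icc 0 1) := ((continuous_gauge hLg).comp (by fun_prop)).continuousOn
    have hmem : (1 : ℝ) ∈ Icc (radialGauge φ (hor W + (0 : ℝ) • (y - hor W)))
        (radialGauge φ (hor W + (1 : ℝ) • (y - hor W))) := by
      simp only [zero_smul, add_zero, one_smul, add_sub_cancel]
      exact ⟨hgW.le, hge⟩
    obtain ⟨s, hs, hs1⟩ := intermediate_value_Icc zero_le_one hcont hmem
    simp only at hs1
    have h1 := hmin (pt (hor W + s • (y - hor W)) ε) (mem_liftedBoundary.2 (by simpa using hs1))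
    rw [hflat _ (height_pt _ _), hflat Q hQε, hor_pt, add_sub_cancel_left, norm_smul,
      Real.norm_of_nonneg hs.1] at h1
    nlinarith [norm_nonneg (y - hor W), hs.2]
  obtain ⟨R₁, hR₁, a₁, hT₁, hS₁⟩ := hI Q hQ
  obtain ⟨R₂, hR₂, a₂, hT₂, -⟩ := hE Q hQ
  have hR₁0 : 0 < R₁ := hr.trans_le hR₁
  have hR₂0 : 0 < R₂ := hr.trans_le hR₂
  have hσ1 := abs_lt.2 hσ
  have hεR₁ : ε ≤ R₁ * ((1 - |σ|) / 2) := hεr.trans (by gcongr)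
  have hεR₂ : ε ≤ R₂ * ((1 - |σ|) / 2) := hεr.trans (by gcongr)
  have hs := sectionRatio_pos hσ
  have hq₁ := hT₁.sectionRatio_le hσ (Or.inl rfl) hε hR₁0 hεR₁
  have hq₂ := hT₂.sectionRatio_le hσ (Or.inr rfl) hε hR₂0 hεR₂
  have hq₁0 : 0 < ‖hor Q - a₁‖ := (mul_pos hs hR₁0).trans_le hq₁
  have hq₂0 : 0 < ‖hor Q - a₂‖ := (mul_pos hs hR₂0).trans_le hq₂
  have hA := smul_eq_neg_smul_of_separated (fun y => hT₁.gauge_lt_one (x := y))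
    (fun y => hT₂.one_le_gauge (x := y))
  have hB := smul_eq_neg_smul_of_separated hball (fun y => hT₂.one_le_gauge (x := y))
  set d := ‖hor Q - hor W‖ with hd
  set q₁ := ‖hor Q - a₁‖
  set q₂ := ‖hor Q - a₂‖
  -- hence `W`, `Q` and the centre of the interior ball are collinear
  have hcol : hor Q - hor W = (d / q₁) • (hor Q - a₁) := by
    have h1 : hor Q - a₂ = -((q₂ / q₁) • (hor Q - a₁)) := by
      have h2 : (q₁ : ℝ)⁻¹ • (q₂ • (hor Q - a₁)) = (q₁ : ℝ)⁻¹ • -(q₁ • (hor Q - a₂)) := by rw [hA]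
      rw [smul_neg, smul_smul, smul_smul, inv_mul_cancel₀ hq₁0.ne', one_smul] at h2
      rw [div_eq_inv_mul, h2, neg_neg]
    have h3 : (q₂ : ℝ)⁻¹ • (q₂ • (hor Q - hor W)) = (q₂ : ℝ)⁻¹ • -(d • (hor Q - a₂)) := by rw [hB]
    rw [smul_smul, inv_mul_cancel₀ hq₂0.ne', one_smul, h1] at h3
    rw [h3]; simp only [smul_neg, neg_neg, smul_smul]
    congr 1; field_simp
  have hdle : d ≤ 2 * q₁ := by
    have h1 : d = ‖W - Q‖ := (hflat Q hQε).symm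
    have h2 : sectionRatio σ * r ≤ sectionRatio σ * R₁ := by gcongr
    linarith
  have hWq : ‖hor W - a₁‖ ≤ q₁ := by
    have h1 : hor W - a₁ = (1 - d / q₁) • (hor Q - a₁) := by
      rw [sub_smul, one_smul, ← hcol]; abel
    rw [h1, norm_smul, Real.norm_eq_abs]
    have h2 : |1 - d / q₁| ≤ 1 := by
      have h3 : d / q₁ ≤ 2 := by rwa [div_le_iff₀ hq₁0]
      have h4 : 0 ≤ d / q₁ := by positivity
      exact abs_le.2 ⟨by linarith, by linarith⟩
    nlinarith
  have hWR : ‖W - pt a₁ (-1 * σ * R₁)‖ ≤ R₁ := by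
    refine abs_le_of_sq_le_sq' ?_ hR₁0.le |>.2
    have e2 := pow_le_pow_left₀ (norm_nonneg _) hWq 2
    have e3 := hT₁.sq_eq
    rw [norm_sq_sub_pt, hWε]
    nlinarith
  have hin := hT₁.le_inner hσ (Or.inl rfl) hε hR₁0 hεR₁ hLg1 hLg hεs
  have := gauge_of_segment hn hε hLg hf hfb (Or.inl rfl) hQ hT₁.norm_eq
    (lt_of_lt_of_le (by positivity) hin) hδ hS₁ hW0 hcW hWR (hWQP.trans_lt hWδ)
    (fun s _ _ => by
      simp only [height_add, height_smul, height_sub, hWε, hQε]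
      simp)
  linarith

/-- The numerical relations between the radius `ρ` of the small stationary balls, the height `ε`
and the constants of the domain and of the local ball condition. -/
structure SmallRadius (σ ε Lg r δ ρ pm : ℝ) : Prop where
  ε_pos : 0 < ε
  ρ_pos : 0 < ρ
  δ_pos : 0 < δ
  ρ_le : ρ ≤ r
  ε_le_ρ : ε ≤ ρ * ((1 - |σ|) / 2)
  one_le : 1 ≤ Lg
  ε_le : ε ≤ sectionRatio σ / (4 * Lg)
  ρ_le_Lg : ρ * (4 * Lg) ≤ 1
  pm_nonneg : 0 ≤ pm
  lt_δ : 4 * ρ + 4 * Lg * ρ * pm < δ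
  le_r : 4 * ρ + 4 * Lg * ρ * pm ≤ 2 * (sectionRatio σ * r)

lemma norm_sub_le_of_ball {X P c : Amb n} (hX : ‖X - c‖ ≤ ρ) (hP : ‖P - c‖ = ρ) :
    ‖X - P‖ ≤ 2 * ρ := by
  have h1 := norm_sub_le (X - c) (P - c)
  rw [sub_sub_sub_cancel_right] at h1
  linarith

lemma one_le_mul_norm (hLg : ∀ x y, |radialGauge φ x - radialGauge φ y| ≤ Lg * ‖x - y‖)
    (hP : P ∈ liftedBoundary φ ε) (hLg1 : 1 ≤ Lg) : 1 ≤ Lg * ‖P‖ := by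
  have h1 := hLg (hor P) 0
  rw [(mem_liftedBoundary.1 hP).2, radialGauge_zero, sub_zero, sub_zero, abs_one] at h1
  have := norm_hor_le P
  nlinarith

/-- The initial hypersurface lies on the correct side of small tangent stationary balls. -/
lemma initial_ball (hn : 1 ≤ n) (hσ : σ ∈ Ioo (-1 : ℝ) 1)
    (hLg : ∀ x y, |radialGauge φ x - radialGauge φ y| ≤ Lg * ‖x - y‖)
    (hf : ContinuousOn f (closure (sphereDomain φ ε)))
    (hfb : ∀ z ∈ sphereBoundary φ ε, Real.exp (f z) • z ∈ liftedBoundary φ ε)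
    (hs : SmallRadius σ ε Lg r δ ρ pm)
    (hI : HasTangentBalls σ φ ε r δ 1 (radialGraph f (closure (sphereDomain φ ε))))
    (hE : HasTangentBalls σ φ ε r δ (-1) (radialGraph f (closure (sphereDomain φ ε))))
    (hκ : κ = 1 ∨ κ = -1) (hP : P ∈ liftedBoundary φ ε) (hPpm : ‖P‖ ≤ pm) :
    ∃ a : Hor n, IsTangentBall σ φ ε κ ρ a P ∧
      ∀ X : Amb n, X ≠ 0 → ‖X - pt a (-κ * σ * ρ)‖ ≤ ρ → 0 ≤ coneFun φ ε X →
        (κ = 1 ∨ ε ≤ height X) → κ * (radialGauge f X - 1) ≤ 0 := by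
  have hε := hs.ε_pos
  have hρ := hs.ρ_pos
  have hLg1 := hs.one_le
  have hσ1 := abs_lt.2 hσ
  obtain ⟨R, hR, a, hT, hS⟩ : ∃ R : ℝ, r ≤ R ∧ ∃ a : Hor n, IsTangentBall σ φ ε κ R a P ∧
      radialGraph f (closure (sphereDomain φ ε)) ∩ Metric.ball P δ ∩
        Metric.closedBall (pt a (-κ * σ * R)) R ⊆ {P} := by
    rcases hκ with rfl | rfl
    · exact hI P hP
    · exact hE P hP
  have hρR : ρ ≤ R := hs.ρ_le.trans hR
  have hR0 : 0 < R := hρ.trans_le hρR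
  have hεR : ε ≤ R * ((1 - |σ|) / 2) := hs.ε_le_ρ.trans (by gcongr)
  have hεr : ε ≤ r * ((1 - |σ|) / 2) := hs.ε_le_ρ.trans (by gcongr; exact hs.ρ_le)
  have hin := hT.le_inner hσ hκ hε hR0 hεR hLg1 hLg hs.ε_le
  have hsp := sectionRatio_pos hσ
  have hin' : 0 < κ * inner ℝ P (P - pt a (-κ * σ * R)) := lt_of_lt_of_le (by positivity) hin
  obtain ⟨a', hT', hsub⟩ := hT.exists_smaller hσ hκ hε hρ hρR hs.ε_le_ρ
  have hPε := (mem_liftedBoundary.1 hP).1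
  have hprod : 0 ≤ 4 * Lg * ρ * pm := by have := hs.pm_nonneg; positivity
  refine ⟨a', hT', fun X hX0 hXρ hcX hXκ => ?_⟩
  have hXP := norm_sub_le_of_ball hXρ hT'.norm_eq
  have hhX := height_pos_of_coneFun hε hX0 hcX
  have hup : ε ≤ height X → κ * (radialGauge f X - 1) ≤ 0 := by
    intro hXε
    refine gauge_of_segment hn hε hLg hf hfb hκ hP hT.norm_eq hin' hs.δ_pos hS hX0 hcX
      (hsub X hXρ hXε) (by linarith [hs.lt_δ]) fun s hs01 hcs => ?_
    have hh : ε ≤ height (X + s • (P - X)) := by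
      simp only [height_add, height_smul, height_sub, hPε]
      nlinarith [hs01.1, hs01.2]
    rcases hκ with rfl | rfl
    · rcases hh.eq_or_lt with h1 | h1
      · rw [← h1]; simp
      · have h2 := hT'.coneFun_pos hσ hε hρ hs.ε_le_ρ hLg1 hLg hs.ε_le (X := X + s • (P - X)) (by
          have e : X + s • (P - X) - pt a' (-1 * σ * ρ) = (1 - s) • (X - pt a' (-1 * σ * ρ)) +
              s • (P - pt a' (-1 * σ * ρ)) := by
            simp only [smul_sub, sub_smul, one_smul]; abel
          rw [e]
          refine (norm_add_le _ _).trans ?_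
          rw [norm_smul, norm_smul, Real.norm_of_nonneg (by linarith [hs01.2]),
            Real.norm_of_nonneg hs01.1, hT'.norm_eq]
          nlinarith [mul_le_mul_of_nonneg_left hXρ (sub_nonneg.2 hs01.2)]) h1
        linarith
    · linarith
  rcases hκ with rfl | rfl
  · rcases le_or_gt ε (height X) with h1 | h1
    · exact hup h1
    · -- points below the height `ε` are compared with `D_ε` along their ray
      set μ := ε / height X with hμ
      have hμ1 : 1 ≤ μ := by rw [hμ, one_le_div hhX]; exact h1.le
      have hg : 1 - 2 * Lg * ρ ≤ radialGauge φ (hor X) := by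
        have h2 := (abs_le.1 (hLg (hor X) (hor P))).1
        rw [(mem_liftedBoundary.1 hP).2, ← hor_sub] at h2
        have h3 := (norm_hor_le (X - P)).trans hXP
        have h4 := mul_le_mul_of_nonneg_left h3 (show 0 ≤ Lg by linarith)
        linarith
      have hμ2 : μ * (1 - 2 * Lg * ρ) ≤ 1 := by
        rw [hμ, div_mul_eq_mul_div, div_le_one hhX]
        have h2 := mul_le_mul_of_nonneg_left hg hε.le
        unfold coneFun at hcX
        linarith
      have hμ3 : μ ≤ 2 := by nlinarith [hs.ρ_le_Lg]
      have hμ4 : μ - 1 ≤ 4 * Lg * ρ := by nlinarith [mul_pos (show 0 < Lg by linarith) hρ]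
      have hWP : ‖μ • X - P‖ ≤ 4 * ρ + 4 * Lg * ρ * pm := by
        have e : μ • X - P = μ • (X - P) + (μ - 1) • P := by
          simp only [smul_sub, sub_smul, one_smul]; abel
        rw [e]
        refine (norm_add_le _ _).trans ?_
        rw [norm_smul, norm_smul, Real.norm_of_nonneg (by linarith),
          Real.norm_of_nonneg (by linarith)]
        have h2 : (μ - 1) * ‖P‖ ≤ 4 * Lg * ρ * pm :=
          mul_le_mul hμ4 hPpm (norm_nonneg _) (by positivity)
        nlinarith
      have hμpos : 0 < μ := by linarith
      have h2 := gauge_le_one_of_height_eq hn hε hσ hLg1 hLg hf hfb hs.δ_pos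
        (hρ.trans_le hs.ρ_le) hεr hs.ε_le hI hE hP (W := μ • X)
        (by rw [height_smul, hμ, div_mul_cancel₀ _ hhX.ne'])
        (by rw [coneFun_smul _ _ hμpos]; positivity) (hWP.trans_lt hs.lt_δ) (hWP.trans hs.le_r)
      rw [radialGauge_smul _ hμpos] at h2
      nlinarith [radialGauge_nonneg f X]
  · exact hup (hXκ.resolve_left (by norm_num))

/-- The evolving hypersurface stays on the correct side of a tangent stationary ball. -/
lemma IsRegularSolution.barrier_ball (hn : 1 ≤ n) (hε : 0 < ε)
    (hLg : ∀ x y, |radialGauge φ x - radialGauge φ y| ≤ Lg * ‖x - y‖)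
    (hv : IsRegularSolution σ φ ε f₀ v) (hκ : κ = 1 ∨ κ = -1) (hρ : 0 < ρ) {a : Hor n}
    (hT : IsTangentBall σ φ ε κ ρ a P) (h0 : ρ < ‖pt a (-κ * σ * ρ)‖)
    (hext : κ = 1 → ∀ X : Amb n, ‖X - pt a (-κ * σ * ρ)‖ ≤ ρ → ε < height X → 0 < coneFun φ ε X)
    (hinit : ∀ X : Amb n, X ≠ 0 → ‖X - pt a (-κ * σ * ρ)‖ ≤ ρ → 0 ≤ coneFun φ ε X →
      (κ = 1 ∨ ε ≤ height X) → κ * (radialGauge (fun x => v x 0) X - 1) ≤ 0) :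
    ∀ t, 0 ≤ t → ∀ X : Amb n, ‖X - pt a (-κ * σ * ρ)‖ ≤ ρ → 0 ≤ coneFun φ ε X →
      (κ = 1 ∨ ε ≤ height X) → κ * (radialGauge (fun x => v x t) X - 1) ≤ 0 := by
  set c := pt a (-κ * σ * ρ) with hc
  have hne : ∀ X : Amb n, ‖X - c‖ ≤ ρ → X ≠ 0 := by
    rintro X hX rfl
    rw [zero_sub, norm_neg] at hX
    linarith
  have hcone := continuous_coneFun (ε := ε) hLg
  set T : Set (Amb n) := {X | ‖X - c‖ ≤ ρ ∧ 0 ≤ coneFun φ ε X ∧ (κ = 1 ∨ ε ≤ height X)} with hTdef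
  have hTc : IsCompact T := by
    have h1 : IsClosed {X : Amb n | κ = 1 ∨ ε ≤ height X} := by
      by_cases h : κ = 1
      · simp [h]
      · simpa [h] using isClosed_le continuous_const continuous_height
    have h2 : T = Metric.closedBall c ρ ∩ ({X | 0 ≤ coneFun φ ε X} ∩
        {X : Amb n | κ = 1 ∨ ε ≤ height X}) := by
      ext X; simp [hTdef, dist_eq_norm]
    rw [h2]
    exact (isCompact_closedBall c ρ).inter_right ((isClosed_le continuous_const hcone).inter h1)
  have key := hv.barrier hn hε hLg hTc (fun X hX => ⟨hne X hX.1, hX.2.1⟩) (m := κ) (g := κ)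
    (by rcases hκ with rfl | rfl <;> norm_num)
    (fun X hX => by
      have := hinit X (hne X hX.1) hX.1 hX.2.1 hX.2.2
      linarith)
    (fun X hX => by
      obtain ⟨hX1, hX2, hX3⟩ := hX
      have hX0 := hne X hX1
      rcases hX2.eq_or_lt with hc0 | hc0
      · left
        intro t ht
        rw [hv.gauge_boundary hn hε hLg hX0 hc0.symm ht]
        rcases hκ with rfl | rfl
        · have : height X ≤ ε := by
            by_contra h
            have := hext rfl X hX1 (not_le.1 h)
            linarith
          rw [one_mul, div_le_one hε]; exact this
        · have : ε ≤ height X := hX3.resolve_left (by norm_num)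
          have := (one_le_div hε).2 this
          linarith
      · right
        by_cases hmove : ∃ b : ℝ, 0 < b ∧ b • X ∈ T ∧ κ < κ * b
        · exact Or.inl hmove
        right
        have hXκ : κ = 1 ∨ ε < height X := by
          rcases hκ with rfl | rfl
          · exact Or.inl rfl
          · refine Or.inr ((hX3.resolve_left (by norm_num)).lt_of_ne fun h1 => ?_)
            have h2 := hT.section_le X hX1 h1.symm
            rw [coneFun, ← h1] at hc0
            nlinarith
        have hfar : ∀ᶠ s : ℝ in 𝓝[>] 0, ¬ ‖(1 + κ * s) • X - c‖ ≤ ρ := by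
          have e1 : ∀ᶠ s : ℝ in 𝓝 0, 0 < 1 + κ * s :=
            (show Continuous fun s : ℝ => 1 + κ * s by fun_prop).continuousAt.eventually
              (lt_mem_nhds (by simp))
          have e2 : ∀ᶠ s : ℝ in 𝓝 0, κ = 1 ∨ ε < height ((1 + κ * s) • X) := by
            rcases hXκ with h | h
            · exact Eventually.of_forall fun s => Or.inl h
            · have : Continuous fun s : ℝ => height ((1 + κ * s) • X) :=
                continuous_height.comp (by fun_prop)
              exact (this.continuousAt.eventually (lt_mem_nhds (by simpa using h))).mono
                fun s hs => Or.inr hs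
          filter_upwards [e1.filter_mono nhdsWithin_le_nhds, e2.filter_mono nhdsWithin_le_nhds,
            self_mem_nhdsWithin] with s h1 h2 (h3 : 0 < s) h4
          refine hmove ⟨1 + κ * s, h1, ⟨h4, ?_, h2.imp_right le_of_lt⟩, ?_⟩
          · rw [coneFun_smul _ _ h1]; positivity
          · rcases hκ with rfl | rfl <;> linarith
        refine ⟨hc0, c, ρ, κ, hρ, ?_, by rw [hc, height_pt], hκ, ?_, ?_⟩
        · refine hX1.eq_of_not_lt fun hlt => ?_
          have e1 : ∀ᶠ s : ℝ in 𝓝 0, ‖(1 + κ * s) • X - c‖ < ρ :=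
            (show Continuous fun s : ℝ => ‖(1 + κ * s) • X - c‖ by
              fun_prop).continuousAt.eventually (gt_mem_nhds (by simpa using hlt))
          obtain ⟨s, h1, h2⟩ := ((e1.filter_mono nhdsWithin_le_nhds).and hfar).exists
          exact h2 h1.le
        · by_contra hneg
          push Not at hneg
          have h1 : inner ℝ (κ • X) (X - c) < 0 := by
            rwa [real_inner_smul_left, real_inner_comm]
          obtain ⟨s, h2, h3⟩ := ((exists_eventually_of_inner_neg h1).and hfar).exists
          refine h3 ?_
          have : (1 + κ * s) • X - c = X - c + s • κ • X := by
            rw [add_smul, one_smul, smul_smul, mul_comm]; abel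
          rw [this]
          exact h2.le.trans hX1
        · have e1 : ∀ᶠ Y in 𝓝 X, 0 < coneFun φ ε Y :=
            hcone.continuousAt.eventually (lt_mem_nhds hc0)
          have e2 : ∀ᶠ Y : Amb n in 𝓝 X, κ = 1 ∨ ε < height Y := by
            rcases hXκ with h | h
            · exact Eventually.of_forall fun s => Or.inl h
            · exact (continuous_height.continuousAt.eventually (lt_mem_nhds h)).mono
                fun s hs => Or.inr hs
          filter_upwards [e1.filter_mono nhdsWithin_le_nhds, e2.filter_mono nhdsWithin_le_nhds,
            self_mem_nhdsWithin] with Y h1 h2 h3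
          rw [mem_sphere_iff_norm] at h3
          exact ⟨h3.le, h1.le, h2.imp_right le_of_lt⟩)
  intro t ht X hX hcX hXκ
  have := key t ht X ⟨hX, hcX, hXκ⟩
  linarith

end Boundary

section BoundaryLipschitz

variable {n : ℕ} {σ ε Lg r δ ρ pm K δ₂ : ℝ} {φ : Hor n → ℝ} {f f₀ : Amb n → ℝ} {P : Amb n}
  {v : Amb n → ℝ → ℝ}

lemma IsRegularSolution.eqOn_initial (hv : IsRegularSolution σ φ ε f₀ v)
    (hf₀ : ContinuousOn f₀ (closure (sphereDomain φ ε))) :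
    EqOn (fun x => v x 0) f₀ (closure (sphereDomain φ ε)) := by
  have h1 : ContinuousOn (fun x => v x 0) (closure (sphereDomain φ ε)) :=
    hv.continuous.comp (f := fun x => (x, (0 : ℝ))) (by fun_prop) fun x hx => ⟨hx, self_mem_Ici⟩
  exact EqOn.of_subset_closure hv.initial h1 hf₀ subset_closure Subset.rfl

lemma proj_mem_closure (hn : 1 ≤ n) (hε : 0 < ε)
    (hLg : ∀ x y, |radialGauge φ x - radialGauge φ y| ≤ Lg * ‖x - y‖) {X : Amb n} (hX : X ≠ 0)
    (hc : 0 ≤ coneFun φ ε X) : proj X ∈ closure (sphereDomain φ ε) :=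
  (mem_closure_sphereDomain hn hε hLg).2 ⟨norm_proj hX, by
    rw [coneFun_proj _ _ hX]; exact mul_nonneg (inv_nonneg.2 (norm_nonneg _)) hc⟩

lemma IsRegularSolution.gauge_initial (hn : 1 ≤ n) (hε : 0 < ε)
    (hLg : ∀ x y, |radialGauge φ x - radialGauge φ y| ≤ Lg * ‖x - y‖)
    (hv : IsRegularSolution σ φ ε f₀ v)
    (hf₀ : ContinuousOn f₀ (closure (sphereDomain φ ε))) {X : Amb n} (hX : X ≠ 0)
    (hc : 0 ≤ coneFun φ ε X) : radialGauge (fun x => v x 0) X = radialGauge f₀ X := by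
  have := hv.eqOn_initial hf₀ (proj_mem_closure hn hε hLg hX hc)
  simp only at this
  rw [radialGauge, radialGauge, this]

/-- Small tangent balls are barriers: through every point of `Γ_ε` there is one of radius `ρ`, and
the evolving hypersurface stays on the correct side of it. -/
lemma IsRegularSolution.side_of_ball (hn : 1 ≤ n) (hσ : σ ∈ Ioo (-1 : ℝ) 1)
    (hLg : ∀ x y, |radialGauge φ x - radialGauge φ y| ≤ Lg * ‖x - y‖)
    (hv : IsRegularSolution σ φ ε f₀ v)
    (hf₀ : ContinuousOn f₀ (closure (sphereDomain φ ε)))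
    (hfb : ∀ z ∈ sphereBoundary φ ε, Real.exp (f₀ z) • z ∈ liftedBoundary φ ε)
    (hs : SmallRadius σ ε Lg r δ ρ pm)
    (hI : HasTangentBalls σ φ ε r δ 1 (radialGraph f₀ (closure (sphereDomain φ ε))))
    (hE : HasTangentBalls σ φ ε r δ (-1) (radialGraph f₀ (closure (sphereDomain φ ε))))
    {κ : ℝ} (hκ : κ = 1 ∨ κ = -1) (hP : P ∈ liftedBoundary φ ε) (hPpm : ‖P‖ ≤ pm) :
    ∃ a : Hor n, IsTangentBall σ φ ε κ ρ a P ∧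
      ∀ t, 0 ≤ t → ∀ X : Amb n, ‖X - pt a (-κ * σ * ρ)‖ ≤ ρ → 0 ≤ coneFun φ ε X →
        (κ = 1 ∨ ε ≤ height X) → κ * (radialGauge (fun x => v x t) X - 1) ≤ 0 := by
  obtain ⟨a, hT, hinit⟩ := initial_ball hn hσ hLg hf₀ hfb hs hI hE hκ hP hPpm
  refine ⟨a, hT, hv.barrier_ball hn hs.ε_pos hLg hκ hs.ρ_pos hT ?_ ?_ ?_⟩
  · have h1 := one_le_mul_norm hLg hP hs.one_le
    have h2 := norm_sub_norm_le P (P - pt a (-κ * σ * ρ))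
    rw [sub_sub_cancel, hT.norm_eq] at h2
    have h3 : 4 * ρ ≤ ‖P‖ := by
      have : Lg * (4 * ρ) ≤ Lg * ‖P‖ := by linarith [hs.ρ_le_Lg]
      exact le_of_mul_le_mul_left this (by linarith [hs.one_le])
    linarith [hs.ρ_pos]
  · rintro rfl X hX hXε
    exact hT.coneFun_pos hσ hs.ε_pos hs.ρ_pos hs.ε_le_ρ hs.one_le hLg hs.ε_le hX hXε
  · intro X hX0 hX hc hXκ
    rw [hv.gauge_initial hn hs.ε_pos hLg hf₀ hX0 hc]
    exact hinit X hX0 hX hc hXκ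

/-- Since the rays cross the boundary of the ball at a uniform angle, a point `Y` near `P` is
brought into the tangent ball by the factor `1 - κ K |Y - P|`. -/
lemma IsTangentBall.smul_mem {κ : ℝ} {a : Hor n} (hT : IsTangentBall σ φ ε κ ρ a P)
    (hσ : σ ∈ Ioo (-1 : ℝ) 1) (hκ : κ = 1 ∨ κ = -1)
    (hLg : ∀ x y, |radialGauge φ x - radialGauge φ y| ≤ Lg * ‖x - y‖)
    (hs : SmallRadius σ ε Lg r δ ρ pm) (hPpm : ‖P‖ ≤ pm) (hK : K = 12 * Lg / sectionRatio σ)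
    (hδK : K * δ₂ ≤ 1 / 2) (hδ₂ : δ₂ * (2 + K * pm) ^ 2 ≤ 3 * ρ) {Y : Amb n} (hY : ‖Y - P‖ ≤ δ₂) :
    ‖(1 - κ * (K * ‖Y - P‖)) • Y - pt a (-κ * σ * ρ)‖ ≤ ρ := by
  have hsr := sectionRatio_pos hσ
  have hLg1 := hs.one_le
  have hρ := hs.ρ_pos
  have hpm := hs.pm_nonneg
  have hK0 : 0 < K := by rw [hK]; positivity
  set Δ := ‖Y - P‖ with hΔ
  have hΔ0 : 0 ≤ Δ := norm_nonneg _
  have hKΔ : K * Δ ≤ 1 / 2 := (mul_le_mul_of_nonneg_left hY hK0.le).trans hδK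
  have hin := hT.le_inner hσ hκ hs.ε_pos hρ hs.ε_le_ρ hLg1 hLg hs.ε_le
  have hKin : 3 * ρ ≤ K * (κ * inner ℝ P (P - pt a (-κ * σ * ρ))) := by
    refine le_trans (le_of_eq ?_) (mul_le_mul_of_nonneg_left hin hK0.le)
    rw [hK]; field_simp; norm_num
  set c := pt a (-κ * σ * ρ) with hc
  set μ := 1 - κ * (K * Δ) with hμ
  have hκ1 := abs_kappa hκ
  have hμκ : |κ * (K * Δ)| ≤ 1 / 2 := by
    rw [abs_mul, hκ1, one_mul, abs_of_nonneg (by positivity)]; exact hKΔ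
  have hμ0 : 0 ≤ μ := by linarith [(abs_le.1 hμκ).2]
  have hμ1 : μ ≤ 3 / 2 := by linarith [(abs_le.1 hμκ).1]
  have e : μ • Y - c = (P - c) + (μ • (Y - P) - (κ * (K * Δ)) • P) := by
    rw [hμ]; simp only [sub_smul, smul_sub, one_smul]; abel
  have h1 : ‖μ • (Y - P) - (κ * (K * Δ)) • P‖ ≤ Δ * (2 + K * pm) := by
    refine (norm_sub_le _ _).trans ?_
    rw [norm_smul, norm_smul, Real.norm_of_nonneg hμ0, Real.norm_eq_abs, abs_mul, hκ1, one_mul,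
      abs_of_nonneg (by positivity), ← hΔ]
    have : K * Δ * ‖P‖ ≤ K * Δ * pm := by gcongr
    nlinarith
  have h2 : inner ℝ (P - c) (μ • (Y - P) - (κ * (K * Δ)) • P) ≤ 3 / 2 * (Δ * ρ) - Δ * (3 * ρ) := by
    rw [inner_sub_right, inner_smul_right, inner_smul_right]
    have h3 : inner ℝ (P - c) (Y - P) ≤ ρ * Δ := by
      have := real_inner_le_norm (P - c) (Y - P)
      rwa [hT.norm_eq] at this
    have h4 : μ * inner ℝ (P - c) (Y - P) ≤ 3 / 2 * (Δ * ρ) :=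
      (mul_le_mul_of_nonneg_left h3 hμ0).trans (by nlinarith [mul_nonneg hρ.le hΔ0])
    have h5 := mul_le_mul_of_nonneg_left hKin hΔ0
    rw [real_inner_comm] at h5
    linarith
  refine abs_le_of_sq_le_sq' ?_ hρ.le |>.2
  rw [e, norm_add_sq_real, hT.norm_eq]
  have h6 := pow_le_pow_left₀ (norm_nonneg _) h1 2
  have h7 : Δ * (2 + K * pm) ^ 2 ≤ 3 * ρ :=
    (mul_le_mul_of_nonneg_right hY (sq_nonneg _)).trans hδ₂
  have h8 := mul_le_mul_of_nonneg_left h7 hΔ0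
  nlinarith

/-- The Lipschitz estimate for the gauge at the points of `Γ_ε`, where the gauge equals `1`. The
constant `K` depends only on `σ` and on the Lipschitz constant of the gauge of the domain. -/
theorem IsRegularSolution.abs_gauge_sub_one_le (hn : 1 ≤ n) (hσ : σ ∈ Ioo (-1 : ℝ) 1)
    (hLg : ∀ x y, |radialGauge φ x - radialGauge φ y| ≤ Lg * ‖x - y‖)
    (hv : IsRegularSolution σ φ ε f₀ v)
    (hf₀ : ContinuousOn f₀ (closure (sphereDomain φ ε)))
    (hfb : ∀ z ∈ sphereBoundary φ ε, Real.exp (f₀ z) • z ∈ liftedBoundary φ ε)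
    (hs : SmallRadius σ ε Lg r δ ρ pm)
    (hI : HasTangentBalls σ φ ε r δ 1 (radialGraph f₀ (closure (sphereDomain φ ε))))
    (hE : HasTangentBalls σ φ ε r δ (-1) (radialGraph f₀ (closure (sphereDomain φ ε))))
    (hP : P ∈ liftedBoundary φ ε) (hPpm : ‖P‖ ≤ pm) (hK : K = 12 * Lg / sectionRatio σ)
    (hδK : K * δ₂ ≤ 1 / 2) (hδ₂ : δ₂ * (2 + K * pm) ^ 2 ≤ 3 * ρ) {Y : Amb n} (hY : ‖Y - P‖ ≤ δ₂)
    (hcY : 0 ≤ coneFun φ ε Y) {t : ℝ} (ht : 0 ≤ t) :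
    |radialGauge (fun x => v x t) Y - 1| ≤ 2 * K * ‖Y - P‖ := by
  obtain ⟨a₁, hT₁, h1⟩ := hv.side_of_ball hn hσ hLg hf₀ hfb hs hI hE (Or.inl rfl) hP hPpm
  obtain ⟨a₂, hT₂, h2⟩ := hv.side_of_ball hn hσ hLg hf₀ hfb hs hI hE (Or.inr rfl) hP hPpm
  have hb₁ := hT₁.smul_mem hσ (Or.inl rfl) hLg hs hPpm hK hδK hδ₂ hY
  have hb₂ := hT₂.smul_mem hσ (Or.inr rfl) hLg hs hPpm hK hδK hδ₂ hY
  have hsr := sectionRatio_pos hσ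
  have hLg1 := hs.one_le
  have hK0 : 0 < K := by rw [hK]; positivity
  have hKLg : 12 * Lg ≤ K := by
    rw [hK, le_div_iff₀ hsr]
    nlinarith [sectionRatio_le_one σ]
  set Δ := ‖Y - P‖ with hΔ
  have hΔ0 : 0 ≤ Δ := norm_nonneg _
  have hKΔ : K * Δ ≤ 1 / 2 := (mul_le_mul_of_nonneg_left hY hK0.le).trans hδK
  have hKΔ0 : 0 ≤ K * Δ := by positivity
  have hg := h1 t ht _ hb₁ (by
    rw [coneFun_smul _ _ (by linarith)]; exact mul_nonneg (by linarith) hcY)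
    (Or.inl rfl)
  have hg' := h2 t ht _ hb₂ (by
    rw [coneFun_smul _ _ (by linarith)]; exact mul_nonneg (by linarith) hcY)
    (Or.inr (by
      -- the exterior ball is a barrier only above the height `ε`, which the scaling exceeds
      have e1 := (abs_le.1 (hLg (hor Y) (hor P))).1
      rw [(mem_liftedBoundary.1 hP).2, ← hor_sub] at e1
      have e2 := mul_le_mul_of_nonneg_left (norm_hor_le (Y - P)) (show 0 ≤ Lg by linarith)
      have e3 : ε * (1 - Lg * Δ) ≤ height Y := by
        have : ε * (1 - Lg * Δ) ≤ ε * radialGauge φ (hor Y) :=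
          mul_le_mul_of_nonneg_left (by linarith) hs.ε_pos.le
        unfold coneFun at hcY
        linarith
      have e4 : 1 ≤ (1 + K * Δ) * (1 - Lg * Δ) := by
        nlinarith [mul_nonneg hΔ0 (show 0 ≤ Lg by linarith)]
      rw [height_smul]
      have e5 := mul_le_mul_of_nonneg_left e3 (show 0 ≤ 1 + K * Δ by linarith)
      have e6 := mul_le_mul_of_nonneg_left e4 hs.ε_pos.le
      linarith))
  rw [radialGauge_smul _ (by linarith)] at hg hg'
  have hG := radialGauge_nonneg (fun x => v x t) Y
  refine abs_le.2 ⟨?_, ?_⟩ <;> nlinarith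

end BoundaryLipschitz

/-! ### Uniform bounds for the solution -/

/-- Polar coordinates for the asymmetric norm with spheres `b ↦ τ (b - σ e)`, `|b| = 1`. -/
lemma exists_eq_smul_sub_vert {n : ℕ} {σ : ℝ} (hσ : σ ∈ Ioo (-1 : ℝ) 1) (ξ : Amb n) :
    ∃ (τ : ℝ) (b : Amb n), 0 ≤ τ ∧ ‖b‖ = 1 ∧ ξ = τ • (b - σ • vert n) ∧ τ * (1 - |σ|) ≤ ‖ξ‖ := by
  rcases eq_or_ne ξ 0 with rfl | hξ
  · exact ⟨0, vert n, le_rfl, norm_vert, by simp, by simp⟩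
  obtain ⟨τ, hτ, h⟩ : ∃ τ : ℝ, 0 < τ ∧ ‖ξ + (τ * σ) • vert n‖ = τ := by
    -- the positive root of the quadratic equation for `τ`
    set N := ‖ξ‖
    have hN : 0 < N := norm_pos_iff.2 hξ
    set h := height ξ
    have hq : 0 < 1 - σ ^ 2 := by nlinarith [hσ.1, hσ.2]
    set s := Real.sqrt (σ ^ 2 * h ^ 2 + (1 - σ ^ 2) * N ^ 2) with hs
    have hs2 : s ^ 2 = σ ^ 2 * h ^ 2 + (1 - σ ^ 2) * N ^ 2 := Real.sq_sqrt (by positivity)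
    have hsp : |σ * h| < s := by
      refine abs_lt_of_sq_lt_sq ?_ (Real.sqrt_nonneg _)
      rw [hs2, mul_pow]
      have : 0 < (1 - σ ^ 2) * N ^ 2 := by positivity
      linarith
    have hτ : 0 < (σ * h + s) / (1 - σ ^ 2) := div_pos (by linarith [(abs_lt.1 hsp).1]) hq
    refine ⟨_, hτ, ?_⟩
    rw [← sq_eq_sq₀ (norm_nonneg _) hτ.le, norm_add_sq_real, inner_smul_right, norm_smul, norm_vert,
      real_inner_comm, show inner ℝ (vert n) ξ = h from rfl, mul_one, Real.norm_eq_abs, sq_abs]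
    field_simp
    nlinarith
  refine ⟨τ, τ⁻¹ • (ξ + (τ * σ) • vert n), hτ.le, ?_, ?_, ?_⟩
  · rw [norm_smul, h, norm_inv, Real.norm_of_nonneg hτ.le, inv_mul_cancel₀ hτ.ne']
  · rw [smul_sub, smul_smul, smul_smul, mul_inv_cancel₀ hτ.ne', one_smul]; abel
  · have := norm_sub_norm_le (ξ + (τ * σ) • vert n) ((τ * σ) • vert n)
    rw [add_sub_cancel_right, h, norm_smul, norm_vert, Real.norm_eq_abs, abs_mul,
      abs_of_pos hτ] at this
    linarith

section Bounds

variable {n : ℕ} {σ ε Lg pm M L : ℝ} {φ : Hor n → ℝ} {f f₀ : Amb n → ℝ} {v : Amb n → ℝ → ℝ}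

lemma abs_le_of_mem_sphereBoundary (hn : 1 ≤ n) (hε : 0 < ε) (hLg1 : 1 ≤ Lg)
    (hLg : ∀ x y, |radialGauge φ x - radialGauge φ y| ≤ Lg * ‖x - y‖)
    (hpm : ∀ P ∈ liftedBoundary φ ε, ‖P‖ ≤ pm) (hpm1 : 1 ≤ pm)
    (hf : ∀ z ∈ sphereBoundary φ ε, Real.exp (f z) • z ∈ liftedBoundary φ ε) {z : Amb n}
    (hz : z ∈ sphereBoundary φ ε) : |f z| ≤ Real.log Lg + Real.log pm := by
  have h1 := hf z hz
  have h2 : ‖Real.exp (f z) • z‖ = Real.exp (f z) := by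
    rw [norm_smul, ((mem_sphereBoundary hn hε hLg).1 hz).1, mul_one, Real.norm_of_nonneg
      (Real.exp_pos _).le]
  have h3 := hpm _ h1
  have h4 := one_le_mul_norm hLg h1 hLg1
  rw [h2] at h3 h4
  have h5 : f z ≤ Real.log pm := by rw [Real.le_log_iff_exp_le (by linarith)]; exact h3
  have h6 : -f z ≤ Real.log Lg := by
    rw [Real.le_log_iff_exp_le (by linarith), Real.exp_neg]
    rwa [inv_le_iff_one_le_mul₀ (Real.exp_pos _)]
  have h7 := Real.log_nonneg hpm1
  have h8 := Real.log_nonneg hLg1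
  exact abs_le.2 ⟨by linarith, by linarith⟩

/-- The initial data are bounded uniformly: they are Lipschitz, and on `∂Ω_ε` they are determined by
`Γ_ε`. -/
lemma abs_le_of_lipschitz (hn : 1 ≤ n) (hε : 0 < ε) (hLg1 : 1 ≤ Lg)
    (hLg : ∀ x y, |radialGauge φ x - radialGauge φ y| ≤ Lg * ‖x - y‖)
    (hpm : ∀ P ∈ liftedBoundary φ ε, ‖P‖ ≤ pm) (hpm1 : 1 ≤ pm)
    (hf : ∀ z ∈ sphereBoundary φ ε, Real.exp (f z) • z ∈ liftedBoundary φ ε) (hL0 : 0 ≤ L)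
    (hL : ∀ x ∈ closure (sphereDomain φ ε), ∀ y ∈ closure (sphereDomain φ ε),
      |f x - f y| ≤ L * ‖x - y‖) {z : Amb n} (hz : z ∈ closure (sphereDomain φ ε)) :
    |f z| ≤ Real.log Lg + Real.log pm + 2 * L := by
  obtain ⟨ω, hω⟩ := exists_norm_one hn
  have hP : pt (Real.exp (φ ω) • ω) ε ∈ liftedBoundary φ ε := ⟨ω, hω, rfl⟩
  set P := pt (Real.exp (φ ω) • ω) ε
  have hP0 := ne_zero_of_mem_liftedBoundary hε hP
  have hzP : proj P ∈ sphereBoundary φ ε := (mem_sphereBoundary hn hε hLg).2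
    ⟨norm_proj hP0, by rw [coneFun_proj _ _ hP0, coneFun_of_mem_liftedBoundary hP, mul_zero]⟩
  have h1 := abs_le_of_mem_sphereBoundary hn hε hLg1 hLg hpm hpm1 hf hzP
  have h2 := hL z hz _ hzP.1
  have h3 : ‖z - proj P‖ ≤ 2 := by
    refine (norm_sub_le _ _).trans ?_
    rw [norm_proj hP0, ((mem_closure_sphereDomain hn hε hLg).1 hz).1]; norm_num
  have h4 := mul_le_mul_of_nonneg_left h3 hL0
  have h5 := abs_sub_abs_le_abs_sub (f z) (f (proj P))
  linarith

/-- The solution is bounded in terms of its data, by comparison with the stationary spheres whose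
centres lie on the vertical axis. -/
lemma IsRegularSolution.abs_le_add_log (hn : 1 ≤ n) (hε : 0 < ε) (hσ : σ ∈ Ioo (-1 : ℝ) 1)
    (hLg : ∀ x y, |radialGauge φ x - radialGauge φ y| ≤ Lg * ‖x - y‖)
    (hv : IsRegularSolution σ φ ε f₀ v)
    (h0 : ∀ z ∈ closure (sphereDomain φ ε), |v z 0| ≤ M)
    (hb : ∀ z ∈ sphereBoundary φ ε, ∀ t, 0 ≤ t → |v z t| ≤ M) {z : Amb n}
    (hz : z ∈ closure (sphereDomain φ ε)) {t : ℝ} (ht : 0 ≤ t) :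
    |v z t| ≤ M + Real.log (2 / (1 - |σ|)) := by
  have hσ1 : |σ| < 1 := abs_lt.2 hσ
  set c : Amb n := -(σ • vert n) with hc
  set T : Set (Amb n) := Metric.sphere c 1 ∩ {X | 0 ≤ coneFun φ ε X} with hT
  have hTb : ∀ X ∈ Metric.sphere c 1, 1 - |σ| ≤ ‖X‖ ∧ ‖X‖ ≤ 2 := fun X hX => by
    have h1 : ‖X + σ • vert n‖ = 1 := by simpa [hc, dist_eq_norm] using hX
    simpa using norm_sub_smul_vert_bounds hσ h1
  have hne : ∀ X ∈ Metric.sphere c 1, X ≠ 0 := fun X hX => by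
    rw [← norm_pos_iff]; linarith [(hTb X hX).1]
  have hcone := continuous_coneFun (ε := ε) hLg
  have hTc : IsCompact T := (isCompact_sphere c 1).inter_right (isClosed_le continuous_const hcone)
  -- the bounds on `T` for the gauge of a function bounded by `M`
  have hup : ∀ (u : Amb n → ℝ), ∀ X ∈ T, |u (proj X)| ≤ M →
      ∀ m : ℝ, m = 1 ∨ m = -1 → m * radialGauge u X ≤
        if m = 1 then 2 * Real.exp M else -((1 - |σ|) * Real.exp (-M)) := by
    intro u X hX hu m hm
    obtain ⟨h1, h2⟩ := hTb X hX.1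
    obtain ⟨h3, h4⟩ := abs_le.1 hu
    rcases hm with rfl | rfl
    · rw [if_pos rfl, one_mul]
      exact mul_le_mul h2 (Real.exp_le_exp.2 (by linarith)) (Real.exp_pos _).le zero_le_two
    · rw [if_neg (by norm_num), neg_one_mul, neg_le_neg_iff]
      exact mul_le_mul h1 (Real.exp_le_exp.2 (by linarith)) (Real.exp_pos _).le (norm_nonneg _)
  have key : ∀ m : ℝ, m = 1 ∨ m = -1 → ∀ t, 0 ≤ t → ∀ X ∈ T,
      m * radialGauge (fun x => v x t) X ≤
        if m = 1 then 2 * Real.exp M else -((1 - |σ|) * Real.exp (-M)) := by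
    intro m hm
    refine hv.barrier hn hε hLg hTc (fun X hX => ⟨hne X hX.1, hX.2⟩)
      (by rcases hm with rfl | rfl <;> norm_num)
      (fun X hX => hup _ X hX (h0 _ (proj_mem_closure hn hε hLg (hne X hX.1) hX.2)) m hm)
      fun X hX => ?_
    have hX0 := hne X hX.1
    rcases (show 0 ≤ coneFun φ ε X from hX.2).eq_or_lt with h1 | h1
    · exact Or.inl fun t ht => hup _ X hX (hb _ ((mem_sphereBoundary hn hε hLg).2
        ⟨norm_proj hX0, by rw [coneFun_proj _ _ hX0, ← h1, mul_zero]⟩) t ht) m hm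
    · refine Or.inr (Or.inr ⟨h1, c, 1, 1, one_pos, mem_sphere_iff_norm.1 hX.1, ?_,
        Or.inl rfl, ?_, ?_⟩)
      · rw [hc, ← neg_smul, height_smul, height_vert]; ring
      · have h2 : ‖X - c‖ = 1 := mem_sphere_iff_norm.1 hX.1
        have h3 : inner ℝ (X - c) X = 1 - σ * inner ℝ (X - c) (vert n) := by
          have : X = (X - c) - σ • vert n := by rw [hc]; abel
          nth_rewrite 2 [this]
          rw [inner_sub_right, inner_smul_right, real_inner_self_eq_norm_sq, h2]; ring
        have h4 := abs_real_inner_le_norm (X - c) (vert n)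
        rw [h2, norm_vert, one_mul] at h4
        have h5 : |σ * inner ℝ (X - c) (vert n)| ≤ 1 := by
          rw [abs_mul]; exact mul_le_one₀ hσ1.le (abs_nonneg _) h4
        rw [h3]; linarith [(abs_le.1 h5).2]
      · filter_upwards [nhdsWithin_le_nhds (hcone.continuousAt.eventually (lt_mem_nhds h1)),
          self_mem_nhdsWithin] with Y h2 h3
        exact ⟨h3, h2.le⟩
  obtain ⟨hz1, hcz⟩ := (mem_closure_sphereDomain hn hε hLg).1 hz
  obtain ⟨τ, b, hτ, hb1, hzb, -⟩ := exists_eq_smul_sub_vert hσ z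
  have hτ0 : 0 < τ := hτ.lt_of_ne fun h => by
    rw [← h, zero_smul] at hzb; rw [hzb] at hz1; simp at hz1
  -- by homogeneity it is enough to consider the point of `T` on the ray through `z`
  have hX : τ⁻¹ • z = b - σ • vert n := by
    rw [hzb, smul_smul, inv_mul_cancel₀ hτ0.ne', one_smul]
  have hτi : 0 < τ⁻¹ := inv_pos.2 hτ0
  have hXT : τ⁻¹ • z ∈ T := by
    refine ⟨?_, ?_⟩
    · rw [hX, mem_sphere_iff_norm, hc, sub_neg_eq_add, sub_add_cancel, hb1]
    · change 0 ≤ coneFun φ ε _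
      rw [coneFun_smul _ _ hτi]; positivity
  obtain ⟨hn1, hn2⟩ := hTb _ hXT.1
  rw [norm_smul, hz1, mul_one, Real.norm_of_nonneg hτi.le] at hn1 hn2
  have k1 := key 1 (Or.inl rfl) t ht _ hXT
  have k2 := key (-1) (Or.inr rfl) t ht _ hXT
  rw [if_pos rfl, one_mul, radialGauge_smul _ hτi, radialGauge_of_norm_one _ hz1] at k1
  rw [if_neg (by norm_num), radialGauge_smul _ hτi, radialGauge_of_norm_one _ hz1] at k2
  have hq : 0 < 1 - |σ| := by linarith
  have he : Real.exp (M + Real.log (2 / (1 - |σ|))) = 2 * Real.exp M / (1 - |σ|) := by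
    rw [Real.exp_add, Real.exp_log (by positivity)]; ring
  refine abs_le.2 ⟨?_, ?_⟩
  · rw [neg_le, ← Real.exp_le_exp, he, le_div_iff₀ hq]
    nlinarith [Real.exp_pos (-v z t)]
  · rw [← neg_le_neg_iff, ← Real.exp_le_exp, Real.exp_neg (M + _), he, inv_div,
      div_le_iff₀ (by positivity)]
    have h1 : Real.exp (-M) * Real.exp M = 1 := by rw [← Real.exp_add]; simp
    have h2 : (1 - |σ|) * Real.exp (-M) ≤ 2 * Real.exp (-v z t) := by
      nlinarith [Real.exp_pos (-v z t)]
    nlinarith [mul_le_mul_of_nonneg_right h2 (Real.exp_pos M).le]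

end Bounds

/-! ### The uniform Lipschitz estimate -/

lemma abs_sub_le_exp_mul {a b M : ℝ} (ha : |a| ≤ M) (hb : |b| ≤ M) :
    |a - b| ≤ Real.exp M * |Real.exp (-a) - Real.exp (-b)| := by
  wlog h : a ≤ b generalizing a b
  · rw [abs_sub_comm, abs_sub_comm (Real.exp _)]; exact this hb ha (le_of_not_ge h)
  have h1 : Real.exp (-a) = Real.exp (-b) * Real.exp (b - a) := by rw [← Real.exp_add]; ring_nf
  have h2 := Real.add_one_le_exp (b - a)
  have h3 : 1 ≤ Real.exp M * Real.exp (-b) := by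
    rw [← Real.exp_add]; exact Real.one_le_exp (by linarith [(abs_le.1 hb).2])
  have h4 : Real.exp (-b) ≤ Real.exp (-a) := Real.exp_le_exp.2 (by linarith)
  rw [abs_of_nonpos (by linarith), abs_of_nonneg (by linarith), h1]
  nlinarith [Real.exp_pos M, Real.exp_pos (-b)]

section Lipschitz

variable {n : ℕ} {σ ε Lg pm M₀ M₁ L K δ₂ τ₁ C : ℝ} {φ : Hor n → ℝ} {f₀ : Amb n → ℝ}
  {v : Amb n → ℝ → ℝ}

/-- The lateral values in the two-point comparison: if one of two nearby points lies over
`∂Ω_ε`, the Lipschitz estimate at the boundary applies after rescaling this point to `Γ_ε`. -/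
lemma IsRegularSolution.abs_gauge_sub_le_of_boundary (hn : 1 ≤ n) (hε : 0 < ε)
    (hLg : ∀ x y, |radialGauge φ x - radialGauge φ y| ≤ Lg * ‖x - y‖)
    (hv : IsRegularSolution σ φ ε f₀ v) (hpm : ∀ P ∈ liftedBoundary φ ε, ‖P‖ ≤ pm)
    (hB : ∀ t, 0 ≤ t → ∀ P ∈ liftedBoundary φ ε, ∀ Y, ‖Y - P‖ ≤ δ₂ → 0 ≤ coneFun φ ε Y →
      |radialGauge (fun x => v x t) Y - 1| ≤ 2 * K * ‖Y - P‖)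
    {X Y : Amb n} (hX : X ≠ 0) (hcX : coneFun φ ε X = 0) (hcY : 0 ≤ coneFun φ ε Y)
    (hXY : pm * ‖Y - X‖ ≤ δ₂ * ‖X‖) {t : ℝ} (ht : 0 ≤ t) :
    |radialGauge (fun x => v x t) Y - radialGauge (fun x => v x t) X| ≤ 2 * K * ‖Y - X‖ := by
  have hXn := norm_pos_iff.2 hX
  have hz : proj X ∈ sphereBoundary φ ε := (mem_sphereBoundary hn hε hLg).2
    ⟨norm_proj hX, by rw [coneFun_proj _ _ hX, hcX, mul_zero]⟩
  have hP := hv.boundary _ hz t ht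
  set a := Real.exp (v (proj X) t) * ‖X‖⁻¹ with ha
  have ha0 : 0 < a := by positivity
  have hPa : Real.exp (v (proj X) t) • proj X = a • X := by rw [ha, mul_smul]; rfl
  rw [hPa] at hP
  have hGX : radialGauge (fun x => v x t) X = a⁻¹ := by
    rw [radialGauge, ha, mul_inv, inv_inv, Real.exp_neg, mul_comm]
  have hapm : a * ‖X‖ ≤ pm := by
    have := hpm _ hP
    rwa [norm_smul, Real.norm_of_nonneg ha0.le] at this
  have hd : ‖a • Y - a • X‖ = a * ‖Y - X‖ := by
    rw [← smul_sub, norm_smul, Real.norm_of_nonneg ha0.le]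
  have h1 := hB t ht _ hP (a • Y) (by
    rw [hd]
    refine le_of_mul_le_mul_right ?_ hXn
    calc a * ‖Y - X‖ * ‖X‖ = a * ‖X‖ * ‖Y - X‖ := by ring
      _ ≤ pm * ‖Y - X‖ := by gcongr
      _ ≤ _ := hXY) (by rw [coneFun_smul _ _ ha0]; positivity)
  rw [hd, radialGauge_smul _ ha0] at h1
  rw [hGX]
  refine le_of_mul_le_mul_left ?_ ha0
  calc a * |radialGauge (fun x => v x t) Y - a⁻¹|
      = |a * radialGauge (fun x => v x t) Y - 1| := by
        rw [← abs_of_pos ha0, ← abs_mul, abs_of_pos ha0, mul_sub, mul_inv_cancel₀ ha0.ne']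
    _ ≤ _ := h1
    _ = _ := by ring

/-- A Lipschitz estimate at the boundary propagates to the interior, by the two-point comparison. -/
lemma IsRegularSolution.abs_sub_le (hn : 1 ≤ n) (hε : 0 < ε) (hσ : σ ∈ Ioo (-1 : ℝ) 1)
    (hLg : ∀ x y, |radialGauge φ x - radialGauge φ y| ≤ Lg * ‖x - y‖)
    (hv : IsRegularSolution σ φ ε f₀ v) (hpm : ∀ P ∈ liftedBoundary φ ε, ‖P‖ ≤ pm)
    (hpm0 : 0 ≤ pm)
    (hB : ∀ t, 0 ≤ t → ∀ P ∈ liftedBoundary φ ε, ∀ Y, ‖Y - P‖ ≤ δ₂ → 0 ≤ coneFun φ ε Y →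
      |radialGauge (fun x => v x t) Y - 1| ≤ 2 * K * ‖Y - P‖)
    (hL0 : 0 ≤ L) (hL : ∀ x ∈ closure (sphereDomain φ ε), ∀ y ∈ closure (sphereDomain φ ε),
      |f₀ x - f₀ y| ≤ L * ‖x - y‖)
    (hM₀ : ∀ z ∈ closure (sphereDomain φ ε), |f₀ z| ≤ M₀)
    (hM₁ : ∀ z ∈ closure (sphereDomain φ ε), ∀ t, 0 ≤ t → |v z t| ≤ M₁)
    (hK : 0 ≤ K) (hτ₁ : 0 < τ₁) (hτ4 : τ₁ ≤ 1 / 4) (hτδ : 4 * pm * τ₁ ≤ δ₂) (hC : 0 < C)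
    (hC₀ : Real.exp M₀ * (1 + 2 * L) * 2 ≤ C) (hC₁ : 4 * K ≤ C)
    (hC₂ : 2 * Real.exp M₁ ≤ C * τ₁) {t : ℝ} (ht : 0 ≤ t) {x z : Amb n}
    (hx : x ∈ closure (sphereDomain φ ε)) (hz : z ∈ closure (sphereDomain φ ε))
    (hxz : ‖x - z‖ ≤ (1 - |σ|) * τ₁) :
    |v x t - v z t| ≤ Real.exp M₁ * (C / (1 - |σ|)) * ‖x - z‖ := by
  have hσ1 : |σ| < 1 := abs_lt.2 hσ
  have hq : 0 < 1 - |σ| := by linarith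
  have hf₀ : ContinuousOn f₀ (closure (sphereDomain φ ε)) := by
    have : LipschitzOnWith L.toNNReal f₀ (closure (sphereDomain φ ε)) :=
      LipschitzOnWith.of_dist_le_mul fun x hx y hy => by
        rw [Real.dist_eq, dist_eq_norm, Real.coe_toNNReal _ hL0]; exact hL x hx y hy
    exact this.continuousOn
  have hδ₂ : 0 ≤ δ₂ := le_trans (by positivity) hτδ
  have hdist : ∀ p ∈ twoPointSet σ φ ε τ₁,
      ‖p.1 + p.2.2 • (p.2.1 - σ • vert n) - p.1‖ ≤ 2 * p.2.2 := by
    intro p hp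
    rw [add_sub_cancel_left, norm_smul, Real.norm_of_nonneg hp.2.2.1.1]
    nlinarith [(norm_sub_smul_vert_bounds hσ hp.2.1).2, hp.2.2.1.1]
  have hne : ∀ p ∈ twoPointSet σ φ ε τ₁, p.1 ≠ 0 ∧ p.1 + p.2.2 • (p.2.1 - σ • vert n) ≠ 0 :=
    fun p hp => ⟨fun h => by have := hp.1; rw [h] at this; simp at this,
      twoPoint_ne_zero hσ hp.1 hp.2.1 hp.2.2.1 (by linarith)⟩
  have key := hv.twoPoint hn hε hσ hLg (τ₁ := τ₁) (by linarith) hC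
    (fun p hp => by
      obtain ⟨h1, h2⟩ := hne p hp
      rw [hv.gauge_initial hn hε hLg hf₀ h1 hp.2.2.2.1,
        hv.gauge_initial hn hε hLg hf₀ h2 hp.2.2.2.2]
      have h3 := radialGauge_lipschitz hL hM₀ hL0 h2 (proj_mem_closure hn hε hLg h2 hp.2.2.2.2)
        (proj_mem_closure hn hε hLg h1 hp.2.2.2.1)
      refine (le_abs_self _).trans (h3.trans ?_)
      calc _ ≤ Real.exp M₀ * (1 + 2 * L) * (2 * p.2.2) :=
            mul_le_mul_of_nonneg_left (hdist p hp) (by positivity)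
        _ = Real.exp M₀ * (1 + 2 * L) * 2 * p.2.2 := by ring
        _ ≤ _ := mul_le_mul_of_nonneg_right hC₀ hp.2.2.1.1)
    (fun s hs p hp hcase => by
      obtain ⟨h1, h2⟩ := hne p hp
      have hd := hdist p hp
      have hτ := hp.2.2.1
      set Y := p.1 + p.2.2 • (p.2.1 - σ • vert n) with hY
      have hYn : ‖Y‖ ≤ 3 / 2 ∧ 1 / 2 ≤ ‖Y‖ := by
        have e1 := norm_sub_norm_le Y p.1
        have e2 := norm_sub_norm_le p.1 Y
        rw [norm_sub_rev] at e2
        rw [hp.1] at e1 e2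
        constructor <;> linarith [hτ.1, hτ.2]
      have hKd : 2 * K * ‖Y - p.1‖ ≤ C * p.2.2 := by
        have e1 := mul_le_mul_of_nonneg_left hd (show 0 ≤ 2 * K by positivity)
        have e2 := mul_le_mul_of_nonneg_right hC₁ hτ.1
        linarith
      have hpd : pm * ‖Y - p.1‖ ≤ pm * (2 * τ₁) :=
        mul_le_mul_of_nonneg_left (by linarith [hτ.2]) hpm0
      rcases hcase with h | h | h
      · have := hv.abs_gauge_sub_le_of_boundary hn hε hLg hpm hB h1 h hp.2.2.2.2 (Y := Y)
          (by rw [hp.1]; nlinarith) hs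
        exact (le_abs_self _).trans (this.trans hKd)
      · have := hv.abs_gauge_sub_le_of_boundary hn hε hLg hpm hB h2 h hp.2.2.2.1 (Y := p.1)
          (by rw [norm_sub_rev]; nlinarith) hs
        rw [norm_sub_rev, abs_sub_comm] at this
        exact (le_abs_self _).trans (this.trans hKd)
      · have e1 := (abs_le.1 (hM₁ _ (proj_mem_closure hn hε hLg h2 hp.2.2.2.2) s hs)).1
        have e2 : radialGauge (fun x => v x s) Y ≤ 2 * Real.exp M₁ :=
          mul_le_mul (by linarith [hYn.1]) (Real.exp_le_exp.2 (by linarith)) (Real.exp_pos _).le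
            zero_le_two
        have e3 := radialGauge_nonneg (fun x => v x s) p.1
        rw [h]
        linarith)
  -- any difference of nearby unit vectors is of the form `τ (b - σ e)` with `τ ≤ τ₁`
  have main : ∀ x ∈ closure (sphereDomain φ ε), ∀ z ∈ closure (sphereDomain φ ε),
      ‖x - z‖ ≤ (1 - |σ|) * τ₁ →
      Real.exp (-v x t) - Real.exp (-v z t) ≤ C / (1 - |σ|) * ‖x - z‖ := by
    intro x hx z hz hxz
    rw [mem_closure_sphereDomain hn hε hLg] at hx hz
    obtain ⟨τ, b, hτ, hb, hxb, hτle⟩ := exists_eq_smul_sub_vert hσ (x - z)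
    have hxe : z + τ • (b - σ • vert n) = x := by rw [← hxb]; abel
    have h1 := key t ht (z, b, τ) ⟨hz.1, hb, ⟨hτ, by
      show τ ≤ τ₁
      exact le_of_mul_le_mul_right (hτle.trans (hxz.trans (mul_comm _ _).le)) hq⟩, hz.2, by
      show 0 ≤ coneFun φ ε (z + τ • (b - σ • vert n))
      rw [hxe]; exact hx.2⟩
    simp only at h1
    rw [hxe, radialGauge_of_norm_one _ hx.1, radialGauge_of_norm_one _ hz.1] at h1
    refine h1.trans ?_
    rw [div_mul_eq_mul_div, le_div_iff₀ hq, mul_assoc]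
    exact mul_le_mul_of_nonneg_left hτle hC.le
  have h1 := main x hx z hz hxz
  have h2 := main z hz x hx (by rwa [norm_sub_rev])
  rw [norm_sub_rev] at h2
  refine (abs_sub_le_exp_mul (hM₁ x hx t ht) (hM₁ z hz t ht)).trans ?_
  rw [mul_assoc]
  exact mul_le_mul_of_nonneg_left (abs_le.2 ⟨by linarith, h1⟩) (Real.exp_pos _).le

end Lipschitz

section Constants

variable {n : ℕ} {σ ε r δ Λ : ℝ} {φ : Hor n → ℝ} {S : Set (Amb n)} {P : Amb n}

lemma InteriorBallAt.exists_isTangentBall (hn : 1 ≤ n) (h : InteriorBallAt σ φ ε r δ Λ S P)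
    (hP : P ∈ liftedBoundary φ ε) : ∃ R : ℝ, r ≤ R ∧ ∃ a : Hor n, IsTangentBall σ φ ε 1 R a P ∧
      S ∩ Metric.ball P δ ∩ Metric.closedBall (pt a (-1 * σ * R)) R ⊆ {P} := by
  obtain ⟨R, hR, a, h1, h2, h3, -⟩ := h
  rw [← neg_one_mul σ] at h1 h2 h3
  refine ⟨R, hR, a, ⟨hP, mem_sphere_iff_norm.1 h1, fun X hX hXε => ?_⟩, h3.le⟩
  have : radialGauge φ (hor X) ≤ 1 := by
    rcases h2 ⟨mem_closedBall_iff_norm.2 hX, hXε⟩ with h | h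
    · exact ((mem_liftedDomain hn).1 h).2.le
    · exact (mem_liftedBoundary.1 h).2.le
  linarith

lemma ExteriorBallAt.exists_isTangentBall (hn : 1 ≤ n) (h : ExteriorBallAt σ φ ε r δ Λ S P)
    (hP : P ∈ liftedBoundary φ ε) : ∃ R : ℝ, r ≤ R ∧ ∃ a : Hor n, IsTangentBall σ φ ε (-1) R a P ∧
      S ∩ Metric.ball P δ ∩ Metric.closedBall (pt a (-(-1) * σ * R)) R ⊆ {P} := by
  obtain ⟨R, hR, a, h1, h2, h3, -⟩ := h
  have e : σ * R = -(-1) * σ * R := by ring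
  rw [e] at h1 h2 h3
  refine ⟨R, hR, a, ⟨hP, mem_sphere_iff_norm.1 h1, fun X hX hXε => ?_⟩, h3.le⟩
  have : 1 ≤ radialGauge φ (hor X) := by
    by_contra hlt
    exact Set.disjoint_left.1 h2 (mem_closedBall_iff_norm.2 hX)
      ((mem_liftedDomain hn).2 ⟨hXε, not_le.1 hlt⟩)
  linarith

/-- A radius `ρ` of the small balls that works for all small heights. -/
lemma exists_smallRadius {Lg pm : ℝ} (hσ : σ ∈ Ioo (-1 : ℝ) 1) (hr : 0 < r) (hδ : 0 < δ)
    (hLg1 : 1 ≤ Lg) (hpm : 0 ≤ pm) : ∃ ρ ε₂ : ℝ, 0 < ρ ∧ 0 < ε₂ ∧ ε₂ ≤ 1 ∧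
      ∀ ε ∈ Ioo 0 ε₂, SmallRadius σ ε Lg r δ ρ pm := by
  have hσ1 := abs_lt.2 hσ
  have hs := sectionRatio_pos hσ
  set s := sectionRatio σ
  set A := 4 + 4 * Lg * pm with hA
  have hA0 : 0 < A := by positivity
  have hq : 0 < (1 - |σ|) / 2 := by linarith
  set ρ := min (min r (1 / (4 * Lg))) (min (δ / (2 * A)) (2 * (s * r) / A)) with hρ
  have hρ0 : 0 < ρ := lt_min (lt_min hr (by positivity)) (lt_min (by positivity) (by positivity))
  have h1 : ρ ≤ r := (min_le_left _ _).trans (min_le_left _ _)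
  have h2 : ρ ≤ 1 / (4 * Lg) := (min_le_left _ _).trans (min_le_right _ _)
  have h3 : ρ ≤ δ / (2 * A) := (min_le_right _ _).trans (min_le_left _ _)
  have h4 : ρ ≤ 2 * (s * r) / A := (min_le_right _ _).trans (min_le_right _ _)
  rw [le_div_iff₀ (by positivity)] at h2 h3 h4
  have hAρ : 4 * ρ + 4 * Lg * ρ * pm = ρ * A := by rw [hA]; ring
  refine ⟨ρ, min 1 (min (ρ * ((1 - |σ|) / 2)) (s / (4 * Lg))), hρ0,
    lt_min one_pos (lt_min (by positivity) (by positivity)), min_le_left _ _, fun ε hε => ?_⟩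
  have h5 := hε.2.le.trans (min_le_right _ _)
  exact ⟨hε.1, hρ0, hδ, h1, h5.trans (min_le_left _ _), hLg1, h5.trans (min_le_right _ _), h2, hpm,
    by rw [hAρ]; nlinarith [mul_pos hρ0 hA0], by rw [hAρ]; exact h4⟩

end Constants

/-- The Lipschitz estimate for the flow, uniform in `ε`, together with interior balls whose
sections at height `ε` do not degenerate to a point. -/
theorem exists_uniform_lipschitz {n : ℕ} (hn : 1 ≤ n) {σ : ℝ} (hσ : σ ∈ Ioo (-1 : ℝ) 1)
    {φ : Hor n → ℝ} (hφ : IsC11On φ (Metric.sphere 0 1)) {ε₀ : ℝ} (hε₀ : 0 < ε₀)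
    {v₀ : ℝ → Amb n → ℝ}
    (hbdry : ∀ ε ∈ Ioo 0 ε₀, ∀ z ∈ sphereBoundary φ ε,
      Real.exp (v₀ ε z) • z ∈ liftedBoundary φ ε)
    (hlip : ∃ L : NNReal, ∀ ε ∈ Ioo 0 ε₀, LipschitzOnWith L (v₀ ε) (closure (sphereDomain φ ε)))
    (hball : UniformLocalBall σ φ ε₀ v₀) :
    ∃ C d : ℝ, 0 ≤ C ∧ 0 < d ∧ ∃ ε₁ ∈ Ioc 0 ε₀, ∀ ε ∈ Ioo 0 ε₁,
      (∀ P ∈ liftedBoundary φ ε, ∃ (R : ℝ) (a : Hor n), IsTangentBall σ φ ε 1 R a P ∧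
        0 < ‖hor P - a‖) ∧
      ∀ v : Amb n → ℝ → ℝ, IsRegularSolution σ φ ε (v₀ ε) v → ∀ t, 0 ≤ t →
        ∀ x ∈ closure (sphereDomain φ ε), ∀ z ∈ closure (sphereDomain φ ε), ‖x - z‖ ≤ d →
          |v x t - v z t| ≤ C * ‖x - z‖ := by
  obtain ⟨Lφ, M, hLφ, hM, -⟩ := hφ.exists_lipschitz
  obtain ⟨Lg, hLg1, hLg⟩ := hφ.exists_gauge_lipschitz
  obtain ⟨L, hL⟩ := hlip
  obtain ⟨r, δ, Λ, hr, hδ, hballs⟩ := hball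
  have hσ1 := abs_lt.2 hσ
  have hq : 0 < 1 - |σ| := by linarith
  have hs := sectionRatio_pos hσ
  set pm := Real.exp M + 1 with hpmdef
  have hpm1 : 1 ≤ pm := by rw [hpmdef]; linarith [Real.exp_pos M]
  obtain ⟨ρ, ε₂, hρ, hε₂, hε₂1, hsmall⟩ := exists_smallRadius hσ hr hδ hLg1 (pm := pm) (by linarith)
  -- `K` is governed by the angle between the rays and the balls, `δ₂` is the range of the boundary
  -- estimate, and `τ₁` keeps the two-point comparison within this range after scaling to `Γ_ε`
  set K := 12 * Lg / sectionRatio σ with hK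
  have hK0 : 0 < K := by positivity
  set δ₂ := min (1 / (2 * K)) (3 * ρ / (2 + K * pm) ^ 2) with hδ₂
  have hδ₂0 : 0 < δ₂ := lt_min (by positivity) (by positivity)
  have hδK : K * δ₂ ≤ 1 / 2 := by
    have : δ₂ ≤ 1 / (2 * K) := min_le_left _ _
    rw [le_div_iff₀ (by positivity)] at this
    linarith
  have hδρ : δ₂ * (2 + K * pm) ^ 2 ≤ 3 * ρ := by
    have : δ₂ ≤ 3 * ρ / (2 + K * pm) ^ 2 := min_le_right _ _
    rwa [le_div_iff₀ (by positivity)] at this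
  set τ₁ := min (1 / 4) (δ₂ / (4 * pm)) with hτ₁
  have hτ0 : 0 < τ₁ := lt_min (by norm_num) (by positivity)
  have hτδ : 4 * pm * τ₁ ≤ δ₂ := by
    have : τ₁ ≤ δ₂ / (4 * pm) := min_le_right _ _
    rw [le_div_iff₀ (by positivity)] at this
    linarith
  set M₀ := Real.log Lg + Real.log pm + 2 * L with hM₀
  set M₁ := M₀ + Real.log (2 / (1 - |σ|)) with hM₁
  -- the three terms stem from the initial time, the lateral boundary and `τ = τ₁`
  set C := Real.exp M₀ * (1 + 2 * L) * 2 + 4 * K + 2 * Real.exp M₁ / τ₁ with hC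
  have hC1 : 0 < Real.exp M₀ * (1 + 2 * L) * 2 := by positivity
  have hC2 : 0 < 2 * Real.exp M₁ / τ₁ := by positivity
  have hC0 : 0 < C := by positivity
  have hCl : Real.exp M₀ * (1 + 2 * L) * 2 ≤ C :=
    (le_add_of_nonneg_right (by positivity)).trans (le_add_of_nonneg_right hC2.le)
  have hCr : 4 * K ≤ C := (le_add_of_nonneg_left hC1.le).trans (le_add_of_nonneg_right hC2.le)
  refine ⟨Real.exp M₁ * (C / (1 - |σ|)), (1 - |σ|) * τ₁, by positivity, by positivity,
    min ε₀ ε₂, ⟨lt_min hε₀ hε₂, min_le_left _ _⟩, fun ε hε => ?_⟩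
  have hεm : ε ∈ Ioo 0 ε₀ := ⟨hε.1, hε.2.trans_le (min_le_left _ _)⟩
  have hS := hsmall ε ⟨hε.1, hε.2.trans_le (min_le_right _ _)⟩
  have hI : HasTangentBalls σ φ ε r δ 1 (radialGraph (v₀ ε) (closure (sphereDomain φ ε))) :=
    fun P hP => (hballs ε hεm P hP).1.exists_isTangentBall hn hP
  have hE : HasTangentBalls σ φ ε r δ (-1) (radialGraph (v₀ ε) (closure (sphereDomain φ ε))) :=
    fun P hP => (hballs ε hεm P hP).2.exists_isTangentBall hn hP
  have hpm : ∀ P ∈ liftedBoundary φ ε, ‖P‖ ≤ pm := by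
    rintro P ⟨ω, hω, rfl⟩
    have h1 : pt (Real.exp (φ ω) • ω) ε = pt (Real.exp (φ ω) • ω) 0 + ε • vert n :=
      amb_ext (by simp) (by simp)
    have h2 : ‖pt (Real.exp (φ ω) • ω) 0‖ = Real.exp (φ ω) := by
      rw [← sq_eq_sq₀ (norm_nonneg _) (Real.exp_pos _).le, norm_sq_eq_hor]
      simp [norm_smul, hω]
    have h3 := (abs_le.1 (hM ω (by simpa using hω))).2
    have h4 : ε ≤ 1 := (hε.2.trans_le (min_le_right _ _)).le.trans hε₂1
    rw [h1]
    refine (norm_add_le _ _).trans ?_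
    rw [h2, norm_smul, norm_vert, mul_one, Real.norm_of_nonneg hε.1.le]
    exact add_le_add (Real.exp_le_exp.2 h3) h4
  have hL' : ∀ x ∈ closure (sphereDomain φ ε), ∀ y ∈ closure (sphereDomain φ ε),
      |v₀ ε x - v₀ ε y| ≤ L * ‖x - y‖ := fun x hx y hy => by
    have := (hL ε hεm).dist_le_mul x hx y hy
    rwa [Real.dist_eq, dist_eq_norm] at this
  have hcont := (hL ε hεm).continuousOn
  refine ⟨fun P hP => ?_, fun v hv t ht x hx z hz hxz => ?_⟩
  · obtain ⟨R, hR, a, hT, -⟩ := hI P hP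
    have hR0 : 0 < R := hr.trans_le hR
    refine ⟨R, a, hT, lt_of_lt_of_le (mul_pos hs hR0)
      (hT.sectionRatio_le hσ (Or.inl rfl) hε.1 hR0 (hS.ε_le_ρ.trans ?_))⟩
    exact mul_le_mul_of_nonneg_right (hS.ρ_le.trans hR) (by linarith)
  have hM₀' : ∀ z ∈ closure (sphereDomain φ ε), |v₀ ε z| ≤ M₀ := fun z hz =>
    abs_le_of_lipschitz hn hε.1 hLg1 hLg hpm hpm1 (hbdry ε hεm) L.2 hL' hz
  have hM₁' : ∀ z ∈ closure (sphereDomain φ ε), ∀ t, 0 ≤ t → |v z t| ≤ M₁ := fun z hz t ht =>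
    hv.abs_le_add_log hn hε.1 hσ hLg
      (fun z hz => by
        have := hv.eqOn_initial hcont hz
        simp only at this
        rw [this]; exact hM₀' z hz)
      (fun z hz t ht => by
        have := abs_le_of_mem_sphereBoundary hn hε.1 hLg1 hLg hpm hpm1
          (fun z hz => hv.boundary z hz t ht) hz
        have hL0 : (0 : ℝ) ≤ L := L.2
        linarith) hz ht
  refine hv.abs_sub_le hn hε.1 hσ hLg hpm (by linarith)
    (fun t ht P hP Y hY hcY => hv.abs_gauge_sub_one_le hn hσ hLg hcont (hbdry ε hεm) hS hI hE hP
      (hpm P hP) hK hδK hδρ hY hcY ht) L.2 hL' hM₀' hM₁' hK0.le hτ0 (min_le_left _ _) hτδ hC0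
    hCl hCr ?_ ht hx hz hxz
  rw [hC, add_mul, div_mul_cancel₀ _ hτ0.ne']
  have : 0 ≤ (Real.exp M₀ * (1 + 2 * L) * 2 + 4 * K) * τ₁ := by positivity
  linarith

/-! ### From Lipschitz estimates to gradients -/

section Gradients

variable {n : ℕ} {σ ε Lg C R : ℝ} {φ : Hor n → ℝ} {f f₀ : Amb n → ℝ} {v : Amb n → ℝ → ℝ}
  {z g : Amb n}

lemma norm_sphereGrad_le (hz : ‖z‖ = 1) (hC : 0 ≤ C) (hd : DifferentiableAt ℝ (radialExt f) z)
    (h : ∀ᶠ x in 𝓝 z, ‖x‖ = 1 → |f x - f z| ≤ C * ‖x - z‖) : ‖sphereGrad f z‖ ≤ 2 * C := by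
  have hz0 : z ≠ 0 := by rintro rfl; simp at hz
  have hpz := proj_of_norm_one hz
  have e : ‖sphereGrad f z‖ = ‖fderiv ℝ (radialExt f) z‖ := by
    rw [sphereGrad, gradient, LinearIsometryEquiv.norm_map]
  rw [e]
  refine hd.hasFDerivAt.le_of_lip' (by positivity) ?_
  have hp : Tendsto (proj : Amb n → Amb n) (𝓝 z) (𝓝 z) := by
    have := continuousAt_proj hz0
    rwa [ContinuousAt, hpz] at this
  filter_upwards [hp.eventually h, isOpen_ne.mem_nhds hz0] with x hx hx0
  have h1 := hx (norm_proj hx0)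
  have h2 := norm_mul_norm_proj_sub_le (y := z) hx0
  rw [hz, one_mul, hpz] at h2
  rw [Real.norm_eq_abs, radialExt, radialExt, hpz]
  calc _ ≤ C * ‖proj x - z‖ := h1
    _ ≤ C * (2 * ‖x - z‖) := by gcongr
    _ = _ := by ring

lemma IsRegularSolution.differentiableAt (hn : 1 ≤ n) (hε : 0 < ε)
    (hLg : ∀ x y, |radialGauge φ x - radialGauge φ y| ≤ Lg * ‖x - y‖)
    (hv : IsRegularSolution σ φ ε f₀ v) (hf₀ : IsC11On f₀ (sphereDomain φ ε))
    (hz : z ∈ sphereDomain φ ε) {t : ℝ} (ht : 0 ≤ t) :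
    DifferentiableAt ℝ (radialExt fun x => v x t) z := by
  rcases ht.eq_or_lt with rfl | ht
  -- the smoothness of `v` does not cover `t = 0`, where the initial datum is used
  · refine (hf₀.1 z hz).congr_of_eventuallyEq ?_
    obtain ⟨hz1, hcz⟩ := (mem_sphereDomain hn hε).1 hz
    have hz0 : z ≠ 0 := by rintro rfl; simp at hz1
    filter_upwards [isOpen_ne.mem_nhds hz0,
      (continuous_coneFun (ε := ε) hLg).continuousAt.eventually (lt_mem_nhds hcz)] with x hx hc
    have hxn := norm_pos_iff.2 hx
    exact hv.initial _ ((mem_sphereDomain hn hε).2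
      ⟨norm_proj hx, by rw [coneFun_proj _ _ hx]; positivity⟩)
  · exact (hv.contDiffAt hz ht).differentiableAt (by norm_num)

/-- A gradient from within `closure Ω_ε` is controlled in the directions of the segments that
enter `D_ε` from the point of `Γ_ε`, up to their radial component. -/
lemma HasSphereGradWithin.abs_inner_le (hn : 1 ≤ n) (hε : 0 < ε)
    (hLg : ∀ x y, |radialGauge φ x - radialGauge φ y| ≤ Lg * ‖x - y‖) (hz : ‖z‖ = 1) {l : ℝ}
    (hl : 0 < l) {a : Hor n} (hT : IsTangentBall σ φ ε 1 R a (l • z)) (hC0 : 0 ≤ C)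
    (hg : HasSphereGradWithin f g (closure (sphereDomain φ ε)) z)
    (hC : ∀ᶠ x in 𝓝[closure (sphereDomain φ ε)] z, |f x - f z| ≤ C * ‖x - z‖) {d : Amb n}
    (hd : height d = 0) (hdin : inner ℝ d (l • z - pt a (-1 * σ * R)) < 0) :
    |inner ℝ g d| ≤ 2 * (C + 1) * ‖d - (inner ℝ d z : ℝ) • z‖ := by
  set q : ℝ := inner ℝ d z with hq
  have hz0 : z ≠ 0 := by rintro rfl; simp at hz
  have hP0 : l • z ≠ 0 := smul_ne_zero hl.ne' hz0
  have hproj : proj (l • z) = z := by rw [proj_smul hl, proj_of_norm_one hz]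
  have hPε := (mem_liftedBoundary.1 hT.mem).1
  have hX : Continuous fun s : ℝ => l • z + s • d := by fun_prop
  have hX0 : Tendsto (fun s : ℝ => l • z + s • d) (𝓝[>] 0) (𝓝 (l • z)) := by
    have := hX.tendsto 0
    simp only [zero_smul, add_zero] at this
    exact this.mono_left nhdsWithin_le_nhds
  have hne : ∀ᶠ s : ℝ in 𝓝[>] 0, l • z + s • d ≠ 0 := hX0.eventually (isOpen_ne.mem_nhds hP0)
  have hmem : ∀ᶠ s : ℝ in 𝓝[>] 0, proj (l • z + s • d) ∈ closure (sphereDomain φ ε) := by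
    filter_upwards [hne, exists_eventually_of_inner_neg hdin] with s h1 h2
    refine proj_mem_closure hn hε hLg h1 ?_
    have hh : height (l • z + s • d) = ε := by rw [height_add, hPε, height_smul, hd]; ring
    have h3 := hT.section_le (l • z + s • d) (by
      rw [hT.norm_eq, sub_add_eq_add_sub] at h2; exact h2.le) hh
    rw [coneFun, hh]
    nlinarith
  have hF : Tendsto (fun s : ℝ => proj (l • z + s • d)) (𝓝[>] 0)
      (𝓝[closure (sphereDomain φ ε)] z) := by
    refine tendsto_nhdsWithin_iff.2 ⟨?_, hmem⟩
    have h1 : Tendsto proj (𝓝 (l • z)) (𝓝 z) := by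
      have := continuousAt_proj hP0
      rwa [ContinuousAt, hproj] at this
    exact h1.comp hX0
  have hlq : Tendsto (fun s : ℝ => l + s * q) (𝓝[>] 0) (𝓝 l) := by
    have := (show Continuous fun s : ℝ => l + s * q by fun_prop).tendsto 0
    simp only [zero_mul, add_zero] at this
    exact this.mono_left nhdsWithin_le_nhds
  have hN : Tendsto (fun s : ℝ => ‖l • z + s • d‖) (𝓝[>] 0) (𝓝 l) := by
    have := hX0.norm
    rwa [norm_smul, hz, mul_one, Real.norm_of_nonneg hl.le] at this
  have hfin : ∀ᶠ s : ℝ in 𝓝[>] 0, (l + s * q) * |inner ℝ g d| ≤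
      ‖l • z + s • d‖ * (2 * (C + 1) * ‖d - q • z‖) := by
    filter_upwards [hF.eventually hC, hF.eventually (hg.2.def one_pos), hne,
      hlq.eventually (lt_mem_nhds hl), self_mem_nhdsWithin] with s h1 h2 h3 h4 (hs : 0 < s)
    set X := l • z + s • d with hXdef
    have hXn := norm_pos_iff.2 h3
    rw [Real.norm_eq_abs, one_mul] at h2
    have h5 : |inner ℝ g (proj X - z)| ≤ (C + 1) * ‖proj X - z‖ := by
      have := abs_sub_abs_le_abs_sub (inner ℝ g (proj X - z)) (f (proj X) - f z)
      rw [abs_sub_comm (inner ℝ g (proj X - z))] at this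
      linarith
    have h6 : inner ℝ g (proj X - z) = ‖X‖⁻¹ * (s * inner ℝ g d) := by
      rw [inner_sub_right, hg.1, sub_zero, proj, inner_smul_right, hXdef, inner_add_right,
        inner_smul_right, hg.1, inner_smul_right]; ring
    -- the radial component of `d` only rescales `X` and does not move its projection
    have h7 : (l + s * q) * ‖proj X - z‖ ≤ 2 * (s * ‖d - q • z‖) := by
      have := norm_mul_norm_proj_sub_le (y := (l + s * q) • z) h3
      rw [proj_smul h4, proj_of_norm_one hz, norm_smul, hz, mul_one,
        Real.norm_of_nonneg h4.le] at this
      have e : X - (l + s * q) • z = s • (d - q • z) := by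
        rw [hXdef, add_smul, smul_sub, smul_smul]; abel
      rwa [e, norm_smul, Real.norm_of_nonneg hs.le] at this
    rw [h6, abs_mul, abs_mul, abs_of_pos (inv_pos.2 hXn), abs_of_pos hs] at h5
    have h8 : s * |inner ℝ g d| ≤ ‖X‖ * ((C + 1) * ‖proj X - z‖) := by
      rwa [inv_mul_le_iff₀ hXn] at h5
    refine le_of_mul_le_mul_left ?_ hs
    calc s * ((l + s * q) * |inner ℝ g d|) = (l + s * q) * (s * |inner ℝ g d|) := by ring
      _ ≤ (l + s * q) * (‖X‖ * ((C + 1) * ‖proj X - z‖)) := by gcongr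
      _ = ‖X‖ * ((C + 1) * ((l + s * q) * ‖proj X - z‖)) := by ring
      _ ≤ ‖X‖ * ((C + 1) * (2 * (s * ‖d - q • z‖))) := by gcongr
      _ = _ := by ring
  have := le_of_tendsto_of_tendsto (hlq.mul_const _) (hN.mul_const _) hfin
  exact le_of_mul_le_mul_left this hl

/-- A gradient from within `closure Ω_ε` is bounded by the local Lipschitz constant: it is tested
on horizontal directions `d`, which, or whose opposites, enter the section of an interior ball. -/
lemma HasSphereGradWithin.norm_le (hn : 1 ≤ n) (hε : 0 < ε)
    (hLg : ∀ x y, |radialGauge φ x - radialGauge φ y| ≤ Lg * ‖x - y‖) (hz : ‖z‖ = 1) {l : ℝ}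
    (hl : 0 < l) {a : Hor n} (hT : IsTangentBall σ φ ε 1 R a (l • z))
    (ha : 0 < ‖hor (l • z) - a‖) (hC0 : 0 ≤ C)
    (hg : HasSphereGradWithin f g (closure (sphereDomain φ ε)) z)
    (hC : ∀ᶠ x in 𝓝[closure (sphereDomain φ ε)] z, |f x - f z| ≤ C * ‖x - z‖) :
    ‖g‖ ≤ 2 * (C + 1) := by
  by_contra hcon
  push Not at hcon
  have hPε := (mem_liftedBoundary.1 hT.mem).1
  have hhz : height z ≠ 0 := fun h => by rw [height_smul, h] at hPε; linarith
  set c := pt a (-1 * σ * R) with hc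
  have key : ∀ d : Amb n, height d = 0 → (inner ℝ d (l • z - c) : ℝ) ≠ 0 →
      |inner ℝ g d| ≤ 2 * (C + 1) * ‖d - (inner ℝ d z : ℝ) • z‖ := by
    intro d hd hne
    rcases hne.lt_or_gt with h | h
    · exact hg.abs_inner_le hn hε hLg hz hl hT hC0 hC hd h
    · have h1 := hg.abs_inner_le hn hε hLg hz hl hT hC0 hC (d := -d)
        (by rw [← neg_one_smul ℝ, height_smul, hd, mul_zero]) (by rw [inner_neg_left]; linarith)
      have e : -d - (inner ℝ (-d) z : ℝ) • z = -(d - (inner ℝ d z : ℝ) • z) := by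
        rw [inner_neg_left, neg_smul]; abel
      rwa [inner_neg_right, abs_neg, e, norm_neg] at h1
  set d₀ := g - (height g / height z) • z with hd₀
  set w : Amb n := pt (hor (l • z) - a) 0 with hw
  have hd₀h : height d₀ = 0 := by
    rw [hd₀, height_sub, height_smul, div_mul_cancel₀ _ hhz, sub_self]
  have hww : 0 < inner ℝ w (l • z - c) := by
    rw [inner_eq_hor, hw, hc, height_pt, zero_mul, add_zero, hor_pt, hor_sub, hor_pt,
      real_inner_self_eq_norm_sq]
    positivity
  have hgz : inner ℝ g z = 0 := hg.1
  have hzz : inner ℝ z z = 1 := by rw [real_inner_self_eq_norm_sq, hz, one_pow]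
  -- the tangential part of `d₀` is `g`
  have hd₀g : inner ℝ g d₀ = ‖g‖ ^ 2 := by
    rw [hd₀, inner_sub_right, inner_smul_right, hgz, real_inner_self_eq_norm_sq]; ring
  have hd₀t : d₀ - (inner ℝ d₀ z : ℝ) • z = g := by
    rw [hd₀, inner_sub_left, real_inner_smul_left, hgz, hzz, zero_sub, mul_one, neg_smul]; abel
  have hopen : ∀ᶠ η : ℝ in 𝓝 0, 2 * (C + 1) *
      ‖(d₀ + η • w) - (inner ℝ (d₀ + η • w) z : ℝ) • z‖ - inner ℝ g (d₀ + η • w) < 0 := by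
    refine (show Continuous fun η : ℝ => 2 * (C + 1) *
      ‖(d₀ + η • w) - (inner ℝ (d₀ + η • w) z : ℝ) • z‖ - inner ℝ g (d₀ + η • w) by
        fun_prop).continuousAt.eventually (gt_mem_nhds ?_)
    simp only [zero_smul, add_zero]
    rw [hd₀t, hd₀g]
    nlinarith
  -- a perturbation makes the direction transversal to the sphere
  obtain ⟨η, hη, hne⟩ : ∃ η : ℝ, 2 * (C + 1) *
      ‖(d₀ + η • w) - (inner ℝ (d₀ + η • w) z : ℝ) • z‖ - inner ℝ g (d₀ + η • w) < 0 ∧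
      (inner ℝ (d₀ + η • w) (l • z - c) : ℝ) ≠ 0 := by
    by_cases h0 : (inner ℝ d₀ (l • z - c) : ℝ) = 0
    · obtain ⟨η, h1, h2 : 0 < η⟩ :=
        ((hopen.filter_mono nhdsWithin_le_nhds).and (self_mem_nhdsWithin (s := Ioi (0 : ℝ)))).exists
      refine ⟨η, h1, ?_⟩
      rw [inner_add_left, h0, zero_add, real_inner_smul_left]
      positivity
    · exact ⟨0, hopen.self_of_nhds, by simpa using h0⟩
  have h1 := key (d₀ + η • w) (by rw [height_add, height_smul, hd₀h, hw, height_pt]; ring) hne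
  linarith [le_abs_self (inner ℝ g (d₀ + η • w))]

end Gradients

end HypFlow

theorem mainTheorem7 (n : ℕ) (hn : 1 ≤ n) (σ : ℝ) (hσ : σ ∈ Set.Ioo (-1 : ℝ) 1)
    (φ : HypFlow.Hor n → ℝ) (hφ : HypFlow.IsC11On φ (Metric.sphere 0 1))
    (ε₀ : ℝ) (hε₀ : 0 < ε₀) (v₀ : ℝ → HypFlow.Amb n → ℝ)
    (hreg : ∀ ε ∈ Set.Ioo 0 ε₀, HypFlow.IsC11On (v₀ ε) (HypFlow.sphereDomain φ ε))
    (hbdry : ∀ ε ∈ Set.Ioo 0 ε₀, ∀ z ∈ HypFlow.sphereBoundary φ ε,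
      Real.exp (v₀ ε z) • z ∈ HypFlow.liftedBoundary φ ε)
    (hlip : ∃ L : NNReal, ∀ ε ∈ Set.Ioo 0 ε₀,
      LipschitzOnWith L (v₀ ε) (closure (HypFlow.sphereDomain φ ε)))
    (hball : HypFlow.UniformLocalBall σ φ ε₀ v₀) :
    ∃ C : ℝ, ∃ ε₁ ∈ Set.Ioc 0 ε₀, ∀ ε ∈ Set.Ioo 0 ε₁, ∀ v : HypFlow.Amb n → ℝ → ℝ,
      HypFlow.IsRegularSolution σ φ ε (v₀ ε) v →
        (∀ z ∈ HypFlow.sphereDomain φ ε, ∀ t : ℝ, 0 ≤ t →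
          DifferentiableAt ℝ (HypFlow.radialExt fun x => v x t) z ∧
          ‖HypFlow.sphereGrad (fun x => v x t) z‖ ≤ C) ∧
        (∀ z ∈ HypFlow.sphereBoundary φ ε, ∀ t : ℝ, 0 ≤ t →
          (∀ᶠ x in nhdsWithin z (closure (HypFlow.sphereDomain φ ε)),
            |v x t - v z t| ≤ C * ‖x - z‖) ∧
          ∀ g : HypFlow.Amb n,
            HypFlow.HasSphereGradWithin (fun x => v x t) g
              (closure (HypFlow.sphereDomain φ ε)) z → ‖g‖ ≤ C) := by
  obtain ⟨C, d, hC, hd, ε₁, hε₁, key⟩ :=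
    HypFlow.exists_uniform_lipschitz hn hσ hφ hε₀ hbdry hlip hball
  obtain ⟨Lg, -, hLg⟩ := hφ.exists_gauge_lipschitz
  refine ⟨2 * (C + 1), ε₁, hε₁, fun ε hε v hv => ⟨fun z hz t ht => ?_, fun z hz t ht => ?_⟩⟩
  · have hdiff := hv.differentiableAt hn hε.1 hLg (hreg ε ⟨hε.1, hε.2.trans_le hε₁.2⟩) hz ht
    obtain ⟨hz1, hcz⟩ := (HypFlow.mem_sphereDomain hn hε.1).1 hz
    refine ⟨hdiff, (HypFlow.norm_sphereGrad_le hz1 hC hdiff ?_).trans (by linarith)⟩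
    filter_upwards [Metric.ball_mem_nhds z hd, (HypFlow.continuous_coneFun (ε := ε)
      hLg).continuousAt.eventually (lt_mem_nhds hcz)] with x hx hcx hx1
    exact (key ε hε).2 v hv t ht x ((HypFlow.mem_closure_sphereDomain hn hε.1 hLg).2
      ⟨hx1, hcx.le⟩) z (subset_closure hz) (mem_ball_iff_norm.1 hx).le
  · have hloc : ∀ᶠ x in nhdsWithin z (closure (HypFlow.sphereDomain φ ε)),
        |v x t - v z t| ≤ C * ‖x - z‖ := by
      filter_upwards [nhdsWithin_le_nhds (Metric.ball_mem_nhds z hd), self_mem_nhdsWithin]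
        with x hx hxm
      exact (key ε hε).2 v hv t ht x hxm z hz.1 (mem_ball_iff_norm.1 hx).le
    refine ⟨hloc.mono fun x hx => hx.trans ?_, fun g hg => ?_⟩
    · exact mul_le_mul_of_nonneg_right (by linarith) (norm_nonneg _)
    · obtain ⟨R, a, hT, ha⟩ := (key ε hε).1 _ (hv.boundary z hz t ht)
      exact hg.norm_le hn hε.1 hLg ((HypFlow.mem_sphereBoundary hn hε.1 hLg).1 hz).1
        (Real.exp_pos _) hT ha hC hloc
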